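/- Let $\kappa$ be a probability measure on $\mathbb{R}$ with $\kappa([0,c^*])=1$ for some $0<c^*<\infty$, and let $B>\tfrac14$. For $N\ge 1$ let $\mathcal{T}_N^2$ be the $N\times N$ discrete torus graph, i.e. the Cartesian product of two $N$-cycles (with $2N^2$ edges when $N\ge 3$). A path-flow is a finite nonnegative measure $\mu$ on the set of finite oriented paths in $\mathcal{T}_N^2$; its flow-volume is $f(e)=\int n(\sigma,e)\,\mu(d\sigma)$, where $n(\sigma,e)$ is the number of times the path $\sigma$ traverses the edge $e$ (in either direction). A standardized global flow is the (finite) flow-volume $\mathbf f$ of some path-flow $\mu$ under which, for every ordered pair $(v,w)$ of vertices (including $v=w$), the set of paths from $v$ to $w$ has measure $N^{-3}$. For an environment $\mathbf c=(c(e))_e$ put $$\mathrm{cost}_{(N)}(\mathbf c,B)=\inf\Big\{\sum_e c(e)f(e)^2 : \mathbf f \text{ a standardized global flow with } \max_e f(e)\le B\Big\}.$$ Let the $c(e)$ be i.i.d. with distribution $\kappa$, and write $\mathbb{E}$ for the corresponding expectation. Then for every $N\ge 3$ the infimum is over a nonempty set and $\mathrm{cost}_{(N)}(\mathbf c,B)$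 is integrable, and there is a constant $\gamma(\kappa,B)\in\mathbb{R}$, depending only on $\kappa$ and $B$, such that $$\lim_{N\to\infty} N^{-2}\,\mathbb{E}\,\mathrm{cost}_{(N)}(\mathbf c,B)=\gamma(\kappa,B).$$ -/

import Mathlib

open Set Filter Topology MeasureTheory
open scoped NNReal ENNReal

noncomputable section

namespace LatticeFlow

universe u

variable {V : Type u}

/-- The space of finite oriented paths `(v₀, v₁, …, v_k)` (with `k ≥ 0`) in a graph. A path is
recorded together with its pair (source, destination). -/
def FinitePath (G : SimpleGraph V) : Type u := Σ p : V × V, G.Walk p.1 p.2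

/-- The space of finite paths is countable when the graph is finite, and it is given the discrete
sigma-algebra. -/
instance (G : SimpleGraph V) : MeasurableSpace (FinitePath G) := ⊤

/-- The source (entrance) of a path. -/
def ent {G : SimpleGraph V} (σ : FinitePath G) : V := σ.1.1

/-- The destination (exit) of a path. -/
def exi {G : SimpleGraph V} (σ : FinitePath G) : V := σ.1.2

open Classical in
/-- `traversals σ e` is the number of times that the edge `e` occurs (in either direction)
in the path `σ`. -/
def traversals {G : SimpleGraph V} (σ : FinitePath G) (e : G.edgeSet) : ℕ :=
  σ.2.edges.count (e : Sym2 V)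

/-- The transportation measure of a path-flow `μ`: the push-forward of `μ` under
`σ ↦ (ent σ, exi σ)`. -/
def tra [MeasurableSpace V] {G : SimpleGraph V} (μ : Measure (FinitePath G)) : Measure (V × V) :=
  μ.map (fun σ => (ent σ, exi σ))

/-- The volume of flow across the edge `e` in the path-flow `μ` (a priori possibly infinite). -/
def flo {G : SimpleGraph V} (μ : Measure (FinitePath G)) (e : G.edgeSet) : ℝ≥0∞ :=
  ∫⁻ σ, (traversals σ e : ℝ≥0∞) ∂μ

/-- The cost `∑ₑ c(e) f(e)²` of the flow-volume `f` in the environment `c`. -/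
def cost {G : SimpleGraph V} [Fintype G.edgeSet] (f : G.edgeSet → ℝ≥0) (c : G.edgeSet → ℝ) : ℝ :=
  ∑ e, c e * (f e : ℝ) ^ 2

/-- The discrete `N × N` torus. -/
abbrev torus (N : ℕ) : SimpleGraph (Fin N × Fin N) :=
  (SimpleGraph.cycleGraph N).boxProd (SimpleGraph.cycleGraph N)

/-- The edge set of the discrete `N × N` torus (it has `2 N ^ 2` elements when `3 ≤ N`). -/
abbrev TorusEdge (N : ℕ) : Type := (torus N).edgeSet

instance (N : ℕ) : Fintype (TorusEdge N) := Fintype.ofFinite _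

/-- A standardized global flow: the flow-volume of some path-flow (finite measure on paths) which
sends volume `N⁻³` between every ordered pair of vertices of the torus. -/
def IsStandardizedGlobalFlow (N : ℕ) (f : TorusEdge N → ℝ≥0) : Prop :=
  ∃ μ : Measure (FinitePath (torus N)), IsFiniteMeasure μ ∧
    (∀ v w : Fin N × Fin N, tra μ {(v, w)} = ((N : ℝ≥0∞) ^ 3)⁻¹) ∧
    ∀ e, flo μ e = (f e : ℝ≥0∞)

/-- The standardized global flows on the `N × N` torus which carry at most `B` on each edge. -/
def feasibleFlows (N : ℕ) (B : ℝ) : Set (TorusEdge N → ℝ≥0) :=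
  {f | IsStandardizedGlobalFlow N f ∧ ∀ e, (f e : ℝ) ≤ B}

/-- The infimum cost, in the environment `c`, of a standardized global flow on the `N × N` torus
which carries at most `B` on each edge. -/
def costN (N : ℕ) (c : TorusEdge N → ℝ) (B : ℝ) : ℝ :=
  sInf ((fun f => cost f c) '' feasibleFlows N B)

/-- The law of the random environment: the cost-factors of the edges of the `N × N` torus are
independent with common distribution `κ`. -/
def environment (N : ℕ) (κ : Measure ℝ) : Measure (TorusEdge N → ℝ) :=
  Measure.pi (fun _ => κ)

end LatticeFlow

end

/-! The expected cost per vertex is almost decreasing: for large `M` and `N ≥ M²`, nearly optimal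
flows on the `M`-torus can be assembled into a flow on the `N`-torus whose expected cost per vertex
is hardly larger (`exists_integral_infCost_le`). A bounded sequence with this property converges
(`exists_tendsto_of_eventually_le`).

Cost-factors are nonnegative, so only the net flow of each source-destination pair matters, and
path-flows may be replaced by families of edge functions with prescribed divergences
(`exists_multiflow`, `exists_standardizedGlobalFlow`). Each `M × M` window of the large torus sees
an environment with the law of that of the `M`-torus, and is given a nearly optimal flow for it.
Averaging over the windows containing an edge does not raise the cost, since the square is convex.
The difficulty is that the flows of different windows do not fit together. Three devices overcome
it.

Sources and destinations are lumped into `K × K` cells, so that the number of commodities does not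
grow with `M`; going back to single vertices costs extra volume of order `1/K`
(`exists_multiflow_of_partition`).

Two coarse flows of the same commodity differ by a circulation, which has a Lipschitz stream
function. Divided by `M`, these functions form a compact family, so coarse flows fall into a number
of classes independent of `M`, within which stream functions differ by at most `η M`
(`exists_classes`). Averaging stream functions rather than flows then glues the differences into an
exact circulation, with a small error (`exists_glued_circulation`).

All windows may use one deterministic class: the infimum cost within a class is a function of
independent variables with bounded differences, so it fluctuates by `O(M)`, against a total of order
`M²` (`exists_selection_in_class`).

A reference flow of the class is carried to the large torus by smoothing and bilinear interpolation
(`abs_rescale_smooth_sub_le`). The small excess over `B` is removed by mixing in some of the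
shortest-path flow, whose volumes are at most `1/4`; this is where `B > 1/4` enters. -/

open Set Filter Topology MeasureTheory
open scoped NNReal ENNReal

noncomputable section

namespace LatticeFlow

/-! ### Path-flows versus antisymmetric net flows -/

section WalkFlows

variable {V : Type*} [DecidableEq V] {G : SimpleGraph V}

/-- The ordered pairs of vertices traversed by a walk. -/
def arcs {u v : V} (p : G.Walk u v) : List (V × V) := p.darts.map (fun d => d.toProd)

/-- The net number of times that a walk steps from `a` to `b`. -/
def netFlow {u v : V} (p : G.Walk u v) (a b : V) : ℝ :=
  ((arcs p).count (a, b) : ℝ) - ((arcs p).count (b, a) : ℝ)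

lemma netFlow_antisymm {u v : V} (p : G.Walk u v) (a b : V) :
    netFlow p a b = - netFlow p b a := by
  simp [netFlow]

lemma netFlow_cons {u v w : V} (h : G.Adj u v) (p : G.Walk v w) (a b : V) :
    netFlow (SimpleGraph.Walk.cons h p) a b =
      (if a = u ∧ b = v then 1 else 0) - (if a = v ∧ b = u then 1 else 0) + netFlow p a b := by
  simp only [netFlow, arcs, SimpleGraph.Walk.darts_cons, List.map_cons, List.count_cons]
  have h1 : (((u, v) : V × V) == (a, b)) = decide (a = u ∧ b = v) := by
    rw [Bool.eq_iff_iff]; simp only [beq_iff_eq, Prod.mk.injEq, decide_eq_true_eq]; tauto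
  have h2 : (((u, v) : V × V) == (b, a)) = decide (a = v ∧ b = u) := by
    rw [Bool.eq_iff_iff]; simp only [beq_iff_eq, Prod.mk.injEq, decide_eq_true_eq]; tauto
  simp only [h1, h2, decide_eq_true_eq]
  push_cast
  ring

lemma sum_netFlow [Fintype V] {u v : V} (p : G.Walk u v) (a : V) :
    ∑ b, netFlow p a b = (if a = u then 1 else 0) - (if a = v then 1 else 0) := by
  induction p with
  | nil => simp [netFlow, arcs]
  | @cons u v w h p ih =>
    simp only [netFlow_cons, Finset.sum_add_distrib, Finset.sum_sub_distrib, ih]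
    have h1 : ∑ b, (if a = u ∧ b = v then (1 : ℝ) else 0) = if a = u then 1 else 0 := by
      by_cases ha : a = u <;> simp [ha]
    have h2 : ∑ b, (if a = v ∧ b = u then (1 : ℝ) else 0) = if a = v then 1 else 0 := by
      by_cases ha : a = v <;> simp [ha]
    rw [h1, h2]; ring

lemma count_edges_eq {u v : V} (p : G.Walk u v) {a b : V} (hab : a ≠ b) :
    p.edges.count s(a, b) = (arcs p).count (a, b) + (arcs p).count (b, a) := by
  induction p with
  | nil => simp [arcs]
  | @cons u v w h p ih =>
    simp only [arcs] at ih
    simp only [SimpleGraph.Walk.edges_cons, arcs, SimpleGraph.Walk.darts_cons, List.map_cons,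
      List.count_cons, ih]
    have h1 : (((u, v) : V × V) == (a, b)) = decide (u = a ∧ v = b) := by
      rw [Bool.eq_iff_iff]; simp
    have h2 : (((u, v) : V × V) == (b, a)) = decide (u = b ∧ v = a) := by
      rw [Bool.eq_iff_iff]; simp
    have h3 : (s(u, v) == s(a, b)) = decide ((u = a ∧ v = b) ∨ (u = b ∧ v = a)) := by
      rw [Bool.eq_iff_iff]; simp
    simp only [h1, h2, h3, decide_eq_true_eq]
    by_cases hA : u = a ∧ v = b
    · have : ¬ (u = b ∧ v = a) := fun h => hab (hA.1.symm.trans h.1)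
      simp [hA]; grind
    · by_cases hB : u = b ∧ v = a <;> (simp [hA, hB]; try grind)

lemma abs_netFlow_le {u v : V} (p : G.Walk u v) {a b : V} (hab : a ≠ b) :
    |netFlow p a b| ≤ (p.edges.count s(a, b) : ℝ) := by
  rw [count_edges_eq p hab, netFlow, abs_le]
  push_cast
  constructor <;> linarith [Nat.cast_nonneg (α := ℝ) ((arcs p).count (a, b)),
    Nat.cast_nonneg (α := ℝ) ((arcs p).count (b, a))]

lemma netFlow_eq_zero_of_not_adj {u v : V} (p : G.Walk u v) {a b : V} (hab : ¬ G.Adj a b) :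
    netFlow p a b = 0 := by
  have h1 : (arcs p).count (a, b) = 0 := by
    rw [List.count_eq_zero]
    intro h
    obtain ⟨d, -, hd⟩ := List.mem_map.1 h
    exact hab (by have := d.adj; rw [hd] at this; exact this)
  have h2 : (arcs p).count (b, a) = 0 := by
    rw [List.count_eq_zero]
    intro h
    obtain ⟨d, -, hd⟩ := List.mem_map.1 h
    exact hab (by have := d.adj; rw [hd] at this; exact this.symm)
  simp [netFlow, h1, h2]

lemma traversals_eq (σ : FinitePath G) {a b : V} (h : G.Adj a b) :
    traversals σ ⟨s(a, b), h⟩ = σ.2.edges.count s(a, b) := by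
  unfold traversals
  congr!

/-- The set of paths from `v` to `w`. -/
def pathsBetween (G : SimpleGraph V) (v w : V) : Set (FinitePath G) :=
  {σ | ent σ = v ∧ exi σ = w}

/-- The net flow of each source-destination pair in a path-flow with finite volumes. -/
theorem exists_pairFlow_of_pathFlow [Fintype V] (μ : Measure (FinitePath G)) [IsFiniteMeasure μ]
    (f : G.edgeSet → ℝ≥0) (hf : ∀ e, flo μ e = f e) :
    ∃ g : V → V → V → V → ℝ, (∀ v w a b, g v w a b = - g v w b a) ∧
      (∀ v w a, ∑ b, g v w a b =
        μ.real (pathsBetween G v w) * ((if a = v then 1 else 0) - (if a = w then 1 else 0))) ∧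
      (∀ v w a b, ¬ G.Adj a b → g v w a b = 0) ∧
      ∀ a b (h : G.Adj a b), ∑ v, ∑ w, |g v w a b| ≤ f ⟨s(a, b), h⟩ := by
  classical
  have hms : ∀ s : Set (FinitePath G), MeasurableSet s := fun s => trivial
  have hmf : ∀ {β : Type} [MeasurableSpace β] (g : FinitePath G → β), Measurable g :=
    fun g s _ => hms _
  have htr : ∀ e : G.edgeSet, Integrable (fun σ => (traversals σ e : ℝ)) μ := by
    intro e
    refine ⟨(hmf _).aestronglyMeasurable, ?_⟩
    rw [hasFiniteIntegral_iff_norm]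
    calc ∫⁻ σ, ENNReal.ofReal ‖(traversals σ e : ℝ)‖ ∂μ = flo μ e := by
          unfold flo; congr 1; ext σ; simp
      _ < ⊤ := by rw [hf]; exact ENNReal.coe_lt_top
  have hint : ∀ e : G.edgeSet, ∫ σ, (traversals σ e : ℝ) ∂μ = f e := by
    intro e
    rw [integral_eq_lintegral_of_nonneg_ae (by filter_upwards with σ using by positivity)
      (hmf _).aestronglyMeasurable]
    have : ∫⁻ σ, ENNReal.ofReal (traversals σ e : ℝ) ∂μ = flo μ e := by
      unfold flo; congr 1; ext σ; simp
    rw [this, hf]; rfl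
  have hle : ∀ a b (h : G.Adj a b) (σ : FinitePath G),
      |netFlow σ.2 a b| ≤ (traversals σ ⟨s(a, b), h⟩ : ℝ) := by
    intro a b h σ
    rw [traversals_eq]; exact abs_netFlow_le _ h.ne
  have hnet : ∀ a b, Integrable (fun σ : FinitePath G => netFlow σ.2 a b) μ := by
    intro a b
    by_cases h : G.Adj a b
    · exact (htr ⟨s(a, b), h⟩).mono' (hmf _).aestronglyMeasurable
        (by filter_upwards with σ using hle a b h σ)
    · simp [netFlow_eq_zero_of_not_adj _ h]
  -- Traversals in opposite directions cancel within a pair, which is why only an inequality with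
  -- `f` survives.
  refine ⟨fun v w a b => ∫ σ in pathsBetween G v w, netFlow σ.2 a b ∂μ, ?_, ?_, ?_, ?_⟩
  · intro v w a b
    rw [← integral_neg]
    exact integral_congr_ae (Eventually.of_forall fun σ => netFlow_antisymm _ _ _)
  · intro v w a
    rw [← integral_finsetSum _ fun b _ => (hnet a b).integrableOn]
    have : ∀ σ ∈ pathsBetween G v w, ∑ b, netFlow σ.2 a b
        = ((if a = v then 1 else 0) - (if a = w then 1 else 0) : ℝ) := by
      intro σ hσ
      rw [sum_netFlow, ← hσ.1, ← hσ.2]; rfl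
    rw [setIntegral_congr_fun (hms _) this]
    simp
  · intro v w a b h
    simp [netFlow_eq_zero_of_not_adj _ h]
  · intro a b h
    have h1 : ∀ v w, |∫ σ in pathsBetween G v w, netFlow σ.2 a b ∂μ| ≤
        ∫ σ in pathsBetween G v w, (traversals σ ⟨s(a, b), h⟩ : ℝ) ∂μ := by
      intro v w
      refine (abs_integral_le_integral_abs).trans ?_
      exact integral_mono (hnet a b).abs.integrableOn (htr _).integrableOn
        (fun σ => hle a b h σ)
    calc _ ≤ ∑ v, ∑ w, ∫ σ in pathsBetween G v w, (traversals σ ⟨s(a, b), h⟩ : ℝ) ∂μ :=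
          Finset.sum_le_sum fun v _ => Finset.sum_le_sum fun w _ => h1 v w
      _ = ∑ q : V × V, ∫ σ in pathsBetween G q.1 q.2,
            (traversals σ ⟨s(a, b), h⟩ : ℝ) ∂μ := by
          rw [Fintype.sum_prod_type]
      _ = ∫ σ in ⋃ q ∈ (Finset.univ : Finset (V × V)), pathsBetween G q.1 q.2,
            (traversals σ ⟨s(a, b), h⟩ : ℝ) ∂μ := by
          rw [integral_biUnion_finset _ (fun _ _ => hms _) ?_ (fun _ _ => (htr _).integrableOn)]
          intro q _ q' _ hqq
          refine Set.disjoint_left.2 fun σ h1 h2 => hqq ?_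
          exact Prod.ext (h1.1.symm.trans h2.1) (h1.2.symm.trans h2.2)
      _ = ∫ σ, (traversals σ ⟨s(a, b), h⟩ : ℝ) ∂μ := by
          have : (⋃ q ∈ (Finset.univ : Finset (V × V)), pathsBetween G q.1 q.2) = univ := by
            ext σ
            simp [pathsBetween]
          rw [this, setIntegral_univ]
      _ = f ⟨s(a, b), h⟩ := hint _

/-- A path along which `g` is positive joins the source of a flow to its sink. -/
lemma exists_positive_path [Fintype V] (g : V → V → ℝ) (hanti : ∀ a b, g a b = - g b a)
    (hadj : ∀ a b, ¬ G.Adj a b → g a b = 0) {v w : V} {m : ℝ} (hm : 0 < m)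
    (hdiv : ∀ a, ∑ b, g a b = m * ((if a = v then 1 else 0) - (if a = w then 1 else 0))) :
    ∃ p : G.Walk v w, p.IsPath ∧ ∀ d ∈ p.darts, 0 < g d.fst d.snd := by
  classical
  have key : ∃ p : G.Walk v w, ∀ d ∈ p.darts, 0 < g d.fst d.snd := by
    by_contra hcon
    -- The set reachable along positive arcs. If it misses `w`, its net outflow is `m > 0`, although
    -- no positive arc leaves it.
    let S : Finset V := Finset.univ.filter fun x =>
      ∃ p : G.Walk v x, ∀ d ∈ p.darts, 0 < g d.fst d.snd
    have hvS : v ∈ S := by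
      simp only [S, Finset.mem_filter, Finset.mem_univ, true_and]
      exact ⟨SimpleGraph.Walk.nil, by simp⟩
    have hwS : w ∉ S := by
      simp only [S, Finset.mem_filter, Finset.mem_univ, true_and]
      exact hcon
    have hout : ∀ a ∈ S, ∀ b ∉ S, g a b ≤ 0 := by
      intro a ha b hb
      by_contra! hlt
      apply hb
      simp only [S, Finset.mem_filter, Finset.mem_univ, true_and] at ha ⊢
      obtain ⟨p, hp⟩ := ha
      have hA : G.Adj a b := by
        by_contra hn; rw [hadj a b hn] at hlt; exact lt_irrefl _ hlt
      refine ⟨p.concat hA, ?_⟩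
      intro d hd
      rw [SimpleGraph.Walk.darts_concat, List.concat_eq_append, List.mem_append] at hd
      rcases hd with hd | hd
      · exact hp d hd
      · simp only [List.mem_singleton] at hd
        rw [hd]; exact hlt
    have h1 : ∑ a ∈ S, ∑ b, g a b = m := by
      simp only [hdiv, ← Finset.mul_sum, Finset.sum_sub_distrib, Finset.sum_ite_eq']
      simp [hvS, hwS]
    have h2 : ∑ a ∈ S, ∑ b ∈ S, g a b = 0 := by
      have : ∑ a ∈ S, ∑ b ∈ S, g a b = - ∑ a ∈ S, ∑ b ∈ S, g a b := by
        conv_lhs => rw [Finset.sum_comm]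
        rw [← Finset.sum_neg_distrib]
        refine Finset.sum_congr rfl fun a _ => ?_
        rw [← Finset.sum_neg_distrib]
        exact Finset.sum_congr rfl fun b _ => hanti b a
      linarith
    have h3 : ∑ a ∈ S, ∑ b, g a b = ∑ a ∈ S, ∑ b ∈ S, g a b + ∑ a ∈ S, ∑ b ∈ Sᶜ, g a b := by
      rw [← Finset.sum_add_distrib]
      exact Finset.sum_congr rfl fun a _ => (Finset.sum_add_sum_compl S _).symm
    have h4 : ∑ a ∈ S, ∑ b ∈ Sᶜ, g a b ≤ 0 :=
      Finset.sum_nonpos fun a ha => Finset.sum_nonpos fun b hb =>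
        hout a ha b (Finset.mem_compl.1 hb)
    linarith
  obtain ⟨p, hp⟩ := key
  exact ⟨p.bypass, p.bypass_isPath, fun d hd => hp d (p.darts_bypass_subset_darts hd)⟩

/-- Flow decomposition: a flow from `v` to `w` dominates a path-flow from `v` to `w`. -/
theorem exists_pathFlow_of_flow [Fintype V] (g : V → V → ℝ) (hanti : ∀ a b, g a b = - g b a)
    (hadj : ∀ a b, ¬ G.Adj a b → g a b = 0) (v w : V) (m : ℝ) (hm : 0 ≤ m)
    (hdiv : ∀ a, ∑ b, g a b = m * ((if a = v then 1 else 0) - (if a = w then 1 else 0))) :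
    ∃ μ : Measure (FinitePath G), IsFiniteMeasure μ ∧
      μ (pathsBetween G v w) = ENNReal.ofReal m ∧ μ (pathsBetween G v w)ᶜ = 0 ∧
      ∀ a b (h : G.Adj a b), flo μ ⟨s(a, b), h⟩ ≤ ENNReal.ofReal |g a b| := by
  classical
  have hms : ∀ s : Set (FinitePath G), MeasurableSet s := fun s => trivial
  have hmf : ∀ {β : Type} [MeasurableSpace β] (g : FinitePath G → β), Measurable g :=
    fun g s _ => hms _
  -- Induction on the number of positive arcs. As much as possible of a positive path is subtracted:
  -- either the whole mass `m` is used up or some arc drops to zero, and no new positive arc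
  -- appears. Circulations left at the end are discarded.
  induction hn : (Finset.univ.filter fun q : V × V => 0 < g q.1 q.2).card using
    Nat.strong_induction_on generalizing g m with
  | _ n ih =>
  rcases hm.eq_or_lt with rfl | hm
  · exact ⟨0, inferInstance, by simp, by simp, by simp [flo]⟩
  by_cases hvw : v = w
  -- The divergence is zero here; the constant path carries the mass and uses no edge.
  · subst hvw
    let σ : FinitePath G := ⟨(v, v), SimpleGraph.Walk.nil⟩
    have hσ : σ ∈ pathsBetween G v v := ⟨rfl, rfl⟩
    refine ⟨ENNReal.ofReal m • Measure.dirac σ, ?_, ?_, ?_, ?_⟩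
    · exact Measure.smul_finite _ ENNReal.ofReal_ne_top
    · simp [Measure.dirac_apply' _ (hms _), hσ]
    · simp [Measure.dirac_apply' _ (hms _), hσ]
    · intro a b h
      unfold flo
      rw [lintegral_smul_measure, lintegral_dirac' _ (hmf _), traversals_eq]
      simp [σ]
  · obtain ⟨p, hp, hpos⟩ := exists_positive_path g hanti hadj hm hdiv
    have harc : ∀ a b, (a, b) ∈ arcs p → 0 < g a b := by
      intro a b hab
      obtain ⟨d, hd, he⟩ := List.mem_map.1 hab
      have := hpos d hd
      have h1 : d.fst = a := congrArg Prod.fst he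
      have h2 : d.snd = b := congrArg Prod.snd he
      rwa [h1, h2] at this
    have hne : ((arcs p).toFinset.image fun q => g q.1 q.2).Nonempty := by
      rw [Finset.image_nonempty]
      cases p with
      | nil => exact absurd rfl hvw
      | cons h p => simp [arcs]
    set δ₀ := ((arcs p).toFinset.image fun q => g q.1 q.2).min' hne with hδ₀
    have hδ₀mem := Finset.min'_mem _ hne
    rw [← hδ₀] at hδ₀mem
    obtain ⟨q₀, hq₀, hgq₀⟩ := Finset.mem_image.1 hδ₀mem
    have hδle : ∀ a b, (a, b) ∈ arcs p → δ₀ ≤ g a b := by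
      intro a b hab
      exact Finset.min'_le _ _ (Finset.mem_image.2 ⟨(a, b), List.mem_toFinset.2 hab, rfl⟩)
    set δ := min m δ₀ with hδ
    have hδ₀pos : 0 < δ₀ := by
      rw [← hgq₀]; exact harc q₀.1 q₀.2 (List.mem_toFinset.1 hq₀)
    have hδpos : 0 < δ := lt_min hm hδ₀pos
    -- the net flow of the path on each arc
    have hcnt : ∀ a b, (a, b) ∈ arcs p →
        netFlow p a b = 1 ∧ p.edges.count s(a, b) = 1 := by
      intro a b hab
      have hgab := harc a b hab
      have hne : a ≠ b := by
        rintro rfl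
        have := hanti a a
        linarith
      have h0 : (arcs p).count (b, a) = 0 := by
        rw [List.count_eq_zero]
        intro h
        have := harc b a h
        have := hanti a b
        linarith
      have h1 := count_edges_eq p hne
      have h2 : p.edges.count s(a, b) ≤ 1 :=
        List.nodup_iff_count_le_one.1 hp.isTrail.edges_nodup _
      have h3 : 0 < (arcs p).count (a, b) := List.count_pos_iff.2 hab
      have h4 : (arcs p).count (a, b) = 1 := by omega
      refine ⟨by simp [netFlow, h0, h4], by omega⟩
    have hcnt0 : ∀ a b, a ≠ b → (a, b) ∉ arcs p → (b, a) ∉ arcs p →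
        netFlow p a b = 0 ∧ p.edges.count s(a, b) = 0 := by
      intro a b hne h1 h2
      have h1' := List.count_eq_zero.2 h1
      have h2' := List.count_eq_zero.2 h2
      refine ⟨by simp [netFlow, h1', h2'], by rw [count_edges_eq p hne]; omega⟩
    set g' : V → V → ℝ := fun a b => g a b - δ * netFlow p a b with hg'
    -- The path runs along arcs where `g ≥ δ`, once each, so what it takes from `|g|` is exactly its
    -- own volume.
    have habs : ∀ a b, a ≠ b → |g' a b| + δ * (p.edges.count s(a, b) : ℝ) ≤ |g a b| := by
      have main : ∀ a b, (a, b) ∈ arcs p →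
          |g' a b| + δ * (p.edges.count s(a, b) : ℝ) ≤ |g a b| := by
        intro a b hab
        obtain ⟨h1, h2⟩ := hcnt a b hab
        have h3 := hδle a b hab
        have h4 : δ ≤ δ₀ := min_le_right _ _
        simp only [hg', h1, h2]
        rw [abs_of_nonneg (by linarith), abs_of_nonneg (by linarith)]
        push_cast; linarith
      intro a b hne
      by_cases h1 : (a, b) ∈ arcs p
      · exact main a b h1
      by_cases h2 : (b, a) ∈ arcs p
      · have := main b a h2
        have e1 : g' b a = - g' a b := by
          simp only [hg']; rw [hanti b a, netFlow_antisymm p b a]; ring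
        rw [e1, abs_neg, hanti b a, abs_neg, Sym2.eq_swap] at this
        exact this
      · obtain ⟨h3, h4⟩ := hcnt0 a b hne h1 h2
        simp [hg', h3, h4]
    have hpos' : ∀ a b, 0 < g' a b → 0 < g a b := by
      intro a b h
      by_contra! hcon
      by_cases h1 : (a, b) ∈ arcs p
      · exact absurd (harc a b h1) (not_lt.2 hcon)
      have hne : a ≠ b := by
        rintro rfl
        have h1 := hanti a a
        have h2 := netFlow_antisymm p a a
        simp only [hg'] at h
        have : netFlow p a a = 0 := by linarith
        rw [this] at h; linarith
      by_cases h2 : (b, a) ∈ arcs p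
      · have e1 := (hcnt b a h2).1
        have e2 := hδle b a h2
        have h4 : δ ≤ δ₀ := min_le_right _ _
        simp only [hg'] at h
        rw [netFlow_antisymm, e1, hanti a b] at h
        linarith
      · have := (hcnt0 a b hne h1 h2).1
        simp only [hg', this] at h
        linarith
    have hdec : δ = δ₀ → (Finset.univ.filter fun q : V × V => 0 < g' q.1 q.2).card < n := by
      intro hδe
      rw [← hn]
      refine Finset.card_lt_card (Finset.ssubset_iff_subset_ne.2 ⟨?_, ?_⟩)
      · intro q hq
        simp only [Finset.mem_filter, Finset.mem_univ, true_and] at hq ⊢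
        exact hpos' _ _ hq
      · intro heq
        have hmem : q₀ ∈ Finset.univ.filter fun q : V × V => 0 < g q.1 q.2 := by
          simp only [Finset.mem_filter, Finset.mem_univ, true_and]
          rw [hgq₀]; exact hδ₀pos
        rw [← heq] at hmem
        simp only [Finset.mem_filter, Finset.mem_univ, true_and, hg'] at hmem
        rw [(hcnt q₀.1 q₀.2 (List.mem_toFinset.1 hq₀)).1, hgq₀, hδe] at hmem
        linarith
    have hanti' : ∀ a b, g' a b = - g' b a := by
      intro a b
      simp only [hg']; rw [hanti a b, netFlow_antisymm p a b]; ring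
    have hadj' : ∀ a b, ¬ G.Adj a b → g' a b = 0 := by
      intro a b h
      simp [hg', hadj a b h, netFlow_eq_zero_of_not_adj p h]
    have hdiv' : ∀ a, ∑ b, g' a b =
        (m - δ) * ((if a = v then 1 else 0) - (if a = w then 1 else 0)) := by
      intro a
      simp only [hg', Finset.sum_sub_distrib, ← Finset.mul_sum, hdiv, sum_netFlow]
      ring
    have hm' : 0 ≤ m - δ := sub_nonneg.2 (min_le_left _ _)
    have hrec : ∃ μ : Measure (FinitePath G), IsFiniteMeasure μ ∧
        μ (pathsBetween G v w) = ENNReal.ofReal (m - δ) ∧ μ (pathsBetween G v w)ᶜ = 0 ∧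
        ∀ a b (h : G.Adj a b), flo μ ⟨s(a, b), h⟩ ≤ ENNReal.ofReal |g' a b| := by
      rcases min_choice m δ₀ with h | h
      · have h0 : m - δ = 0 := by rw [hδ, h]; ring
        rw [h0]
        exact ⟨0, inferInstance, by simp, by simp, by simp [flo]⟩
      · exact ih _ (hdec h) g' hanti' hadj' (m - δ) hm' hdiv' rfl
    obtain ⟨μ, hμf, hμ1, hμ2, hμ3⟩ := hrec
    let σ : FinitePath G := ⟨(v, w), p⟩
    have hσ : σ ∈ pathsBetween G v w := ⟨rfl, rfl⟩
    have hfin : IsFiniteMeasure (ENNReal.ofReal δ • Measure.dirac σ) :=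
      Measure.smul_finite _ ENNReal.ofReal_ne_top
    refine ⟨μ + ENNReal.ofReal δ • Measure.dirac σ, inferInstance, ?_, ?_, ?_⟩
    · rw [Measure.add_apply, hμ1, Measure.smul_apply, Measure.dirac_apply' _ (hms _)]
      simp only [hσ, indicator_of_mem, Pi.one_apply, smul_eq_mul, mul_one]
      rw [← ENNReal.ofReal_add hm' hδpos.le]
      congr 1; ring
    · rw [Measure.add_apply, hμ2, Measure.smul_apply, Measure.dirac_apply' _ (hms _)]
      simp [hσ]
    · intro a b h
      have e1 : flo (μ + ENNReal.ofReal δ • Measure.dirac σ) ⟨s(a, b), h⟩ =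
          flo μ ⟨s(a, b), h⟩ + ENNReal.ofReal δ * (p.edges.count s(a, b) : ℝ≥0∞) := by
        unfold flo
        rw [lintegral_add_measure, lintegral_smul_measure, lintegral_dirac' _ (hmf _),
          traversals_eq]
        rfl
      rw [e1]
      calc _ ≤ ENNReal.ofReal |g' a b| + ENNReal.ofReal (δ * (p.edges.count s(a, b) : ℝ)) := by
            gcongr
            · exact hμ3 a b h
            · rw [ENNReal.ofReal_mul hδpos.le]; simp
        _ = ENNReal.ofReal (|g' a b| + δ * (p.edges.count s(a, b) : ℝ)) :=
            (ENNReal.ofReal_add (abs_nonneg _) (by positivity)).symm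
        _ ≤ ENNReal.ofReal |g a b| := ENNReal.ofReal_le_ofReal (habs a b h.ne)

end WalkFlows

/-! ### Multiflows on the torus in coordinates -/

section TorusFlows

/-- The vertices of the `N × N` torus. -/
abbrev Pt (N : ℕ) : Type := ZMod N × ZMod N

/-- The oriented edges of the torus: `(false, p)` goes from `p` one step to the right and
`(true, p)` goes from `p` one step up. -/
abbrev Ed (N : ℕ) : Type := Bool × Pt N

/-- The end of an oriented edge. -/
def tgt {N : ℕ} (e : Ed N) : Pt N :=
  if e.1 then (e.2.1, e.2.2 + 1) else (e.2.1 + 1, e.2.2)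

/-- The divergence of an edge function. -/
def dv {N : ℕ} (F : Ed N → ℝ) (p : Pt N) : ℝ :=
  F (false, p) - F (false, (p.1 - 1, p.2)) + (F (true, p) - F (true, (p.1, p.2 - 1)))

/-- The identification of the two descriptions of the vertices of the torus. -/
def vert (N : ℕ) [NeZero N] : Pt N ≃ Fin N × Fin N :=
  Equiv.prodCongr (ZMod.finEquiv N).symm.toEquiv (ZMod.finEquiv N).symm.toEquiv

lemma measurable_finitePath {V β : Type*} {G : SimpleGraph V} [MeasurableSpace β]
    (g : FinitePath G → β) : Measurable g :=
  fun s _ => show MeasurableSet[⊤] (g ⁻¹' s) from MeasurableSpace.measurableSet_top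

lemma two_ne_zero_zmod {N : ℕ} (hN : 3 ≤ N) : (1 + 1 : ZMod N) ≠ 0 := by
  intro h
  have h2 : ((2 : ℕ) : ZMod N) = 0 := by push_cast; rw [← h]; ring
  rw [ZMod.natCast_eq_zero_iff] at h2
  exact absurd (Nat.le_of_dvd (by norm_num) h2) (by omega)

lemma one_ne_zero_zmod {N : ℕ} (hN : 3 ≤ N) : (1 : ZMod N) ≠ 0 := by
  intro h
  have h2 : ((1 : ℕ) : ZMod N) = 0 := by push_cast; rw [← h]
  rw [ZMod.natCast_eq_zero_iff] at h2
  exact absurd (Nat.le_of_dvd (by norm_num) h2) (by omega)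

variable {N : ℕ} [NeZero N]

lemma cycleGraph_adj_iff (hN : 3 ≤ N) (a b : ZMod N) :
    (SimpleGraph.cycleGraph N).Adj ((ZMod.finEquiv N).symm a) ((ZMod.finEquiv N).symm b) ↔
      b = a + 1 ∨ a = b + 1 := by
  obtain ⟨n, rfl⟩ : ∃ n, N = n + 2 := ⟨N - 2, by omega⟩
  refine (SimpleGraph.cycleGraph_adj (n := n) (u := (ZMod.finEquiv (n + 2)).symm a)
    (v := (ZMod.finEquiv (n + 2)).symm b)).trans ?_
  constructor
  · rintro (h | h)
    · right
      have h' : (a - b : ZMod (n + 2)) = 1 := h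
      rw [← h']; ring
    · left
      have h' : (b - a : ZMod (n + 2)) = 1 := h
      rw [← h']; ring
  · rintro (h | h)
    · right
      show (b - a : ZMod (n + 2)) = 1
      rw [h]; ring
    · left
      show (a - b : ZMod (n + 2)) = 1
      rw [h]; ring

lemma torus_adj_iff (hN : 3 ≤ N) (p q : Pt N) :
    (torus N).Adj (vert N p) (vert N q) ↔
      ((q.1 = p.1 + 1 ∨ p.1 = q.1 + 1) ∧ p.2 = q.2) ∨
      ((q.2 = p.2 + 1 ∨ p.2 = q.2 + 1) ∧ p.1 = q.1) := by
  rw [SimpleGraph.boxProd_adj]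
  simp only [vert, Equiv.prodCongr_apply, Prod.map_fst, Prod.map_snd, RingEquiv.toEquiv_eq_coe,
    EquivLike.coe_coe]
  rw [cycleGraph_adj_iff hN, cycleGraph_adj_iff hN]
  simp

lemma torus_adj_tgt (hN : 3 ≤ N) (e : Ed N) : (torus N).Adj (vert N e.2) (vert N (tgt e)) := by
  rw [torus_adj_iff hN]
  obtain ⟨d, p⟩ := e
  cases d <;> simp [tgt]

lemma tgt_injective {N : ℕ} (hN : 3 ≤ N) {e e' : Ed N} (h1 : e.2 = e'.2) (h2 : tgt e = tgt e') :
    e = e' := by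
  have h := one_ne_zero_zmod hN
  obtain ⟨d, x, y⟩ := e
  obtain ⟨d', x', y'⟩ := e'
  cases d <;> cases d' <;> simp_all [tgt]

/-- No two oriented edges are reverses of each other, since neither one step nor two steps close up
when `N ≥ 3`. This makes the undirected edges correspond bijectively to `Ed N`. -/
lemma tgt_ne_swap {N : ℕ} (hN : 3 ≤ N) {e e' : Ed N} (h1 : e.2 = tgt e') : tgt e ≠ e'.2 := by
  have h := one_ne_zero_zmod hN
  have h' := two_ne_zero_zmod hN
  obtain ⟨d, x, y⟩ := e
  obtain ⟨d', x', y'⟩ := e'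
  cases d <;> cases d' <;> simp_all [tgt, add_assoc]

/-- The edges of the torus graph are the oriented edges. -/
def edgeEquiv (hN : 3 ≤ N) : Ed N ≃ TorusEdge N :=
  Equiv.ofBijective (fun e => ⟨s(vert N e.2, vert N (tgt e)), torus_adj_tgt hN e⟩) <| by
    constructor
    · intro e e' h
      have h' : s(vert N e.2, vert N (tgt e)) = s(vert N e'.2, vert N (tgt e')) :=
        congrArg Subtype.val h
      rw [Sym2.eq_iff] at h'
      simp only [EmbeddingLike.apply_eq_iff_eq] at h'
      rcases h' with h | h
      · exact tgt_injective hN h.1 h.2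
      · exact absurd h.2 (tgt_ne_swap hN h.1)
    · rintro ⟨e, he⟩
      induction e using Sym2.ind with
      | _ a b =>
        obtain ⟨p, rfl⟩ := (vert N).surjective a
        obtain ⟨q, rfl⟩ := (vert N).surjective b
        have he' : (torus N).Adj (vert N p) (vert N q) := he
        rw [torus_adj_iff hN] at he'
        obtain ⟨p1, p2⟩ := p
        obtain ⟨q1, q2⟩ := q
        simp only at he'
        rcases he' with ⟨h | h, h'⟩ | ⟨h | h, h'⟩
        · exact ⟨(false, (p1, p2)), by simp [tgt, h, h']⟩
        · exact ⟨(false, (q1, q2)), by simp [tgt, h, h', Sym2.eq_swap]⟩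
        · exact ⟨(true, (p1, p2)), by simp [tgt, h, h']⟩
        · exact ⟨(true, (q1, q2)), by simp [tgt, h, h', Sym2.eq_swap]⟩

lemma edgeEquiv_val (hN : 3 ≤ N) (e : Ed N) :
    edgeEquiv hN e = ⟨s(vert N e.2, vert N (tgt e)), torus_adj_tgt hN e⟩ := rfl

/-- A family of flows which send volume `N⁻³` between each ordered pair of vertices. -/
def IsMultiflow (G : Pt N → Pt N → Ed N → ℝ) : Prop :=
  ∀ v w p, dv (G v w) p = ((N : ℝ) ^ 3)⁻¹ * ((if p = v then 1 else 0) - (if p = w then 1 else 0))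

/-- The volume of a family of flows. -/
def volume₂ {ι κ : Type*} [Fintype ι] [Fintype κ] (G : ι → κ → Ed N → ℝ) (e : Ed N) : ℝ :=
  ∑ i, ∑ j, |G i j e|

theorem exists_multiflow (hN : 3 ≤ N) {f : TorusEdge N → ℝ≥0}
    (hf : IsStandardizedGlobalFlow N f) :
    ∃ G : Pt N → Pt N → Ed N → ℝ, IsMultiflow G ∧ ∀ e, volume₂ G e ≤ f (edgeEquiv hN e) := by
  obtain ⟨μ, hμ, htra, hflo⟩ := hf
  obtain ⟨g, hanti, hdiv, hadj, hvol⟩ := exists_pairFlow_of_pathFlow μ f hflo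
  have hmass : ∀ v w, μ.real (pathsBetween (torus N) v w) = ((N : ℝ) ^ 3)⁻¹ := by
    intro v w
    have h := htra v w
    unfold tra at h
    rw [Measure.map_apply (measurable_finitePath _) (measurableSet_singleton _)] at h
    have e : (fun σ : FinitePath (torus N) => (ent σ, exi σ)) ⁻¹' {(v, w)} =
        pathsBetween (torus N) v w := by
      ext σ; simp [pathsBetween]
    rw [e] at h
    rw [measureReal_def, h]
    simp
  refine ⟨fun v w e => g (vert N v) (vert N w) (vert N e.2) (vert N (tgt e)), ?_, ?_⟩
  · intro v w p
    have h := hdiv (vert N v) (vert N w) (vert N p)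
    rw [hmass, ← (vert N).sum_comp] at h
    have hv : ∀ a b : Pt N, vert N a = vert N b ↔ a = b := fun a b => (vert N).apply_eq_iff_eq
    rw [if_congr (hv p v) rfl rfl, if_congr (hv p w) rfl rfl] at h
    rw [← h]
    set k : Pt N → ℝ := fun q => g (vert N v) (vert N w) (vert N p) (vert N q) with hk
    have h1 := one_ne_zero_zmod hN
    have h2 := two_ne_zero_zmod hN
    have h3 : (-1 : ZMod N) ≠ 1 := by
      intro h; exact h2 (by linear_combination -h)
    obtain ⟨x, y⟩ := p
    -- Only the four neighbours carry flow; they are distinct because `1 ≠ 0` and `-1 ≠ 1`.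
    have hsub : ∑ q, k q = ∑ q ∈ ({(x + 1, y), (x - 1, y), (x, y + 1), (x, y - 1)} :
        Finset (Pt N)), k q := by
      symm
      apply Finset.sum_subset (Finset.subset_univ _)
      rintro ⟨a, b⟩ - hq
      apply hadj
      rw [torus_adj_iff hN]
      simp only [Finset.mem_insert, Finset.mem_singleton, Prod.mk.injEq, not_or] at hq
      simp only
      rintro (⟨h | h, h'⟩ | ⟨h | h, h'⟩)
      · exact hq.1 ⟨h, h'.symm⟩
      · exact hq.2.1 ⟨by rw [h]; ring, h'.symm⟩
      · exact hq.2.2.1 ⟨h'.symm, h⟩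
      · exact hq.2.2.2 ⟨h'.symm, by rw [h]; ring⟩
    rw [hsub, Finset.sum_insert, Finset.sum_insert, Finset.sum_insert, Finset.sum_singleton]
    · simp only [dv, tgt, hk, if_true, Bool.false_eq_true, if_false, sub_add_cancel]
      rw [hanti _ _ (vert N (x - 1, y)) (vert N (x, y)),
        hanti _ _ (vert N (x, y - 1)) (vert N (x, y))]
      ring
    · simp [sub_eq_add_neg, h3.symm]
    · simp [h1]
    · simp [sub_eq_add_neg, h3.symm, h1]
  · intro e
    have h := hvol _ _ (torus_adj_tgt hN e)
    rw [edgeEquiv_val]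
    refine le_trans (le_of_eq ?_) h
    unfold volume₂
    rw [← (vert N).sum_comp]
    refine Finset.sum_congr rfl fun v _ => ?_
    rw [← (vert N).sum_comp]

lemma sum_ed_sub (F : Ed N → ℝ) (p : Pt N) :
    ∑ e, F e * ((if p = e.2 then 1 else 0) - (if p = tgt e then 1 else 0)) = dv F p := by
  have h : ∀ d : Bool, ∑ q : Pt N, F (d, q) * (if p = q then 1 else 0) = F (d, p) := by
    intro d; simp
  have h1 : ∑ q : Pt N, F (false, q) * (if p = tgt (false, q) then 1 else 0) =
      F (false, (p.1 - 1, p.2)) := by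
    rw [Finset.sum_eq_single (p.1 - 1, p.2)]
    · simp [tgt]
    · rintro ⟨a, b⟩ - hne
      have : p ≠ tgt (false, (a, b)) := by
        intro h; apply hne; rw [h]; simp [tgt]
      simp [this]
    · simp
  have h2 : ∑ q : Pt N, F (true, q) * (if p = tgt (true, q) then 1 else 0) =
      F (true, (p.1, p.2 - 1)) := by
    rw [Finset.sum_eq_single (p.1, p.2 - 1)]
    · simp [tgt]
    · rintro ⟨a, b⟩ - hne
      have : p ≠ tgt (true, (a, b)) := by
        intro h; apply hne; rw [h]; simp [tgt]
      simp [this]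
    · simp
  rw [Fintype.sum_prod_type, Fintype.sum_bool]
  simp only [mul_sub, Finset.sum_sub_distrib, h, h1, h2, dv]
  ring

/-- The arc function of an edge function. -/
def arcFlow (F : Ed N → ℝ) (a b : Fin N × Fin N) : ℝ :=
  ∑ e, F e * ((if a = vert N e.2 ∧ b = vert N (tgt e) then 1 else 0) -
    (if a = vert N (tgt e) ∧ b = vert N e.2 then 1 else 0))

lemma arcFlow_antisymm (F : Ed N → ℝ) (a b : Fin N × Fin N) :
    arcFlow F a b = - arcFlow F b a := by
  unfold arcFlow
  rw [← Finset.sum_neg_distrib]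
  refine Finset.sum_congr rfl fun e _ => ?_
  simp only [and_comm (a := b = _)]
  ring

lemma arcFlow_of_not_adj (hN : 3 ≤ N) (F : Ed N → ℝ) (a b : Fin N × Fin N)
    (h : ¬ (torus N).Adj a b) : arcFlow F a b = 0 := by
  unfold arcFlow
  refine Finset.sum_eq_zero fun e _ => ?_
  have h1 : ¬ (a = vert N e.2 ∧ b = vert N (tgt e)) := by
    rintro ⟨rfl, rfl⟩; exact h (torus_adj_tgt hN e)
  have h2 : ¬ (a = vert N (tgt e) ∧ b = vert N e.2) := by
    rintro ⟨rfl, rfl⟩; exact h (torus_adj_tgt hN e).symm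
  simp [h1, h2]

lemma sum_arcFlow (F : Ed N → ℝ) (p : Pt N) : ∑ b, arcFlow F (vert N p) b = dv F p := by
  unfold arcFlow
  rw [Finset.sum_comm, ← sum_ed_sub F p]
  refine Finset.sum_congr rfl fun e _ => ?_
  rw [← Finset.mul_sum, Finset.sum_sub_distrib]
  congr 2
  · by_cases h : p = e.2 <;> simp [h]
  · by_cases h : p = tgt e <;> simp [h]

lemma arcFlow_edge (hN : 3 ≤ N) (F : Ed N → ℝ) (e : Ed N) :
    arcFlow F (vert N e.2) (vert N (tgt e)) = F e := by
  unfold arcFlow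
  simp only [EmbeddingLike.apply_eq_iff_eq]
  rw [Finset.sum_eq_single e]
  · have : ¬ (e.2 = tgt e ∧ tgt e = e.2) := fun h => tgt_ne_swap hN h.1 h.2
    simp [this]
  · intro e' _ hne
    have h1 : ¬ (e.2 = e'.2 ∧ tgt e = tgt e') := fun h => hne (tgt_injective hN h.1 h.2).symm
    have h2 : ¬ (e.2 = tgt e' ∧ tgt e = e'.2) := fun h => tgt_ne_swap hN h.1 h.2
    simp [h1, h2]
  · simp

/-- The converse of `exists_multiflow`: each commodity is decomposed into paths separately and the
measures are added. The two directions bound volumes from opposite sides, so path-flows and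
multiflows have the same infimum cost. -/
theorem exists_standardizedGlobalFlow (hN : 3 ≤ N) {G : Pt N → Pt N → Ed N → ℝ}
    (hG : IsMultiflow G) :
    ∃ f : TorusEdge N → ℝ≥0, IsStandardizedGlobalFlow N f ∧
      ∀ e, (f (edgeEquiv hN e) : ℝ) ≤ volume₂ G e := by
  have hex : ∀ v w : Pt N, ∃ μ : Measure (FinitePath (torus N)), IsFiniteMeasure μ ∧
      μ (pathsBetween (torus N) (vert N v) (vert N w)) = ENNReal.ofReal ((N : ℝ) ^ 3)⁻¹ ∧
      μ (pathsBetween (torus N) (vert N v) (vert N w))ᶜ = 0 ∧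
      ∀ a b (h : (torus N).Adj a b),
        flo μ ⟨s(a, b), h⟩ ≤ ENNReal.ofReal |arcFlow (G v w) a b| := by
    intro v w
    apply exists_pathFlow_of_flow _ (arcFlow_antisymm _) (arcFlow_of_not_adj hN _) _ _ _
      (by positivity)
    intro a
    obtain ⟨p, rfl⟩ := (vert N).surjective a
    rw [sum_arcFlow, hG]
    simp only [EmbeddingLike.apply_eq_iff_eq]
  choose ν hν1 hν2 hν3 hν4 using hex
  set μ : Measure (FinitePath (torus N)) := Measure.sum fun q : Pt N × Pt N => ν q.1 q.2 with hμ
  have hfin : IsFiniteMeasure μ := by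
    rw [hμ, Measure.sum_fintype]; infer_instance
  have hflo : ∀ e, flo μ (edgeEquiv hN e) ≤ ENNReal.ofReal (volume₂ G e) := by
    intro e
    have h1 : flo μ (edgeEquiv hN e) = ∑ v, ∑ w, flo (ν v w) (edgeEquiv hN e) := by
      unfold flo
      rw [hμ, lintegral_sum_measure, tsum_fintype, Fintype.sum_prod_type]
    rw [h1, volume₂, ENNReal.ofReal_sum_of_nonneg
      (fun v _ => Finset.sum_nonneg fun w _ => abs_nonneg _)]
    refine Finset.sum_le_sum fun v _ => ?_
    rw [ENNReal.ofReal_sum_of_nonneg (fun w _ => abs_nonneg _)]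
    refine Finset.sum_le_sum fun w _ => ?_
    have := hν4 v w _ _ (torus_adj_tgt hN e)
    rw [arcFlow_edge hN] at this
    exact this
  have hne : ∀ e, flo μ e ≠ ⊤ := by
    intro e
    obtain ⟨e, rfl⟩ := (edgeEquiv hN).surjective e
    exact ((hflo e).trans_lt ENNReal.ofReal_lt_top).ne
  refine ⟨fun e => (flo μ e).toNNReal, ⟨μ, hfin, ?_, fun e => (ENNReal.coe_toNNReal (hne e)).symm⟩,
    ?_⟩
  · intro a b
    obtain ⟨v, rfl⟩ := (vert N).surjective a
    obtain ⟨w, rfl⟩ := (vert N).surjective b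
    unfold tra
    rw [Measure.map_apply (measurable_finitePath _) (measurableSet_singleton _)]
    have e : (fun σ : FinitePath (torus N) => (ent σ, exi σ)) ⁻¹' {(vert N v, vert N w)} =
        pathsBetween (torus N) (vert N v) (vert N w) := by
      ext σ; simp [pathsBetween]
    rw [e, hμ, Measure.sum_apply _ (show MeasurableSet[⊤] _ from MeasurableSpace.measurableSet_top),
      tsum_fintype, Finset.sum_eq_single (v, w)]
    · rw [hν2]
      rw [ENNReal.ofReal_inv_of_pos (by have := NeZero.pos N; positivity),
        ENNReal.ofReal_pow (by positivity), ENNReal.ofReal_natCast]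
    · rintro ⟨v', w'⟩ - hne
      refine measure_mono_null ?_ (hν3 v' w')
      intro σ h1 h2
      apply hne
      have a1 := (vert N).injective (h1.1.symm.trans h2.1)
      have a2 := (vert N).injective (h1.2.symm.trans h2.2)
      rw [a1, a2]
    · simp
  · intro e
    have h := hflo e
    have h0 : 0 ≤ volume₂ G e :=
      Finset.sum_nonneg fun v _ => Finset.sum_nonneg fun w _ => abs_nonneg _
    calc ((flo μ (edgeEquiv hN e)).toNNReal : ℝ) = (flo μ (edgeEquiv hN e)).toReal := rfl
      _ ≤ (ENNReal.ofReal (volume₂ G e)).toReal := ENNReal.toReal_mono ENNReal.ofReal_ne_top h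
      _ = volume₂ G e := ENNReal.toReal_ofReal h0

end TorusFlows

/-! ### Shortest-path flows and the refinement of flows between parts -/

section CanonicalFlows

variable {N : ℕ} [NeZero N]

/-- The unit flow from `a` to `b` along the shorter arc of the cycle; `cyc a b x` is the flow from
`x` to `x + 1`. -/
def cyc (a b x : ZMod N) : ℝ :=
  ∑ k ∈ Finset.range (b - a).valMinAbs.toNat, (if a + k = x then 1 else 0) -
    ∑ k ∈ Finset.range (-(b - a).valMinAbs).toNat, (if a - k - 1 = x then 1 else 0)

/-- The number of times that the shorter arc from `a` to `b` uses the edge from `x` to `x + 1`. -/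
def cycAbs (a b x : ZMod N) : ℝ :=
  ∑ k ∈ Finset.range (b - a).valMinAbs.toNat, (if a + k = x then 1 else 0) +
    ∑ k ∈ Finset.range (-(b - a).valMinAbs).toNat, (if a - k - 1 = x then 1 else 0)

/-- Counts the ways in which the edge from `x` to `x + 1` is within distance `D` of `a`. -/
def near (D : ℕ) (a x : ZMod N) : ℝ :=
  ∑ k ∈ Finset.range D, (if a + k = x then 1 else 0) +
    ∑ k ∈ Finset.range D, (if a - k - 1 = x then 1 else 0)

lemma sum_near (D : ℕ) (x : ZMod N) : ∑ a, near D a x = 2 * D := by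
  unfold near
  rw [Finset.sum_add_distrib, Finset.sum_comm, Finset.sum_comm (t := Finset.range D)]
  have h1 : ∀ k : ℕ, ∑ a : ZMod N, (if a + k = x then (1 : ℝ) else 0) = 1 := by
    intro k
    simp only [← eq_sub_iff_add_eq, Finset.sum_ite_eq', Finset.mem_univ, if_true]
  have h2 : ∀ k : ℕ, ∑ a : ZMod N, (if a - k - 1 = x then (1 : ℝ) else 0) = 1 := by
    intro k
    simp only [sub_eq_iff_eq_add, Finset.sum_ite_eq', Finset.mem_univ, if_true]
  simp only [h1, h2]
  simp; ring

lemma abs_cyc_le {N : ℕ} (a b x : ZMod N) : |cyc a b x| ≤ cycAbs a b x := by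
  unfold cyc cycAbs
  refine (abs_sub _ _).trans (le_of_eq ?_)
  rw [abs_of_nonneg (by positivity), abs_of_nonneg (by positivity)]

lemma toNat_cast_valMinAbs {N : ℕ} {a b : ZMod N} (h : 0 ≤ (b - a).valMinAbs) :
    ((b - a).valMinAbs.toNat : ZMod N) = b - a := by
  rw [← Int.cast_natCast, Int.toNat_of_nonneg h, ZMod.coe_valMinAbs]

lemma toNat_cast_neg_valMinAbs {N : ℕ} {a b : ZMod N} (h : (b - a).valMinAbs ≤ 0) :
    ((-(b - a).valMinAbs).toNat : ZMod N) = a - b := by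
  rw [← Int.cast_natCast, Int.toNat_of_nonneg (by omega), Int.cast_neg, ZMod.coe_valMinAbs]
  ring

/-- Both sums telescope. Only the one selected by the sign of `valMinAbs` is nonempty, and its arc
ends at `b`. -/
lemma cyc_sub {N : ℕ} (a b x : ZMod N) :
    cyc a b x - cyc a b (x - 1) = (if x = a then 1 else 0) - (if x = b then 1 else 0) := by
  have h1 : ∀ n : ℕ, ∑ k ∈ Finset.range n, (if a + k = x then (1 : ℝ) else 0) -
      ∑ k ∈ Finset.range n, (if a + k = x - 1 then (1 : ℝ) else 0) =
      (if a = x then 1 else 0) - (if a + n = x then 1 else 0) := by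
    intro n
    have := Finset.sum_range_sub' (fun k : ℕ => if a + k = x then (1 : ℝ) else 0) n
    rw [← Finset.sum_sub_distrib]
    simp only [Nat.cast_zero, add_zero] at this
    rw [← this]
    refine Finset.sum_congr rfl fun k _ => ?_
    simp only [eq_sub_iff_add_eq, Nat.cast_add, Nat.cast_one, add_assoc]
  have h2 : ∀ n : ℕ, ∑ k ∈ Finset.range n, (if a - k - 1 = x then (1 : ℝ) else 0) -
      ∑ k ∈ Finset.range n, (if a - k - 1 = x - 1 then (1 : ℝ) else 0) =
      (if a - n = x then 1 else 0) - (if a = x then 1 else 0) := by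
    intro n
    have := Finset.sum_range_sub (fun k : ℕ => if a - k = x then (1 : ℝ) else 0) n
    rw [← Finset.sum_sub_distrib]
    simp only [Nat.cast_zero, sub_zero] at this
    rw [← this]
    refine Finset.sum_congr rfl fun k _ => ?_
    simp only [sub_left_inj, Nat.cast_add, Nat.cast_one, ← sub_sub]
  unfold cyc
  have e1 := h1 (b - a).valMinAbs.toNat
  have e2 := h2 (-(b - a).valMinAbs).toNat
  rw [sub_sub_sub_comm, e1, e2]
  simp only [eq_comm (a := x)]
  rcases le_total 0 (b - a).valMinAbs with h | h
  · rw [toNat_cast_valMinAbs h, Int.toNat_of_nonpos (by omega : -(b - a).valMinAbs ≤ 0)]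
    simp
  · rw [toNat_cast_neg_valMinAbs h, Int.toNat_of_nonpos h]
    simp

lemma cycAbs_le_near {N : ℕ} {D : ℕ} {a b : ZMod N} (h : (b - a).valMinAbs.natAbs ≤ D) (x : ZMod N) :
    cycAbs a b x ≤ near D a x := by
  unfold cycAbs near
  gcongr <;> omega

/-- The arc is read backwards from `b`. This version is needed because the vertical leg of `can v w`
lies in the column of `w`, so its bound has to be indexed by the destination. -/
lemma cycAbs_le_near' {N : ℕ} {D : ℕ} {a b : ZMod N} (h : (b - a).valMinAbs.natAbs ≤ D) (x : ZMod N) :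
    cycAbs a b x ≤ near D b x := by
  have h1 : ∑ k ∈ Finset.range (b - a).valMinAbs.toNat, (if a + k = x then (1 : ℝ) else 0) ≤
      ∑ k ∈ Finset.range D, (if b - k - 1 = x then 1 else 0) := by
    rcases le_total 0 (b - a).valMinAbs with h0 | h0
    · have e := toNat_cast_valMinAbs h0
      set n := (b - a).valMinAbs.toNat with hn
      rw [← Finset.sum_range_reflect]
      calc _ = ∑ k ∈ Finset.range n, (if b - k - 1 = x then (1 : ℝ) else 0) := by
            refine Finset.sum_congr rfl fun k hk => ?_
            have hk' := Finset.mem_range.1 hk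
            have : ((n - 1 - k : ℕ) : ZMod N) = n - 1 - k := by
              rw [Nat.cast_sub (by omega), Nat.cast_sub (by omega)]; simp
            rw [this, e]
            congr 2
            ring
        _ ≤ _ := by gcongr; omega
    · rw [Int.toNat_of_nonpos h0]
      simp only [Finset.range_zero, Finset.sum_empty]
      positivity
  have h2 : ∑ k ∈ Finset.range (-(b - a).valMinAbs).toNat,
        (if a - k - 1 = x then (1 : ℝ) else 0) ≤
      ∑ k ∈ Finset.range D, (if b + k = x then 1 else 0) := by
    rcases le_total (b - a).valMinAbs 0 with h0 | h0
    · have e := toNat_cast_neg_valMinAbs h0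
      set n := (-(b - a).valMinAbs).toNat with hn
      rw [← Finset.sum_range_reflect]
      calc _ = ∑ k ∈ Finset.range n, (if b + k = x then (1 : ℝ) else 0) := by
            refine Finset.sum_congr rfl fun k hk => ?_
            have hk' := Finset.mem_range.1 hk
            have : ((n - 1 - k : ℕ) : ZMod N) = n - 1 - k := by
              rw [Nat.cast_sub (by omega), Nat.cast_sub (by omega)]; simp
            rw [this, e]
            congr 2
            ring
        _ ≤ _ := by gcongr; omega
    · rw [Int.toNat_of_nonpos (by omega : -(b - a).valMinAbs ≤ 0)]
      simp only [Finset.range_zero, Finset.sum_empty]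
      positivity
  unfold cycAbs near
  linarith

/-- The origin of the constant `1/4`: the mean distance on the cycle is at most a quarter of its
length. Passing from `n` to `n + 2` shifts the index by one and raises each inner minimum by one. -/
lemma sum_range_min_le (n : ℕ) : 4 * ∑ k ∈ Finset.range n, min k (n - k) ≤ n ^ 2 := by
  induction n using Nat.twoStepInduction with
  | zero => simp
  | one => simp
  | more n ih _ =>
    rw [Finset.sum_range_succ']
    have : ∑ k ∈ Finset.range (n + 1), min (k + 1) (n + 2 - (k + 1)) =
        ∑ k ∈ Finset.range n, min k (n - k) + (n + 1) := by
      have h : ∀ k ∈ Finset.range (n + 1), min (k + 1) (n + 2 - (k + 1)) = min k (n - k) + 1 := by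
        intro k hk
        have := Finset.mem_range.1 hk
        omega
      rw [Finset.sum_congr rfl h, Finset.sum_add_distrib, Finset.sum_range_succ]
      simp
    rw [this]
    simp only [Nat.zero_min, add_zero]
    nlinarith

lemma sum_natAbs_valMinAbs_le :
    ∑ d : ZMod N, (d.valMinAbs.natAbs : ℝ) ≤ (N : ℝ) ^ 2 / 4 := by
  have h : ∑ d : ZMod N, d.valMinAbs.natAbs = ∑ k ∈ Finset.range N, min k (N - k) := by
    simp only [ZMod.valMinAbs_natAbs_eq_min]
    obtain ⟨n, rfl⟩ : ∃ n, N = n + 1 := ⟨N - 1, by have := NeZero.pos N; omega⟩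
    exact Fin.sum_univ_eq_sum_range (fun k => min k (n + 1 - k)) (n + 1)
  have h2 := sum_range_min_le N
  rw [← h] at h2
  have h3 : (4 : ℝ) * ∑ d : ZMod N, (d.valMinAbs.natAbs : ℝ) ≤ (N : ℝ) ^ 2 := by
    exact_mod_cast h2
  linarith

/-- By translation invariance, the arcs of displacement `d` use a given edge `|d|` times in total.
-/
lemma sum_cycAbs_le (x : ZMod N) : ∑ a, ∑ b, cycAbs a b x ≤ (N : ℝ) ^ 2 / 4 := by
  refine le_trans (le_of_eq ?_) (sum_natAbs_valMinAbs_le (N := N))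
  have h0 : ∀ a : ZMod N, ∑ b, cycAbs a b x = ∑ d, cycAbs a (a + d) x := fun a =>
    (Fintype.sum_equiv (Equiv.addLeft a) _ _ fun _ => rfl).symm
  simp only [h0]
  rw [Finset.sum_comm]
  refine Finset.sum_congr rfl fun d _ => ?_
  simp only [cycAbs, add_sub_cancel_left]
  rw [Finset.sum_add_distrib, Finset.sum_comm, Finset.sum_comm
    (t := Finset.range (-d.valMinAbs).toNat)]
  have h1 : ∀ k : ℕ, ∑ a : ZMod N, (if a + k = x then (1 : ℝ) else 0) = 1 := by
    intro k
    simp only [← eq_sub_iff_add_eq, Finset.sum_ite_eq', Finset.mem_univ, if_true]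
  have h2 : ∀ k : ℕ, ∑ a : ZMod N, (if a - k - 1 = x then (1 : ℝ) else 0) = 1 := by
    intro k
    simp only [sub_eq_iff_eq_add, Finset.sum_ite_eq', Finset.mem_univ, if_true]
  simp only [h1, h2]
  simp only [Finset.sum_const, Finset.card_range, nsmul_eq_mul, mul_one]
  rw [← Nat.cast_add]
  congr 1
  omega

/-- The unit flow from `v` to `w` which first moves horizontally and then vertically. -/
def can (v w : Pt N) (e : Ed N) : ℝ :=
  if e.1 then (if e.2.1 = w.1 then cyc v.2 w.2 e.2.2 else 0)
  else (if e.2.2 = v.2 then cyc v.1 w.1 e.2.1 else 0)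

lemma dv_can {N : ℕ} (v w p : Pt N) :
    dv (can v w) p = (if p = v then 1 else 0) - (if p = w then 1 else 0) := by
  obtain ⟨x, y⟩ := p
  obtain ⟨v1, v2⟩ := v
  obtain ⟨w1, w2⟩ := w
  have hx := cyc_sub v1 w1 x
  have hy := cyc_sub v2 w2 y
  simp only [dv, can, Bool.false_eq_true, if_false, if_true, Prod.mk.injEq]
  by_cases h1 : y = v2 <;> by_cases h2 : x = w1 <;> simp only [h1, h2, if_true, if_false] at * <;>
    by_cases h3 : x = v1 <;> by_cases h4 : y = w2 <;> simp_all

/-- The horizontal leg must lie in the row of `v`, while the second coordinate of `w` is free; this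
gives the factor `N`. -/
lemma sum_abs_can_false (x y : ZMod N) :
    ∑ v, ∑ w, |can v w (false, (x, y))| ≤ (N : ℝ) ^ 3 / 4 := by
  calc ∑ v, ∑ w, |can v w (false, (x, y))|
      ≤ ∑ v : Pt N, ∑ w : Pt N, (if y = v.2 then cycAbs v.1 w.1 x else 0) := by
        refine Finset.sum_le_sum fun v _ => Finset.sum_le_sum fun w _ => ?_
        simp only [can, Bool.false_eq_true, if_false]
        split_ifs
        · exact abs_cyc_le _ _ _
        · simp
    _ = N * ∑ a, ∑ b, cycAbs a b x := by
        simp only [Fintype.sum_prod_type, Finset.sum_const, Finset.card_univ, ZMod.card,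
          nsmul_eq_mul]
        rw [Finset.mul_sum]
        refine Finset.sum_congr rfl fun a _ => ?_
        rw [Finset.sum_comm]
        simp [Finset.mul_sum]
    _ ≤ N * ((N : ℝ) ^ 2 / 4) := by
        gcongr; exact sum_cycAbs_le x
    _ = _ := by ring

lemma sum_abs_can_true (x y : ZMod N) :
    ∑ v, ∑ w, |can v w (true, (x, y))| ≤ (N : ℝ) ^ 3 / 4 := by
  calc ∑ v, ∑ w, |can v w (true, (x, y))|
      ≤ ∑ v : Pt N, ∑ w : Pt N, (if x = w.1 then cycAbs v.2 w.2 y else 0) := by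
        refine Finset.sum_le_sum fun v _ => Finset.sum_le_sum fun w _ => ?_
        simp only [can, if_true]
        split_ifs
        · exact abs_cyc_le _ _ _
        · simp
    _ = N * ∑ a, ∑ b, cycAbs a b y := by
        simp only [Fintype.sum_prod_type]
        have : ∀ b : ZMod N, ∑ c : ZMod N, ∑ d : ZMod N,
            (if x = c then cycAbs b d y else 0) = ∑ d, cycAbs b d y := by
          intro b
          rw [Finset.sum_comm]; simp
        simp only [this, Finset.sum_const, Finset.card_univ, ZMod.card, nsmul_eq_mul]
    _ ≤ N * ((N : ℝ) ^ 2 / 4) := by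
        gcongr; exact sum_cycAbs_le y
    _ = _ := by ring

lemma dv_mul {N : ℕ} (a : ℝ) (F : Ed N → ℝ) (p : Pt N) : dv (fun e => a * F e) p = a * dv F p := by
  unfold dv; ring

lemma dv_add {N : ℕ} (F F' : Ed N → ℝ) (p : Pt N) :
    dv (fun e => F e + F' e) p = dv F p + dv F' p := by
  unfold dv; ring

lemma dv_sub {N : ℕ} (F F' : Ed N → ℝ) (p : Pt N) :
    dv (fun e => F e - F' e) p = dv F p - dv F' p := by
  unfold dv; ring

lemma dv_sum {N : ℕ} {ι : Type*} (s : Finset ι) (F : ι → Ed N → ℝ) (p : Pt N) :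
    dv (fun e => ∑ i ∈ s, F i e) p = ∑ i ∈ s, dv (F i) p := by
  unfold dv
  simp only [← Finset.sum_sub_distrib, ← Finset.sum_add_distrib]

/-- The multiflow which uses the canonical paths. -/
def stdFlow (N : ℕ) [NeZero N] (v w : Pt N) (e : Ed N) : ℝ := ((N : ℝ) ^ 3)⁻¹ * can v w e

lemma isMultiflow_stdFlow : IsMultiflow (stdFlow N) := by
  intro v w p
  unfold stdFlow
  rw [dv_mul, dv_can]

lemma volume₂_stdFlow_le (e : Ed N) : volume₂ (stdFlow N) e ≤ 1 / 4 := by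
  have hN : (0 : ℝ) < N := by exact_mod_cast NeZero.pos N
  have h : ∑ v, ∑ w, |can v w e| ≤ (N : ℝ) ^ 3 / 4 := by
    obtain ⟨d, x, y⟩ := e
    cases d
    · exact sum_abs_can_false x y
    · exact sum_abs_can_true x y
  unfold volume₂ stdFlow
  simp only [abs_mul, ← Finset.mul_sum]
  rw [abs_of_pos (by positivity)]
  calc _ ≤ ((N : ℝ) ^ 3)⁻¹ * ((N : ℝ) ^ 3 / 4) := by gcongr
    _ = 1 / 4 := by field_simp

/-- A multiflow can be built from flows between the members of a fractional partition of the
torus into small parts. -/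
theorem exists_multiflow_of_partition {ι : Type*} [Fintype ι] (χ : ι → Pt N → ℝ)
    (hχ0 : ∀ i v, 0 ≤ χ i v) (hχ1 : ∀ v, ∑ i, χ i v = 1) (D : ℕ)
    (hD : ∀ i v w, χ i v ≠ 0 → χ i w ≠ 0 →
      (w.1 - v.1).valMinAbs.natAbs ≤ D ∧ (w.2 - v.2).valMinAbs.natAbs ≤ D)
    (H : ι → ι → Ed N → ℝ)
    (hH : ∀ i j p, dv (H i j) p =
      ((N : ℝ) ^ 3)⁻¹ * ((∑ v, χ j v) * χ i p - (∑ v, χ i v) * χ j p)) :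
    ∃ G : Pt N → Pt N → Ed N → ℝ, IsMultiflow G ∧
      ∀ e, volume₂ G e ≤ volume₂ H e + 4 * D / N := by
  have hN : (0 : ℝ) < N := by exact_mod_cast NeZero.pos N
  set n : ι → ℝ := fun i => ∑ v, χ i v with hn
  have hn0 : ∀ i, 0 ≤ n i := fun i => Finset.sum_nonneg fun v _ => hχ0 i v
  have hzero : ∀ i, n i = 0 → ∀ v, χ i v = 0 := fun i h v =>
    (Finset.sum_eq_zero_iff_of_nonneg fun v _ => hχ0 i v).1 h v (Finset.mem_univ v)
  -- For an empty part the quotient is `0 / 0 = 0`, harmless because `χ i` vanishes.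
  have hmul : ∀ i v, χ i v * (n i / n i) = χ i v := by
    intro i v
    by_cases h : n i = 0
    · rw [hzero i h v]; simp
    · rw [div_self h, mul_one]
  -- A unit mass at `v` enters part `i` with weight `χ i v` and is spread there with density `χ i /
  -- n i`. The kernel is symmetric, hence doubly stochastic, and moves mass by at most `D` in each
  -- coordinate.
  set ρ : Pt N → Pt N → ℝ := fun v X => ∑ i, χ i v * χ i X / n i with hρ
  have hρ0 : ∀ v X, 0 ≤ ρ v X := fun v X =>
    Finset.sum_nonneg fun i _ => div_nonneg (mul_nonneg (hχ0 i v) (hχ0 i X)) (hn0 i)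
  have hρsymm : ∀ v X, ρ v X = ρ X v := fun v X => by
    simp only [hρ]; refine Finset.sum_congr rfl fun i _ => by ring
  have hρ1 : ∀ v, ∑ X, ρ v X = 1 := by
    intro v
    simp only [hρ]
    rw [Finset.sum_comm, ← hχ1 v]
    refine Finset.sum_congr rfl fun i _ => ?_
    rw [← Finset.sum_div, ← Finset.mul_sum, mul_div_assoc]
    exact hmul i v
  have hρ1' : ∀ X, ∑ v, ρ v X = 1 := by
    intro X; simp only [hρsymm _ X]; exact hρ1 X
  have hρD : ∀ v X, ρ v X ≠ 0 →
      (X.1 - v.1).valMinAbs.natAbs ≤ D ∧ (X.2 - v.2).valMinAbs.natAbs ≤ D := by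
    intro v X h
    obtain ⟨i, -, hi⟩ := Finset.exists_ne_zero_of_sum_ne_zero h
    have h1 : χ i v ≠ 0 := by rintro h; simp [h] at hi
    have h2 : χ i X ≠ 0 := by rintro h; simp [h] at hi
    exact hD i v X h1 h2
  set S : Pt N → Ed N → ℝ := fun v e => ∑ X, ρ v X * can v X e with hS
  have hSdv : ∀ v p, dv (S v) p = (if p = v then 1 else 0) - ρ v p := by
    intro v p
    simp only [hS]
    rw [dv_sum]
    simp only [dv_mul, dv_can, mul_sub, Finset.sum_sub_distrib]
    rw [← Finset.sum_mul, hρ1]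
    simp
  have hSabs : ∀ e, ∑ v, |S v e| ≤ 2 * D := by
    intro e
    have h1 : ∑ v, |S v e| ≤ ∑ v, ∑ X, ρ v X * |can v X e| := by
      refine Finset.sum_le_sum fun v _ => (Finset.abs_sum_le_sum_abs _ _).trans (le_of_eq ?_)
      refine Finset.sum_congr rfl fun X _ => ?_
      rw [abs_mul, abs_of_nonneg (hρ0 v X)]
    refine h1.trans ?_
    obtain ⟨d, x, y⟩ := e
    cases d
    · calc _ ≤ ∑ v : Pt N, ∑ X : Pt N, ρ v X * (if y = v.2 then near D v.1 x else 0) := by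
            refine Finset.sum_le_sum fun v _ => Finset.sum_le_sum fun X _ => ?_
            by_cases h : ρ v X = 0
            · simp [h]
            · refine mul_le_mul_of_nonneg_left ?_ (hρ0 v X)
              simp only [can, Bool.false_eq_true, if_false]
              split_ifs
              · exact (abs_cyc_le _ _ _).trans (cycAbs_le_near (hρD v X h).1 x)
              · simp
        _ = ∑ v : Pt N, (if y = v.2 then near D v.1 x else 0) := by
            refine Finset.sum_congr rfl fun v _ => ?_
            rw [← Finset.sum_mul, hρ1, one_mul]
        _ = 2 * D := by
            simp only [Fintype.sum_prod_type, Finset.sum_ite_eq, Finset.mem_univ, if_true]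
            exact sum_near D x
    · calc _ ≤ ∑ v : Pt N, ∑ X : Pt N, ρ v X * (if x = X.1 then near D X.2 y else 0) := by
            refine Finset.sum_le_sum fun v _ => Finset.sum_le_sum fun X _ => ?_
            by_cases h : ρ v X = 0
            · simp [h]
            · refine mul_le_mul_of_nonneg_left ?_ (hρ0 v X)
              simp only [can, if_true]
              split_ifs
              · exact (abs_cyc_le _ _ _).trans (cycAbs_le_near' (hρD v X h).2 y)
              · simp
        _ = ∑ X : Pt N, (if x = X.1 then near D X.2 y else 0) := by
            rw [Finset.sum_comm]
            refine Finset.sum_congr rfl fun v _ => ?_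
            rw [← Finset.sum_mul, hρ1', one_mul]
        _ = 2 * D := by
            rw [Fintype.sum_prod_type, Finset.sum_comm]
            simp only [Finset.sum_ite_eq, Finset.mem_univ, if_true]
            exact sum_near D y
  -- Spread from `v`, travel with a fraction of each `H i j`, and gather at `w`. For each `(i, j)`
  -- the fractions add up to at most one, so `H` is counted once; spreading and gathering cost `N⁻³
  -- · 2N² · 2D`.
  refine ⟨fun v w e => ((N : ℝ) ^ 3)⁻¹ * (S v e - S w e) +
    ∑ i, ∑ j, (χ i v * χ j w / (n i * n j)) * H i j e, ?_, ?_⟩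
  · intro v w p
    rw [dv_add, dv_mul, dv_sub, hSdv, hSdv, dv_sum]
    simp only [dv_sum, dv_mul, hH]
    have h1 : ∑ i, ∑ j, χ i v * χ j w / (n i * n j) *
        (((N : ℝ) ^ 3)⁻¹ * (n j * χ i p - n i * χ j p)) =
        ((N : ℝ) ^ 3)⁻¹ * (ρ v p - ρ w p) := by
      have e1 : ∀ i j, χ i v * χ j w / (n i * n j) *
          (((N : ℝ) ^ 3)⁻¹ * (n j * χ i p - n i * χ j p)) =
          ((N : ℝ) ^ 3)⁻¹ * ((χ i v * χ i p / n i) * (χ j w * (n j / n j)) -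
            (χ i v * (n i / n i)) * (χ j w * χ j p / n j)) := by
        intro i j; simp only [div_eq_mul_inv, mul_inv]; ring
      simp only [e1, hmul, ← Finset.mul_sum, Finset.sum_sub_distrib, ← Finset.sum_mul, hχ1]
      simp only [hρ, mul_one, one_mul]
    rw [h1]; ring
  · intro e
    have hcoef : ∀ i j, ∑ v, ∑ w, χ i v * χ j w / (n i * n j) ≤ 1 := by
      intro i j
      have e1 : ∑ v, ∑ w, χ i v * χ j w / (n i * n j) = (n i / n i) * (n j / n j) := by
        have : ∀ v w, χ i v * χ j w / (n i * n j) = (χ i v / n i) * (χ j w / n j) := by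
          intro v w; rw [mul_div_mul_comm]
        rw [Finset.sum_congr rfl fun v _ => Finset.sum_congr rfl fun w _ => this v w]
        simp only [← Finset.mul_sum, ← Finset.sum_mul, ← Finset.sum_div, hn]
      rw [e1]
      exact mul_le_one₀ (div_self_le_one _) (div_nonneg (hn0 j) (hn0 j)) (div_self_le_one _)
    have hc0 : ∀ i j v w, 0 ≤ χ i v * χ j w / (n i * n j) := fun i j v w =>
      div_nonneg (mul_nonneg (hχ0 _ _) (hχ0 _ _)) (mul_nonneg (hn0 _) (hn0 _))
    unfold volume₂
    calc _ ≤ ∑ v, ∑ w, (((N : ℝ) ^ 3)⁻¹ * (|S v e| + |S w e|) +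
          ∑ i, ∑ j, χ i v * χ j w / (n i * n j) * |H i j e|) := by
          refine Finset.sum_le_sum fun v _ => Finset.sum_le_sum fun w _ => ?_
          refine (abs_add_le _ _).trans (add_le_add ?_ ?_)
          · rw [abs_mul, abs_of_pos (by positivity)]
            gcongr; exact abs_sub _ _
          · refine (Finset.abs_sum_le_sum_abs _ _).trans (Finset.sum_le_sum fun i _ => ?_)
            refine (Finset.abs_sum_le_sum_abs _ _).trans (Finset.sum_le_sum fun j _ => ?_)
            rw [abs_mul, abs_of_nonneg (hc0 i j v w)]
      _ = ((N : ℝ) ^ 3)⁻¹ * (2 * (N : ℝ) ^ 2 * ∑ v, |S v e|) +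
          ∑ i, ∑ j, (∑ v, ∑ w, χ i v * χ j w / (n i * n j)) * |H i j e| := by
          simp only [Finset.sum_add_distrib, ← Finset.mul_sum, Finset.sum_const,
            Finset.card_univ, Fintype.card_prod, ZMod.card, nsmul_eq_mul]
          congr 1
          · push_cast; ring
          · simp only [Finset.sum_mul]
            rw [Finset.sum_congr rfl fun v _ => Finset.sum_comm, Finset.sum_comm]
            refine Finset.sum_congr rfl fun i _ => ?_
            rw [Finset.sum_congr rfl fun v _ => Finset.sum_comm, Finset.sum_comm]
      _ ≤ ((N : ℝ) ^ 3)⁻¹ * (2 * (N : ℝ) ^ 2 * (2 * D)) + ∑ i, ∑ j, 1 * |H i j e| := by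
          gcongr with i _ j _
          · exact hSabs e
          · exact hcoef i j
      _ = _ := by
          simp only [one_mul]
          rw [add_comm]
          congr 1
          field_simp
          ring

end CanonicalFlows

/-! ### Variance under bounded differences -/

section Concentration

/-- A function of independent variables each of which can change its value by at most `D` has
variance at most `n D²`. -/
lemma integral_sq_sub_integral_le_fin (κ : Measure ℝ) [IsProbabilityMeasure κ] {D C : ℝ}
    (hD : 0 ≤ D) (n : ℕ) (g : (Fin n → ℝ) → ℝ) (hg : Measurable g) (hC : ∀ c, |g c| ≤ C)
    (hosc : ∀ c i x, |g c - g (Function.update c i x)| ≤ D) :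
    ∫ c, (g c - ∫ c', g c' ∂(Measure.pi fun _ => κ)) ^ 2 ∂(Measure.pi fun _ => κ) ≤ n * D ^ 2 := by
  induction n with
  | zero =>
    have h : ∀ c, g c = g 0 := fun c => congrArg g (Subsingleton.elim _ _)
    simp [h]
  | succ n ih =>
    set μ : Measure (Fin n → ℝ) := Measure.pi fun _ => κ with hμ
    have hmp := (measurePreserving_piFinSuccAbove (fun _ : Fin (n + 1) => κ) 0).symm
    set φ := (MeasurableEquiv.piFinSuccAbove (fun _ : Fin (n + 1) => ℝ) 0).symm with hφ
    have hint : ∀ k : (Fin (n + 1) → ℝ) → ℝ,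
        ∫ c, k c ∂(Measure.pi fun _ => κ) = ∫ z, k (φ z) ∂(κ.prod μ) := by
      intro k
      exact (hmp.integral_comp' k).symm
    have hφc : ∀ x y, φ (x, y) = Fin.cons x y := by
      intro x y
      ext i
      refine Fin.cases ?_ (fun j => ?_) i
      · simp [hφ, MeasurableEquiv.piFinSuccAbove_symm_apply]
      · simp [hφ, MeasurableEquiv.piFinSuccAbove_symm_apply]
    have hgφ : Measurable fun z => g (φ z) := hg.comp φ.measurable
    set m := ∫ c', g c' ∂(Measure.pi fun _ : Fin (n + 1) => κ) with hm
    have hC0 : 0 ≤ C := (abs_nonneg _).trans (hC 0)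
    have hmC : |m| ≤ C := by
      have := norm_integral_le_of_norm_le_const (μ := Measure.pi fun _ : Fin (n + 1) => κ)
        (f := g) (C := C) (Eventually.of_forall hC)
      simpa using this
    have hib : ∀ {α : Type} [MeasurableSpace α] (ν : Measure α) [IsProbabilityMeasure ν]
        (k : α → ℝ) (R : ℝ), Measurable k → (∀ a, |k a| ≤ R) → Integrable k ν := by
      intro α _ ν _ k R hk hR
      exact Integrable.of_bound hk.aestronglyMeasurable R (Eventually.of_forall hR)
    -- The mean of `g` given the first coordinate. The variance is the mean conditional variance,
    -- bounded by induction, plus the variance of `H`, which is at most `D²` because `H` oscillates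
    -- by at most `D`.
    set H : ℝ → ℝ := fun x => ∫ y, g (φ (x, y)) ∂μ with hH
    have hHm : Measurable H := by
      have : StronglyMeasurable fun z : ℝ × (Fin n → ℝ) => g (φ z) := hgφ.stronglyMeasurable
      exact this.integral_prod_right.measurable
    have hsec : ∀ x, Measurable fun y => g (φ (x, y)) := fun x =>
      hgφ.comp measurable_prodMk_left
    have hsecI : ∀ x, Integrable (fun y => g (φ (x, y))) μ := fun x =>
      hib μ _ C (hsec x) fun y => hC _
    have hHC : ∀ x, |H x| ≤ C := by
      intro x
      have := norm_integral_le_of_norm_le_const (μ := μ) (f := fun y => g (φ (x, y)))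
        (C := C) (Eventually.of_forall fun y => hC _)
      simpa using this
    have hmH : m = ∫ x, H x ∂κ := by
      rw [hm, hint, integral_prod _ (hib _ _ C hgφ fun z => hC _)]
    have hoscH : ∀ x x', |H x - H x'| ≤ D := by
      intro x x'
      simp only [hH]
      rw [← integral_sub (hsecI x) (hsecI x')]
      have hb : ∀ y, ‖g (φ (x, y)) - g (φ (x', y))‖ ≤ D := by
        intro y
        have := hosc (Fin.cons x y) 0 x'
        rw [Fin.update_cons_zero] at this
        rw [hφc, hφc]; exact this
      have := norm_integral_le_of_norm_le_const (μ := μ)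
        (f := fun y => g (φ (x, y)) - g (φ (x', y))) (C := D) (Eventually.of_forall hb)
      simpa using this
    have hHm' : ∀ x, |H x - m| ≤ D := by
      intro x
      have e : H x - m = ∫ x', (H x - H x') ∂κ := by
        rw [integral_sub (integrable_const _) (hib κ _ C hHm hHC), hmH]; simp
      rw [e]
      have := norm_integral_le_of_norm_le_const (μ := κ) (f := fun x' => H x - H x') (C := D)
        (Eventually.of_forall fun x' => hoscH x x')
      simpa using this
    have hinner : ∀ x, ∫ y, (g (φ (x, y)) - m) ^ 2 ∂μ ≤ n * D ^ 2 + D ^ 2 := by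
      intro x
      have h1 := ih (fun y => g (φ (x, y))) (hsec x) (fun y => hC _) (by
        intro y i t
        have := hosc (Fin.cons x y) i.succ t
        rw [← Fin.cons_update] at this
        rw [hφc, hφc]; exact this)
      have e : ∀ y, (g (φ (x, y)) - m) ^ 2 =
          (g (φ (x, y)) - H x) ^ 2 + ((2 * (H x - m)) * (g (φ (x, y)) - H x) + (H x - m) ^ 2) := by
        intro y; ring
      have hi1 : Integrable (fun y => g (φ (x, y)) - H x) μ :=
        (hsecI x).sub (integrable_const _)
      have hi2 : Integrable (fun y => (g (φ (x, y)) - H x) ^ 2) μ := by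
        refine hib μ _ ((2 * C) ^ 2) (((hsec x).sub_const _).pow_const 2) fun y => ?_
        rw [abs_of_nonneg (sq_nonneg _), sq_le_sq, abs_of_nonneg (by linarith : 0 ≤ 2 * C)]
        refine (abs_sub _ _).trans ?_
        linarith [hC (φ (x, y)), hHC x]
      simp only [e]
      have hi3 : Integrable (fun y => 2 * (H x - m) * (g (φ (x, y)) - H x)) μ := hi1.const_mul _
      have hi4 : Integrable (fun y => 2 * (H x - m) * (g (φ (x, y)) - H x) + (H x - m) ^ 2) μ :=
        hi3.add (integrable_const _)
      rw [integral_add hi2 hi4, integral_add hi3 (integrable_const _), integral_const_mul,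
        integral_sub (hsecI x) (integrable_const _)]
      have hz : ∫ y, g (φ (x, y)) ∂μ - ∫ _y, H x ∂μ = 0 := by simp [hH]
      rw [hz]
      have h2 : (H x - m) ^ 2 ≤ D ^ 2 := by
        rw [sq_le_sq, abs_of_nonneg hD]; exact hHm' x
      simp only [mul_zero, zero_add, integral_const, probReal_univ, smul_eq_mul, one_mul]
      exact add_le_add h1 h2
    have hsq : ∀ c, |(g c - m) ^ 2| ≤ (2 * C) ^ 2 := by
      intro c
      rw [abs_of_nonneg (sq_nonneg _), sq_le_sq, abs_of_nonneg (by linarith : 0 ≤ 2 * C)]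
      refine (abs_sub _ _).trans ?_
      linarith [hC c]
    have hprodI : Integrable (fun z => (g (φ z) - m) ^ 2) (κ.prod μ) :=
      hib _ _ ((2 * C) ^ 2) ((hgφ.sub_const _).pow_const 2) fun z => hsq _
    rw [hint, integral_prod _ hprodI]
    calc ∫ x, ∫ y, (g (φ (x, y)) - m) ^ 2 ∂μ ∂κ ≤ ∫ _x, (n * D ^ 2 + D ^ 2) ∂κ :=
          integral_mono hprodI.integral_prod_left (integrable_const _) hinner
      _ = _ := by simp; ring

/-- The mean deviation of a function of independent variables with bounded oscillations. -/
lemma integral_abs_sub_integral_le (κ : Measure ℝ) [IsProbabilityMeasure κ] {E : Type} [Fintype E]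
    {D C : ℝ} (hD : 0 ≤ D) (g : (E → ℝ) → ℝ) (hg : Measurable g) (hC : ∀ c, |g c| ≤ C)
    (hosc : ∀ c c' : E → ℝ, ∀ i, (∀ j ≠ i, c j = c' j) → |g c - g c'| ≤ D) :
    ∫ c, |g c - ∫ c', g c' ∂(Measure.pi fun _ => κ)| ∂(Measure.pi fun _ => κ) ≤
      D * √(Fintype.card E) := by
  classical
  set n := Fintype.card E with hn
  let e : Fin n ≃ E := (Fintype.equivFin E).symm
  set φ := MeasurableEquiv.piCongrLeft (fun _ : E => ℝ) e with hφ
  have hmp := measurePreserving_piCongrLeft (fun _ : E => κ) e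
  have hint : ∀ k : (E → ℝ) → ℝ, ∫ c, k c ∂(Measure.pi fun _ => κ) =
      ∫ c, k (φ c) ∂(Measure.pi fun _ : Fin n => κ) := fun k => (hmp.integral_comp' k).symm
  have hφa : ∀ c i, φ c (e i) = c i := fun c i => by
    simp only [hφ, MeasurableEquiv.coe_piCongrLeft]
    exact Equiv.piCongrLeft_apply_apply (P := fun _ : E => ℝ) e c i
  have hvar := integral_sq_sub_integral_le_fin κ hD n (fun c => g (φ c)) (hg.comp φ.measurable)
    (fun c => hC _) (by
      intro c i x
      apply hosc _ _ (e i)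
      intro j hj
      obtain ⟨j, rfl⟩ := e.surjective j
      rw [hφa, hφa, Function.update_of_ne]
      rintro rfl; exact hj rfl)
  rw [← hint, ← hint (fun c => (g c - ∫ c', g c' ∂(Measure.pi fun _ => κ)) ^ 2)] at hvar
  set ν : Measure (E → ℝ) := Measure.pi fun _ => κ with hν
  set m := ∫ c', g c' ∂ν with hm
  set a := ∫ c, |g c - m| ∂ν with ha
  have hI : ∀ (k : (E → ℝ) → ℝ) (R : ℝ), Measurable k → (∀ a, |k a| ≤ R) → Integrable k ν := by
    intro k R hk hR
    exact Integrable.of_bound hk.aestronglyMeasurable R (Eventually.of_forall hR)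
  have hb : ∀ c, |g c - m| ≤ C + |m| := fun c => (abs_sub _ _).trans (by linarith [hC c])
  have hmeas : Measurable fun c => |g c - m| := (hg.sub_const _).abs
  have hI1 : Integrable (fun c => |g c - m|) ν :=
    hI _ (C + |m|) hmeas (fun c => by rw [abs_abs]; exact hb c)
  have hI2 : Integrable (fun c => (g c - m) ^ 2) ν := by
    refine hI _ ((C + |m|) ^ 2) ((hg.sub_const _).pow_const 2) fun c => ?_
    rw [abs_of_nonneg (sq_nonneg _), ← sq_abs]
    exact pow_le_pow_left₀ (abs_nonneg _) (hb c) 2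
  have hsq : a ^ 2 ≤ ∫ c, (g c - m) ^ 2 ∂ν := by
    have h0 : 0 ≤ ∫ c, (|g c - m| - a) ^ 2 ∂ν := integral_nonneg fun c => sq_nonneg _
    have e1 : ∀ c, (|g c - m| - a) ^ 2 = (g c - m) ^ 2 - ((2 * a) * |g c - m| - a ^ 2) := by
      intro c; rw [sub_sq, sq_abs]; ring
    simp only [e1] at h0
    have hI3 : Integrable (fun c => 2 * a * |g c - m|) ν := hI1.const_mul _
    have hI4 : Integrable (fun c => 2 * a * |g c - m| - a ^ 2) ν := hI3.sub (integrable_const _)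
    rw [integral_sub hI2 hI4, integral_sub hI3 (integrable_const _), integral_const_mul, ← ha] at h0
    simp at h0
    nlinarith
  have ha0 : 0 ≤ a := integral_nonneg fun c => abs_nonneg _
  have hfin : a ^ 2 ≤ (D * √n) ^ 2 := by
    rw [mul_pow, Real.sq_sqrt (by positivity)]
    calc a ^ 2 ≤ _ := hsq
      _ ≤ n * D ^ 2 := hvar
      _ = _ := by ring
  exact (pow_le_pow_iff_left₀ ha0 (by positivity) two_ne_zero).1 hfin

end Concentration

/-! ### Nearly optimal choices within a single class -/

section Selection

variable {E : Type} [Fintype E] {T : Type*}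

/-- The cost of the volumes `v` in the environment `c`. -/
def quadCost (v c : E → ℝ) : ℝ := ∑ e, c e * v e ^ 2

/-- The infimum of the costs of a family of volumes. -/
def infCost (vol : T → E → ℝ) (c : E → ℝ) : ℝ := ⨅ t, quadCost (vol t) c

lemma abs_quadCost_sub_le {B : ℝ} {v : E → ℝ} (h0 : ∀ e, 0 ≤ v e) (hB : ∀ e, v e ≤ B)
    (c c' : E → ℝ) : |quadCost v c - quadCost v c'| ≤ B ^ 2 * ∑ e, |c e - c' e| := by
  unfold quadCost
  rw [← Finset.sum_sub_distrib, Finset.mul_sum]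
  refine (Finset.abs_sum_le_sum_abs _ _).trans (Finset.sum_le_sum fun e _ => ?_)
  rw [← sub_mul, abs_mul, abs_of_nonneg (sq_nonneg (v e)), mul_comm]
  gcongr
  · exact h0 e
  · exact hB e

lemma quadCost_nonneg {v c : E → ℝ} (hc : ∀ e, 0 ≤ c e) : 0 ≤ quadCost v c :=
  Finset.sum_nonneg fun e _ => mul_nonneg (hc e) (sq_nonneg _)

lemma quadCost_le {B cm : ℝ} {v c : E → ℝ} (h0 : ∀ e, 0 ≤ v e) (hB : ∀ e, v e ≤ B)
    (hc : ∀ e, c e ∈ Icc 0 cm) : quadCost v c ≤ Fintype.card E * (cm * B ^ 2) := by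
  unfold quadCost
  calc _ ≤ ∑ _e : E, cm * B ^ 2 := by
        refine Finset.sum_le_sum fun e _ => ?_
        have := hc e
        gcongr
        · exact this.1.trans this.2
        · exact this.2
        · exact h0 e
        · exact hB e
    _ = _ := by simp

lemma bddBelow_quadCost {B : ℝ} {vol : T → E → ℝ} (h0 : ∀ t e, 0 ≤ vol t e)
    (hB : ∀ t e, vol t e ≤ B) (c : E → ℝ) : BddBelow (range fun t => quadCost (vol t) c) := by
  refine ⟨-(B ^ 2 * ∑ e, |c e - 0|), ?_⟩
  rintro _ ⟨t, rfl⟩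
  have := abs_quadCost_sub_le (h0 t) (hB t) c (fun _ => 0)
  have h2 : quadCost (vol t) (fun _ => 0) = 0 := by simp [quadCost]
  rw [h2, sub_zero] at this
  exact (abs_le.1 this).1

lemma infCost_le {B : ℝ} {vol : T → E → ℝ} (h0 : ∀ t e, 0 ≤ vol t e)
    (hB : ∀ t e, vol t e ≤ B) (c : E → ℝ) (t : T) : infCost vol c ≤ quadCost (vol t) c :=
  ciInf_le (bddBelow_quadCost h0 hB c) t

lemma abs_infCost_sub_le [Nonempty T] {B : ℝ} {vol : T → E → ℝ} (h0 : ∀ t e, 0 ≤ vol t e)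
    (hB : ∀ t e, vol t e ≤ B) (c c' : E → ℝ) :
    |infCost vol c - infCost vol c'| ≤ B ^ 2 * ∑ e, |c e - c' e| := by
  have key : ∀ c c' : E → ℝ, infCost vol c - B ^ 2 * ∑ e, |c e - c' e| ≤ infCost vol c' := by
    intro c c'
    refine le_ciInf fun t => ?_
    have h1 := infCost_le h0 hB c t
    have h2 := (abs_le.1 (abs_quadCost_sub_le (h0 t) (hB t) c c')).2
    linarith
  rw [abs_le]
  have h1 := key c c'
  have h2 := key c' c
  simp only [abs_sub_comm (c' _)] at h2
  constructor <;> linarith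

lemma continuous_infCost [Nonempty T] {B : ℝ} {vol : T → E → ℝ} (h0 : ∀ t e, 0 ≤ vol t e)
    (hB : ∀ t e, vol t e ≤ B) : Continuous (infCost vol) := by
  rw [continuous_iff_continuousAt]
  intro c₀
  rw [ContinuousAt, tendsto_iff_dist_tendsto_zero]
  have hlim : Tendsto (fun c : E → ℝ => B ^ 2 * ∑ e, |c e - c₀ e|) (𝓝 c₀) (𝓝 0) := by
    have : Continuous fun c : E → ℝ => B ^ 2 * ∑ e, |c e - c₀ e| := by fun_prop
    have h := this.tendsto c₀
    simpa using h
  exact squeeze_zero (fun _ => dist_nonneg) (fun c => abs_infCost_sub_le h0 hB c c₀) hlim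

lemma continuous_quadCost_right (v : E → ℝ) : Continuous (quadCost v) := by
  unfold quadCost; fun_prop

lemma continuous_quadCost_left (c : E → ℝ) : Continuous fun v => quadCost v c := by
  unfold quadCost; fun_prop

lemma infCost_nonneg [Nonempty T] {vol : T → E → ℝ} {c : E → ℝ} (hc : ∀ e, 0 ≤ c e) :
    0 ≤ infCost vol c :=
  le_ciInf fun _ => quadCost_nonneg hc

lemma infCost_le_card [Nonempty T] {B cm : ℝ} {vol : T → E → ℝ} (h0 : ∀ t e, 0 ≤ vol t e)
    (hB : ∀ t e, vol t e ≤ B) {c : E → ℝ} (hc : ∀ e, c e ∈ Icc 0 cm) :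
    infCost vol c ≤ Fintype.card E * (cm * B ^ 2) := by
  obtain ⟨t⟩ := ‹Nonempty T›
  exact (infCost_le h0 hB c t).trans (quadCost_le (h0 t) (hB t) hc)

variable {κ : Measure ℝ} [IsProbabilityMeasure κ] {cm : ℝ}

lemma ae_pi_mem_Icc (hκ : κ (Icc 0 cm) = 1) :
    ∀ᵐ c ∂(Measure.pi fun _ : E => κ), ∀ e, c e ∈ Icc 0 cm := by
  rw [ae_all_iff]
  intro e
  have h : ∀ᵐ x ∂κ, x ∈ Icc 0 cm := by
    rw [← prob_compl_eq_zero_iff measurableSet_Icc] at hκ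
    exact hκ
  exact (Measure.quasiMeasurePreserving_eval (fun _ : E => κ) e).ae h

lemma integrable_infCost (hκ : κ (Icc 0 cm) = 1) [Nonempty T] {B : ℝ}
    {vol : T → E → ℝ} (h0 : ∀ t e, 0 ≤ vol t e) (hB : ∀ t e, vol t e ≤ B) :
    Integrable (infCost vol) (Measure.pi fun _ : E => κ) := by
  refine Integrable.of_bound (continuous_infCost h0 hB).aestronglyMeasurable
    (Fintype.card E * (cm * B ^ 2)) ?_
  filter_upwards [ae_pi_mem_Icc hκ] with c hc
  rw [Real.norm_of_nonneg (infCost_nonneg fun e => (hc e).1)]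
  exact infCost_le_card h0 hB hc

lemma integral_abs_infCost_sub_le (hcm : 0 ≤ cm) (hκ : κ (Icc 0 cm) = 1) [Nonempty T] {B : ℝ}
    {vol : T → E → ℝ} (h0 : ∀ t e, 0 ≤ vol t e) (hB : ∀ t e, vol t e ≤ B) :
    ∫ c, |infCost vol c - ∫ c', infCost vol c' ∂(Measure.pi fun _ => κ)|
      ∂(Measure.pi fun _ : E => κ) ≤ (cm * B ^ 2) * √(Fintype.card E) := by
  classical
  -- Truncation makes the bounded difference `cm * B ^ 2` valid everywhere, and changes the cost
  -- only on a null set.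
  set clip : (E → ℝ) → (E → ℝ) := fun c e => max 0 (min (c e) cm) with hclip
  have hcl : ∀ c e, clip c e ∈ Icc 0 cm := fun c e =>
    ⟨le_max_left _ _, max_le hcm (min_le_right _ _)⟩
  have hclm : Measurable clip := by
    simp only [hclip]; fun_prop
  have hae : ∀ᵐ c ∂(Measure.pi fun _ : E => κ), infCost vol (clip c) = infCost vol c := by
    filter_upwards [ae_pi_mem_Icc hκ] with c hc
    congr 1
    ext e
    have := hc e
    simp [hclip, this.1, this.2]
  have h := integral_abs_sub_integral_le κ (E := E) (D := cm * B ^ 2)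
    (C := Fintype.card E * (cm * B ^ 2)) (by positivity) (fun c => infCost vol (clip c))
    ((continuous_infCost h0 hB).measurable.comp hclm) (by
      intro c
      rw [abs_of_nonneg (infCost_nonneg fun e => (hcl c e).1)]
      exact infCost_le_card h0 hB (hcl c)) (by
      intro c c' i hi
      refine (abs_infCost_sub_le h0 hB _ _).trans ?_
      rw [Finset.sum_eq_single i]
      · have h1 := hcl c i
        have h2 := hcl c' i
        have : |clip c i - clip c' i| ≤ cm := by
          rw [abs_le]; constructor <;> linarith [h1.1, h1.2, h2.1, h2.2]
        calc _ ≤ B ^ 2 * cm := by gcongr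
          _ = _ := mul_comm _ _
      · intro j _ hj
        simp [hclip, hi j hj]
      · simp)
  rw [integral_congr_ae hae] at h
  refine le_trans (le_of_eq (integral_congr_ae ?_)) h
  filter_upwards [hae] with c hc
  rw [hc]

lemma exists_measurable_selection [Nonempty T] {B : ℝ} {vol : T → E → ℝ}
    (h0 : ∀ t e, 0 ≤ vol t e) (hB : ∀ t e, vol t e ≤ B) {ε : ℝ} (hε : 0 < ε) :
    ∃ s : (E → ℝ) → T, (∀ e, Measurable fun c => vol (s c) e) ∧
      ∀ c, quadCost (vol (s c)) c ≤ infCost vol c + ε := by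
  classical
  -- Volumes form a separable set, so the first nearly optimal member of a dense sequence is a
  -- measurable choice.
  let W := range vol
  have : Nonempty W := (range_nonempty vol).to_subtype
  have hsel : ∀ n, ∃ t, vol t = (TopologicalSpace.denseSeq W n : E → ℝ) := fun n =>
    (TopologicalSpace.denseSeq W n).2
  choose τ hτ using hsel
  have hex : ∀ c, ∃ n, quadCost (vol (τ n)) c < infCost vol c + ε := by
    intro c
    obtain ⟨t, ht⟩ := exists_lt_of_ciInf_lt (show (⨅ t, quadCost (vol t) c) < infCost vol c + ε by
      unfold infCost; linarith)
    have hopen : IsOpen {w : W | quadCost (w : E → ℝ) c < infCost vol c + ε} :=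
      isOpen_lt ((continuous_quadCost_left c).comp continuous_subtype_val) continuous_const
    obtain ⟨n, hn⟩ := (TopologicalSpace.denseRange_denseSeq W).exists_mem_open hopen
      ⟨⟨vol t, t, rfl⟩, ht⟩
    exact ⟨n, by rw [hτ]; exact hn⟩
  refine ⟨fun c => τ (Nat.find (hex c)), ?_, fun c => (Nat.find_spec (hex c)).le⟩
  intro e
  have hm : Measurable fun c => Nat.find (hex c) := measurable_find hex fun n =>
    measurableSet_lt (continuous_quadCost_right _).measurable
      ((continuous_infCost h0 hB).measurable.add_const _)
  exact (Measurable.of_discrete (f := fun n => vol (τ n) e)).comp hm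

lemma integrable_quadCost_selection (hκ : κ (Icc 0 cm) = 1) {B : ℝ} {v : (E → ℝ) → E → ℝ}
    (h0 : ∀ c e, 0 ≤ v c e) (hB : ∀ c e, v c e ≤ B) (hv : ∀ e, Measurable fun c => v c e) :
    Integrable (fun c => quadCost (v c) c) (Measure.pi fun _ : E => κ) := by
  refine Integrable.of_bound ?_ (Fintype.card E * (cm * B ^ 2)) ?_
  · refine Measurable.aestronglyMeasurable ?_
    unfold quadCost
    exact Finset.measurable_sum _ fun e _ => (measurable_pi_apply e).mul ((hv e).pow_const 2)
  filter_upwards [ae_pi_mem_Icc hκ] with c hc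
  rw [Real.norm_of_nonneg (quadCost_nonneg fun e => (hc e).1)]
  exact quadCost_le (h0 c) (hB c) hc

/-- If the members of a family of volumes are sorted into finitely many classes, then there are
nearly optimal choices from one and the same class in all environments. -/
theorem exists_selection_in_class (hcm : 0 ≤ cm) (hκ : κ (Icc 0 cm) = 1) [Nonempty T] {B : ℝ}
    {vol : T → E → ℝ} (h0 : ∀ t e, 0 ≤ vol t e) (hB : ∀ t e, vol t e ≤ B)
    {ι : Type*} [Fintype ι] (pr : T → ι) :
    ∃ s : (E → ℝ) → T, (∀ c c', pr (s c) = pr (s c')) ∧ (∀ e, Measurable fun c => vol (s c) e) ∧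
      ∫ c, quadCost (vol (s c)) c ∂(Measure.pi fun _ => κ) ≤
        ∫ c, infCost vol c ∂(Measure.pi fun _ => κ) +
          Fintype.card ι * ((cm * B ^ 2) * √(Fintype.card E)) + 1 := by
  classical
  set ν : Measure (E → ℝ) := Measure.pi fun _ => κ with hν
  let ι' := range pr
  have : Nonempty ι' := (range_nonempty pr).to_subtype
  let vi : ∀ i : ι', {t // pr t = i} → E → ℝ := fun i t => vol t.1
  have hne : ∀ i : ι', Nonempty {t // pr t = i} := fun i => by
    obtain ⟨_, t, rfl⟩ := i; exact ⟨⟨t, rfl⟩⟩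
  have hv0 : ∀ i t e, 0 ≤ vi i t e := fun i t e => h0 _ _
  have hvB : ∀ i t e, vi i t e ≤ B := fun i t e => hB _ _
  let m : ι' → ℝ := fun i => ∫ c, infCost (vi i) c ∂ν
  -- The class with the least mean. In each environment a near-optimum lies in some class `j`, whose
  -- infimum is close to `m j ≥ m i`; the sum of the deviations of all classes covers the unknown
  -- `j`.
  obtain ⟨i, hi⟩ := Finite.exists_min m
  have hI : ∀ i, Integrable (infCost (vi i)) ν := fun i => integrable_infCost hκ (hv0 i) (hvB i)
  have hmain : ∀ c, m i ≤ infCost vol c + 1 / 2 + ∑ j : ι', |infCost (vi j) c - m j| := by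
    intro c
    obtain ⟨t, ht⟩ := exists_lt_of_ciInf_lt (show (⨅ t, quadCost (vol t) c) <
      infCost vol c + 1 / 2 by unfold infCost; linarith)
    let j : ι' := ⟨pr t, t, rfl⟩
    have h1 : infCost (vi j) c ≤ quadCost (vol t) c := infCost_le (hv0 j) (hvB j) c ⟨t, rfl⟩
    have h2 : |infCost (vi j) c - m j| ≤ ∑ j : ι', |infCost (vi j) c - m j| :=
      Finset.single_le_sum (f := fun j : ι' => |infCost (vi j) c - m j|)
        (fun _ _ => abs_nonneg _) (Finset.mem_univ j)
    have h3 := (abs_le.1 (le_refl |infCost (vi j) c - m j|)).1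
    have h4 := hi j
    linarith
  have hIabs : ∀ j, Integrable (fun c => |infCost (vi j) c - m j|) ν := fun j =>
    ((hI j).sub (integrable_const _)).abs
  have hIv := integrable_infCost hκ h0 hB
  have hm2 : m i ≤ ∫ c, infCost vol c ∂ν + 1 / 2 +
      Fintype.card ι * ((cm * B ^ 2) * √(Fintype.card E)) := by
    have := integral_mono (μ := ν) (integrable_const (m i))
      ((hIv.add (integrable_const (1 / 2))).add
        (integrable_finsetSum Finset.univ fun j _ => hIabs j)) hmain
    simp only [Pi.add_apply] at this
    have hI1 : Integrable (fun c => infCost vol c + 1 / 2) ν := hIv.add (integrable_const _)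
    have hI2 : Integrable (fun c => ∑ j, |infCost (vi j) c - m j|) ν :=
      integrable_finsetSum Finset.univ fun j _ => hIabs j
    rw [integral_add hI1 hI2, integral_add hIv (integrable_const _), integral_finsetSum _ fun j _ => hIabs j] at this
    simp only [integral_const, probReal_univ, smul_eq_mul, one_mul] at this
    refine this.trans ?_
    gcongr
    calc _ ≤ ∑ _j : ι', (cm * B ^ 2) * √(Fintype.card E) :=
          Finset.sum_le_sum fun j _ => integral_abs_infCost_sub_le hcm hκ (hv0 j) (hvB j)
      _ = Fintype.card ι' * ((cm * B ^ 2) * √(Fintype.card E)) := by simp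
      _ ≤ _ := by
          gcongr
          exact Fintype.card_subtype_le _
  obtain ⟨s, hs1, hs2⟩ := exists_measurable_selection (hv0 i) (hvB i) (ε := 1 / 2) (by norm_num)
  refine ⟨fun c => (s c).1, fun c c' => (s c).2.trans (s c').2.symm, hs1, ?_⟩
  have := integral_mono (μ := ν)
    (integrable_quadCost_selection hκ (fun c e => h0 (s c).1 e) (fun c e => hB (s c).1 e) hs1)
    ((hI i).add (integrable_const (1 / 2))) hs2
  simp only [Pi.add_apply] at this
  rw [integral_add (hI i) (integrable_const _)] at this
  simp only [integral_const, probReal_univ, smul_eq_mul, one_mul] at this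
  calc _ ≤ m i + 1 / 2 := this
    _ ≤ _ := by linarith

end Selection

/-! ### Stream functions and a finite classification of flows -/

section Streams

/-- The stream function of a divergence-free flow on the torus, on the quadrant of the plane. -/
def stream {M : ℕ} (F : Ed M → ℝ) (x y : ℕ) : ℝ :=
  ∑ t ∈ Finset.range y, F (false, ((x : ZMod M) - 1, (t : ZMod M))) -
    ∑ t ∈ Finset.range x, F (true, ((t : ZMod M), -1))

variable {M : ℕ}

lemma stream_sub (F F' : Ed M → ℝ) (x y : ℕ) :
    stream (fun e => F e - F' e) x y = stream F x y - stream F' x y := by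
  unfold stream
  simp only [Finset.sum_sub_distrib]
  ring

lemma stream_succ_right (F : Ed M → ℝ) (x y : ℕ) :
    stream F x (y + 1) - stream F x y = F (false, ((x : ZMod M) - 1, (y : ZMod M))) := by
  unfold stream
  rw [Finset.sum_range_succ]
  ring

/-- The value at `(x, y)` belongs to the corner below and to the left of the vertex `(x, y)`. The
arguments are natural numbers, not residues, because a circulation with net flux around the torus
has no periodic stream function. -/
lemma stream_false (F : Ed M → ℝ) (x y : ℕ) :
    stream F (x + 1) (y + 1) - stream F (x + 1) y = F (false, ((x : ZMod M), (y : ZMod M))) := by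
  rw [stream_succ_right]
  simp

lemma stream_succ_left_zero (F : Ed M → ℝ) (x : ℕ) :
    stream F x 0 - stream F (x + 1) 0 = F (true, ((x : ZMod M), -1)) := by
  unfold stream
  rw [Finset.sum_range_succ]
  simp

/-- Row zero holds by definition of the stream function, and vanishing divergence carries the
identity up the column. -/
lemma stream_true {F : Ed M → ℝ} (hF : ∀ p, dv F p = 0) (x y : ℕ) :
    stream F x (y + 1) - stream F (x + 1) (y + 1) = F (true, ((x : ZMod M), (y : ZMod M))) := by
  have hstep : ∀ z : ℕ, F (false, ((x : ZMod M) - 1, (z : ZMod M))) -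
      F (false, ((x : ZMod M), (z : ZMod M))) =
      F (true, ((x : ZMod M), (z : ZMod M))) - F (true, ((x : ZMod M), (z : ZMod M) - 1)) := by
    intro z
    have := hF ((x : ZMod M), (z : ZMod M))
    simp only [dv] at this
    linarith
  induction y with
  | zero =>
    have h1 := stream_succ_right F x 0
    have h2 := stream_false F x 0
    have h3 := stream_succ_left_zero F x
    have h4 := hstep 0
    simp only [Nat.cast_zero, zero_sub] at h1 h2 h4 ⊢
    linarith
  | succ y ih =>
    have h1 := stream_succ_right F x (y + 1)
    have h2 := stream_false F x (y + 1)
    have h4 := hstep (y + 1)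
    simp only [Nat.cast_add, Nat.cast_one, add_sub_cancel_right] at h1 h2 h4 ⊢
    linarith

lemma abs_sub_le_of_steps {f : ℕ → ℝ} {b : ℝ} (h : ∀ n, |f (n + 1) - f n| ≤ b) (m k : ℕ) :
    |f (m + k) - f m| ≤ b * k := by
  induction k with
  | zero => simp
  | succ k ih =>
    have h1 := h (m + k)
    have e : f (m + (k + 1)) - f m = (f (m + k + 1) - f (m + k)) + (f (m + k) - f m) := by
      rw [← add_assoc]; ring
    rw [e]
    refine (abs_add_le _ _).trans ?_
    push_cast
    linarith

lemma abs_stream_sub_le {F : Ed M → ℝ} (hF : ∀ p, dv F p = 0) {b : ℝ} (hb : ∀ e, |F e| ≤ b)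
    (x y k m : ℕ) : |stream F (x + k) (y + m) - stream F x y| ≤ b * (k + m) := by
  have h1 : |stream F (x + k) (y + m) - stream F (x + k) y| ≤ b * m :=
    abs_sub_le_of_steps (f := fun y => stream F (x + k) y)
      (fun n => by rw [stream_succ_right]; exact hb _) y m
  have h2 : |stream F (x + k) y - stream F x y| ≤ b * k := by
    refine abs_sub_le_of_steps (f := fun x => stream F x y) (fun n => ?_) x k
    rw [abs_sub_comm]
    cases y with
    | zero => rw [stream_succ_left_zero]; exact hb _
    | succ y => rw [stream_true hF]; exact hb _
  calc _ = |(stream F (x + k) (y + m) - stream F (x + k) y) +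
        (stream F (x + k) y - stream F x y)| := by congr 1; ring
    _ ≤ b * m + b * k := (abs_add_le _ _).trans (add_le_add h1 h2)
    _ = _ := by ring

lemma stream_zero_zero (F : Ed M → ℝ) : stream F 0 0 = 0 := by
  simp [stream]

lemma abs_le_volume₂ {ι κ : Type*} [Fintype ι] [Fintype κ] (F : ι → κ → Ed M → ℝ) (i : ι) (j : κ)
    (e : Ed M) : |F i j e| ≤ volume₂ F e :=
  (Finset.single_le_sum (f := fun j => |F i j e|) (fun _ _ => abs_nonneg _)
    (Finset.mem_univ j)).trans
    (Finset.single_le_sum (f := fun i => ∑ j, |F i j e|)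
      (fun _ _ => Finset.sum_nonneg fun _ _ => abs_nonneg _) (Finset.mem_univ i))

lemma volume₂_nonneg {ι κ : Type*} [Fintype ι] [Fintype κ] (F : ι → κ → Ed M → ℝ) (e : Ed M) :
    0 ≤ volume₂ F e :=
  Finset.sum_nonneg fun _ _ => Finset.sum_nonneg fun _ _ => abs_nonneg _

/-- Families of flows with given divergences and with volumes at most `B` can be sorted into a
number of classes that does not depend on the torus, such that the stream functions of the
differences within a class are small. -/
theorem exists_classes (I : Type) [Fintype I] {B η : ℝ} (hB : 0 ≤ B) (hη : 0 < η) :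
    ∃ (ι : Type) (_ : Fintype ι) (M₀ : ℕ), ∀ M, M₀ ≤ M →
      ∀ (T : Type) (Φ : T → I → I → Ed M → ℝ), (∀ t e, volume₂ (Φ t) e ≤ B) →
      (∀ t t' i j p, dv (Φ t i j) p = dv (Φ t' i j) p) →
      ∃ pr : T → ι, ∀ t t', pr t = pr t' → ∀ i j x y, x ≤ 2 * M + 1 → y ≤ 2 * M + 1 →
        |stream (fun e => Φ t i j e - Φ t' i j e) x y| ≤ η * M := by
  classical
  obtain ⟨Q, hQ⟩ := exists_nat_gt (16 * B / η)
  set Q' := Q + 1 with hQ'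
  set h := η / 4 with hh
  have hh0 : 0 < h := by positivity
  -- Samples of the stream functions on a grid of spacing `R`, divided by `M`. The Lipschitz
  -- constant `2B` and coordinates up to `10M` put them in a ball of radius `40B` in a fixed
  -- finite-dimensional space; the class is a small ball of a finite cover.
  let Y := I × I × Fin (2 * Q' + 3) × Fin (2 * Q' + 3) → ℝ
  obtain ⟨t, -, htf, htc⟩ := (isCompact_closedBall (0 : Y) (40 * B)).finite_cover_balls hh0
  refine ⟨t, htf.fintype, Q', fun M hM T Φ hvol hdv => ?_⟩
  rcases isEmpty_or_nonempty T with hT | ⟨⟨t₀⟩⟩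
  · exact ⟨fun t => (hT.false t).elim, fun t => (hT.false t).elim⟩
  have hM0 : 0 < M := by omega
  have hMr : (0 : ℝ) < M := by exact_mod_cast hM0
  set R := M / Q' + 1 with hR
  have hR0 : 0 < R := Nat.succ_pos _
  have hQR : M < Q' * R := by
    rw [hR]; have := Nat.lt_mul_div_succ M (show 0 < Q' by omega); exact this
  have hRle : (Q' * R : ℕ) ≤ 2 * M := by
    rw [hR, mul_add, mul_one]
    have := Nat.mul_div_le M Q'
    omega
  have hd0 : ∀ t t' i j p, dv (fun e => Φ t i j e - Φ t' i j e) p = 0 := by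
    intro t t' i j p
    rw [dv_sub, hdv t t', sub_self]
  have hb0 : ∀ t t' i j e, |Φ t i j e - Φ t' i j e| ≤ 2 * B := by
    intro t t' i j e
    refine (abs_sub _ _).trans ?_
    linarith [(abs_le_volume₂ (Φ t) i j e).trans (hvol t e),
      (abs_le_volume₂ (Φ t') i j e).trans (hvol t' e)]
  let vec : T → Y := fun t z =>
    stream (fun e => Φ t z.1 z.2.1 e - Φ t₀ z.1 z.2.1 e) (z.2.2.1 * R) (z.2.2.2 * R) / M
  have hvec : ∀ t, vec t ∈ Metric.closedBall (0 : Y) (40 * B) := by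
    intro t
    rw [mem_closedBall_zero_iff, pi_norm_le_iff_of_nonneg (by positivity)]
    rintro ⟨i, j, p, q⟩
    have h1 := abs_stream_sub_le (hd0 t t₀ i j) (hb0 t t₀ i j) 0 0 (p * R) (q * R)
    simp only [zero_add, stream_zero_zero, sub_zero] at h1
    have hpR : ∀ p : Fin (2 * Q' + 3), ((p * R : ℕ) : ℝ) ≤ 10 * M := by
      intro p
      have : (p : ℕ) * R ≤ (2 * Q' + 2) * R := Nat.mul_le_mul_right _ (by omega)
      have h2 : (2 * Q' + 2) * R ≤ 10 * M := by nlinarith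
      exact_mod_cast this.trans h2
    simp only [vec, Real.norm_eq_abs, abs_div, Nat.abs_cast]
    rw [div_le_iff₀ hMr]
    refine h1.trans ?_
    nlinarith [hpR p, hpR q]
  have hchoose : ∀ s, ∃ c : t, dist (vec s) (c : Y) < h := by
    intro s
    obtain ⟨c, hc, hc'⟩ := mem_iUnion₂.1 (htc (hvec s))
    exact ⟨(⟨c, hc⟩ : t), hc'⟩
  choose pr hpr using hchoose
  refine ⟨pr, fun s s' hss i j x y hx hy => ?_⟩
  have hdist : dist (vec s) (vec s') < 2 * h := by
    have h1 := hpr s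
    have h2 := hpr s'
    rw [← hss] at h2
    calc _ ≤ dist (vec s) (pr s) + dist (pr s : Y) (vec s') := dist_triangle _ _ _
      _ < _ := by rw [dist_comm (pr s : Y)]; linarith
  have hxR : ∀ x ≤ 2 * M + 1, x / R < 2 * Q' + 3 := by
    intro x hx
    rw [Nat.div_lt_iff_lt_mul hR0]
    nlinarith
  have hentry := (dist_le_pi_dist (vec s) (vec s')
    (i, j, ⟨x / R, hxR x hx⟩, ⟨y / R, hxR y hy⟩)).trans hdist.le
  simp only [vec, Real.dist_eq, ← sub_div, ← stream_sub, sub_sub_sub_cancel_right, abs_div,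
    Nat.abs_cast] at hentry
  rw [div_le_iff₀ hMr] at hentry
  have hmod := abs_stream_sub_le (hd0 s s' i j) (hb0 s s' i j) (x / R * R) (y / R * R)
    (x % R) (y % R)
  rw [Nat.div_add_mod', Nat.div_add_mod'] at hmod
  have hxm : ((x % R : ℕ) : ℝ) ≤ R := by exact_mod_cast (Nat.mod_lt _ hR0).le
  have hym : ((y % R : ℕ) : ℝ) ≤ R := by exact_mod_cast (Nat.mod_lt _ hR0).le
  have hRr : (Q' : ℝ) * R ≤ 2 * M := by exact_mod_cast hRle
  have hQη : 16 * B ≤ η * Q' := by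
    have : 16 * B / η < Q' := hQ.trans (by rw [hQ']; push_cast; linarith)
    rw [div_lt_iff₀ hη] at this
    linarith
  -- Moving to the nearest grid point below costs half of `η M`, by the choice of `Q`; the radius
  -- `h` accounts for the other half.
  have hBR : 2 * B * ((x % R : ℕ) + (y % R : ℕ) : ℝ) ≤ η / 2 * M := by
    calc _ ≤ 2 * B * (R + R) := by gcongr
      _ = 16 * B * R / 4 := by ring
      _ ≤ η * Q' * R / 4 := by gcongr
      _ = η * (Q' * R) / 4 := by ring
      _ ≤ η * (2 * M) / 4 := by gcongr
      _ = _ := by ring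
  have e : ∀ a b : ℝ, |a| ≤ |a - b| + |b| := fun a b => by
    have := abs_add_le (a - b) b
    rwa [sub_add_cancel] at this
  refine (e _ _).trans ((add_le_add hmod hentry).trans ?_)
  calc _ ≤ η / 2 * M + 2 * h * M := by gcongr
    _ = η * M := by rw [hh]; ring

end Streams

/-! ### Lumping vertices into classes -/

section CoarseFlows

variable {M : ℕ} [NeZero M] {I : Type} [Fintype I] [DecidableEq I]

/-- The size of a class of vertices. -/
def classSize (l : Pt M → I) (i : I) : ℝ := ∑ p, if l p = i then 1 else 0

/-- A family of flows between the classes of a partition of the torus, in which each pair of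
vertices contributes `M⁻³`. -/
def IsCoarseFlow (l : Pt M → I) (F : I → I → Ed M → ℝ) : Prop :=
  ∀ i j p, dv (F i j) p = ((M : ℝ) ^ 3)⁻¹ *
    (classSize l j * (if l p = i then 1 else 0) - classSize l i * (if l p = j then 1 else 0))

/-- Adding up the commodities of each pair of classes can only cancel volume, so the coarse problem
is a relaxation of the original one. -/
lemma exists_coarseFlow (l : Pt M → I) {G : Pt M → Pt M → Ed M → ℝ} (hG : IsMultiflow G) :
    ∃ F : I → I → Ed M → ℝ, IsCoarseFlow l F ∧ ∀ e, volume₂ F e ≤ volume₂ G e := by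
  refine ⟨fun i j e => ∑ v, ∑ w, (if l v = i then 1 else 0) * (if l w = j then 1 else 0) * G v w e,
    ?_, ?_⟩
  · intro i j p
    rw [dv_sum]
    simp only [dv_sum, dv_mul, hG _ _ p]
    have e : ∀ v w : Pt M, (if l v = i then (1 : ℝ) else 0) * (if l w = j then 1 else 0) *
        (((M : ℝ) ^ 3)⁻¹ * ((if p = v then 1 else 0) - (if p = w then 1 else 0))) =
        ((M : ℝ) ^ 3)⁻¹ * ((if p = v then (if l v = i then 1 else 0) else 0) *
          (if l w = j then 1 else 0) - (if l v = i then 1 else 0) *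
          (if p = w then (if l w = j then 1 else 0) else 0)) := by
      intro v w
      split_ifs <;> ring
    simp only [e, ← Finset.mul_sum, Finset.sum_sub_distrib, ← Finset.sum_mul, Finset.sum_ite_eq,
      Finset.mem_univ, if_true, classSize]
    ring
  · intro e
    unfold volume₂
    calc _ ≤ ∑ i, ∑ j, ∑ v, ∑ w,
          (if l v = i then 1 else 0) * (if l w = j then 1 else 0) * |G v w e| := by
          refine Finset.sum_le_sum fun i _ => Finset.sum_le_sum fun j _ => ?_
          refine (Finset.abs_sum_le_sum_abs _ _).trans (Finset.sum_le_sum fun v _ => ?_)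
          refine (Finset.abs_sum_le_sum_abs _ _).trans (Finset.sum_le_sum fun w _ => ?_)
          rw [abs_mul, abs_of_nonneg (by positivity :
            (0 : ℝ) ≤ (if l v = i then 1 else 0) * (if l w = j then 1 else 0))]
      _ = ∑ v, ∑ w, ∑ i, ∑ j,
          (if l v = i then 1 else 0) * (if l w = j then 1 else 0) * |G v w e| := by
          rw [Finset.sum_congr rfl fun i _ => Finset.sum_comm, Finset.sum_comm]
          refine Finset.sum_congr rfl fun v _ => ?_
          rw [Finset.sum_congr rfl fun i _ => Finset.sum_comm, Finset.sum_comm]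
      _ ≤ _ := by
          refine le_of_eq (Finset.sum_congr rfl fun v _ => Finset.sum_congr rfl fun w _ => ?_)
          simp only [← Finset.sum_mul, ← Finset.mul_sum, Finset.sum_ite_eq, Finset.mem_univ,
            if_true, one_mul]

end CoarseFlows

/-! ### Interpolation from the small torus to the large one -/

section Rescaling

/-- The vertex of the `M`-cycle below a vertex of the `N`-cycle. -/
def pos (M : ℕ) {N : ℕ} (X : ZMod N) : ℕ := X.val * M / N

/-- Pull-back of a function on the vertices of the `M`-cycle to the vertices of the `N`-cycle,
by linear interpolation. -/
def vtxAvg {M N : ℕ} (f : ZMod M → ℝ) (X : ZMod N) : ℝ :=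
  (M : ℝ)⁻¹ * ∑ t ∈ Finset.range M, f ((X.val * M + t) / N : ℕ)

/-- Pull-back of a function on the edges of the `M`-cycle to the edges of the `N`-cycle,
by linear interpolation. -/
def edgAvg {M N : ℕ} (f : ZMod M → ℝ) (X : ZMod N) : ℝ :=
  (N : ℝ)⁻¹ * ∑ t ∈ Finset.range N, f ((((X.val + 1) * M + t) / N : ℕ) - 1)

variable {M N : ℕ} [NeZero M] [NeZero N]

/-- Adding `N` to `n` adds a full turn `M` to the quotient, so only the residue of `n` matters. -/
lemma cast_val_mul_div {M N : ℕ} [NeZero N] (n a : ℕ) :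
    ((((n : ZMod N).val * M + a) / N : ℕ) : ZMod M) = ((n * M + a) / N : ℕ) := by
  have h : n * M + a = (n % N) * M + a + N * (M * (n / N)) := by
    conv_lhs => rw [← Nat.mod_add_div n N]
    ring
  rw [ZMod.val_natCast, h, Nat.add_mul_div_left _ _ (NeZero.pos N)]
  simp

lemma pos_natCast {M N : ℕ} [NeZero N] (n : ℕ) : ((pos M (n : ZMod N) : ℕ) : ZMod M) = (n * M / N : ℕ) :=
  cast_val_mul_div n 0

lemma vtxAvg_natCast {M : ℕ} (f : ZMod M → ℝ) (n : ℕ) : vtxAvg f (n : ZMod N) =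
    (M : ℝ)⁻¹ * ∑ t ∈ Finset.range M, f ((n * M + t) / N : ℕ) := by
  unfold vtxAvg
  simp only [cast_val_mul_div]

lemma edgAvg_natCast {M : ℕ} (f : ZMod M → ℝ) (n : ℕ) : edgAvg f (n : ZMod N) =
    (N : ℝ)⁻¹ * ∑ t ∈ Finset.range N, f ((((n + 1) * M + t) / N : ℕ) - 1) := by
  unfold edgAvg
  simp only [add_one_mul, add_assoc, cast_val_mul_div]

/-- Divide the circle into `MN` units, so that a vertex of the `N`-cycle covers `M` of them and a
vertex of the `M`-cycle covers `N`. Shifting a block of `N` terms by `M` changes its sum as shifting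
a block of `M` terms by `N` does: both compare two splittings of `M + N` consecutive terms. -/
lemma edgAvg_sub (f : ZMod M → ℝ) (X : ZMod N) :
    edgAvg f X - edgAvg f (X - 1) = M / N * vtxAvg (fun m => f m - f (m - 1)) X := by
  obtain ⟨n, hn⟩ : ∃ n : ℕ, X = (n + 1 : ℕ) :=
    ⟨X.val + (N - 1), by rw [add_assoc, Nat.sub_add_cancel (NeZero.pos N)]; simp⟩
  have hn' : X - 1 = (n : ℕ) := by rw [hn]; simp
  rw [hn', hn, edgAvg_natCast, edgAvg_natCast, vtxAvg_natCast]
  have hM : (M : ℝ) ≠ 0 := NeZero.ne _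
  set g : ℕ → ℝ := fun s => f ((((n + 1) * M + s) / N : ℕ) - 1) with hg
  have h1 := Finset.sum_range_add g M N
  have h2 := Finset.sum_range_add g N M
  rw [add_comm M N] at h1
  have h3 : ∑ t ∈ Finset.range N, f ((((n + 1 + 1) * M + t) / N : ℕ) - 1) =
      ∑ t ∈ Finset.range N, g (M + t) := by
    refine Finset.sum_congr rfl fun t _ => ?_
    simp only [hg]
    rw [show (n + 1) * M + (M + t) = (n + 1 + 1) * M + t by ring]
  have h4 : ∑ t ∈ Finset.range M, f (((n + 1) * M + t) / N : ℕ) =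
      ∑ t ∈ Finset.range M, g (N + t) := by
    refine Finset.sum_congr rfl fun t _ => ?_
    simp only [hg]
    rw [show (n + 1) * M + (N + t) = (n + 1) * M + t + N by ring,
      Nat.add_div_right _ (NeZero.pos N)]
    simp
  rw [Finset.sum_sub_distrib, h3, h4]
  have h5 : ∑ t ∈ Finset.range M, f ((((n + 1) * M + t) / N : ℕ) - 1) =
      ∑ t ∈ Finset.range M, g t := rfl
  have h6 : ∑ t ∈ Finset.range N, f ((((n + 1) * M + t) / N : ℕ) - 1) =
      ∑ t ∈ Finset.range N, g t := rfl
  rw [h5, h6]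
  have h7 : ∑ t ∈ Finset.range N, g (M + t) - ∑ t ∈ Finset.range N, g t =
      ∑ t ∈ Finset.range M, g (N + t) - ∑ t ∈ Finset.range M, g t := by linarith
  rw [← mul_sub, h7]
  field_simp

lemma sum_range_mul (h : ℕ → ℝ) (a b : ℕ) :
    ∑ s ∈ Finset.range (a * b), h s =
      ∑ i ∈ Finset.range a, ∑ j ∈ Finset.range b, h (i * b + j) := by
  induction a with
  | zero => simp
  | succ a ih => rw [add_one_mul, Finset.sum_range_add, ih, Finset.sum_range_succ]

lemma sum_zmod (g : ℕ → ℝ) : ∑ X : ZMod N, g X.val = ∑ n ∈ Finset.range N, g n := by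
  obtain ⟨n, rfl⟩ : ∃ n, N = n + 1 := ⟨N - 1, by have := NeZero.pos N; omega⟩
  exact Fin.sum_univ_eq_sum_range g (n + 1)

/-- The samples run once through all `MN` units, `N` of them over each vertex of the `M`-cycle. -/
lemma sum_vtxAvg (f : ZMod M → ℝ) : ∑ X : ZMod N, vtxAvg f X = N / M * ∑ m, f m := by
  unfold vtxAvg
  rw [← Finset.mul_sum, sum_zmod (fun x => ∑ t ∈ Finset.range M, f ((x * M + t) / N : ℕ)),
    ← sum_range_mul (fun s => f (s / N : ℕ)), mul_comm N M, sum_range_mul]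
  have h : ∀ i, ∑ j ∈ Finset.range N, f ((i * N + j) / N : ℕ) = N * f (i : ℕ) := by
    intro i
    have : ∀ j ∈ Finset.range N, f ((i * N + j) / N : ℕ) = f (i : ℕ) := by
      intro j hj
      rw [mul_comm, Nat.mul_add_div (NeZero.pos N), Nat.div_eq_of_lt (Finset.mem_range.1 hj),
        add_zero]
    rw [Finset.sum_congr rfl this]
    simp
  have h' : ∑ m : ZMod M, f m = ∑ n ∈ Finset.range M, f (n : ℕ) := by
    rw [← sum_zmod (fun n => f (n : ℕ))]
    simp
  simp only [h, ← Finset.mul_sum, h']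
  ring

lemma vtxAvg_sum {M N : ℕ} {ι : Type*} (s : Finset ι) (f : ι → ZMod M → ℝ) (X : ZMod N) :
    vtxAvg (fun m => ∑ i ∈ s, f i m) X = ∑ i ∈ s, vtxAvg (f i) X := by
  unfold vtxAvg
  rw [Finset.sum_comm, Finset.mul_sum]

lemma vtxAvg_mul {M N : ℕ} (a : ℝ) (f : ZMod M → ℝ) (X : ZMod N) :
    vtxAvg (fun m => a * f m) X = a * vtxAvg f X := by
  unfold vtxAvg
  rw [← Finset.mul_sum]
  ring

lemma vtxAvg_add {M N : ℕ} (f g : ZMod M → ℝ) (X : ZMod N) :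
    vtxAvg (fun m => f m + g m) X = vtxAvg f X + vtxAvg g X := by
  unfold vtxAvg
  rw [Finset.sum_add_distrib, mul_add]

lemma vtxAvg_sub {M N : ℕ} (f g : ZMod M → ℝ) (X : ZMod N) :
    vtxAvg (fun m => f m - g m) X = vtxAvg f X - vtxAvg g X := by
  unfold vtxAvg
  rw [Finset.sum_sub_distrib, mul_sub]

lemma vtxAvg_const {M N : ℕ} [NeZero M] (c : ℝ) (X : ZMod N) :
    vtxAvg (fun _ : ZMod M => c) X = c := by
  have : (M : ℝ) ≠ 0 := NeZero.ne _
  simp only [vtxAvg, Finset.sum_const, Finset.card_range, nsmul_eq_mul]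
  field_simp

lemma vtxAvg_nonneg {M N : ℕ} {f : ZMod M → ℝ} (hf : ∀ m, 0 ≤ f m) (X : ZMod N) :
    0 ≤ vtxAvg f X :=
  mul_nonneg (by positivity) (Finset.sum_nonneg fun _ _ => hf _)

lemma exists_of_vtxAvg_ne_zero {M N : ℕ} {f : ZMod M → ℝ} {X : ZMod N} (h : vtxAvg f X ≠ 0) :
    ∃ t < M, f ((X.val * M + t) / N : ℕ) ≠ 0 := by
  by_contra! hc
  exact h (by rw [vtxAvg, Finset.sum_eq_zero fun t ht => hc t (Finset.mem_range.1 ht), mul_zero])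

lemma abs_avg_sub_le {n : ℕ} [NeZero n] {f : ℕ → ℝ} {c ε : ℝ} (h : ∀ t < n, |f t - c| ≤ ε) :
    |(n : ℝ)⁻¹ * ∑ t ∈ Finset.range n, f t - c| ≤ ε := by
  have hn : (n : ℝ) ≠ 0 := NeZero.ne _
  have hn' : (0 : ℝ) < n := by exact_mod_cast NeZero.pos n
  have e : (n : ℝ)⁻¹ * ∑ t ∈ Finset.range n, f t - c =
      (n : ℝ)⁻¹ * ∑ t ∈ Finset.range n, (f t - c) := by
    rw [Finset.sum_sub_distrib]
    simp only [Finset.sum_const, Finset.card_range, nsmul_eq_mul]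
    field_simp
  rw [e, abs_mul, abs_of_pos (inv_pos.2 hn')]
  calc _ ≤ (n : ℝ)⁻¹ * ∑ t ∈ Finset.range n, ε := by
        gcongr
        exact (Finset.abs_sum_le_sum_abs _ _).trans
          (Finset.sum_le_sum fun t ht => h t (Finset.mem_range.1 ht))
    _ = ε := by
        simp only [Finset.sum_const, Finset.card_range, nsmul_eq_mul]
        field_simp

/-- The range of `m`, with its shift by one, is wide enough to serve both vertex and edge averages.
-/
lemma abs_vtxAvg_sub_le (hMN : M ≤ N) {f : ZMod M → ℝ} {c ε : ℝ} {X : ZMod N}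
    (h : ∀ m : ℕ, m ≤ pos M X + 2 → pos M X ≤ m → |f ((m : ZMod M) - 1) - c| ≤ ε) :
    |vtxAvg f X - c| ≤ ε := by
  refine abs_avg_sub_le fun t ht => ?_
  have h1 := h ((X.val * M + t) / N + 1) ?_ ?_
  · simpa using h1
  · have : (X.val * M + t) / N ≤ (X.val * M + N) / N := Nat.div_le_div_right (by omega)
    rw [Nat.add_div_right _ (NeZero.pos N)] at this
    unfold pos
    omega
  · have : X.val * M / N ≤ (X.val * M + t) / N := Nat.div_le_div_right (by omega)
    unfold pos
    omega

lemma abs_edgAvg_sub_le {M N : ℕ} [NeZero N] (hMN : M ≤ N) {f : ZMod M → ℝ} {c ε : ℝ} {X : ZMod N}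
    (h : ∀ m : ℕ, m ≤ pos M X + 2 → pos M X ≤ m → |f ((m : ZMod M) - 1) - c| ≤ ε) :
    |edgAvg f X - c| ≤ ε := by
  refine abs_avg_sub_le fun t ht => h _ ?_ ?_
  · have : ((X.val + 1) * M + t) / N ≤ (X.val * M + N + N) / N :=
      Nat.div_le_div_right (by rw [add_one_mul]; omega)
    rw [Nat.add_div_right _ (NeZero.pos N), Nat.add_div_right _ (NeZero.pos N)] at this
    unfold pos
    omega
  · exact Nat.div_le_div_right (by rw [add_one_mul]; omega)

/-- Pull-back of a flow on the `M`-torus to the `N`-torus by bilinear interpolation. -/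
def rescale {M N : ℕ} (φ : Ed M → ℝ) (e : Ed N) : ℝ :=
  if e.1 then vtxAvg (fun a => edgAvg (fun b => φ (true, (a, b))) e.2.2) e.2.1
  else edgAvg (fun a => vtxAvg (fun b => φ (false, (a, b))) e.2.2) e.2.1

/-- Pull-back of a function on the vertices of the `M`-torus to the `N`-torus by bilinear
interpolation. -/
def ptAvg {M N : ℕ} (g : Pt M → ℝ) (X : Pt N) : ℝ :=
  vtxAvg (fun a => vtxAvg (fun b => g (a, b)) X.2) X.1

lemma dv_rescale (φ : Ed M → ℝ) (X : Pt N) :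
    dv (rescale φ) X = M / N * ptAvg (dv φ) X := by
  unfold dv ptAvg rescale
  simp only [if_true, Bool.false_eq_true, if_false]
  rw [edgAvg_sub, ← vtxAvg_sub]
  simp only [edgAvg_sub, ← vtxAvg_sub, vtxAvg_mul]
  rw [← mul_add, ← vtxAvg_add]
  simp only [← vtxAvg_add]

lemma sum_ptAvg (g : Pt M → ℝ) : ∑ X : Pt N, ptAvg g X = (N / M) ^ 2 * ∑ p, g p := by
  unfold ptAvg
  rw [Fintype.sum_prod_type]
  simp only [← vtxAvg_sum, sum_vtxAvg, vtxAvg_mul, ← Finset.mul_sum]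
  rw [Fintype.sum_prod_type]
  ring

end Rescaling

/-! ### Averages over the windows containing a vertex -/

section Windows

variable {M N : ℕ} [NeZero M] [NeZero N]

/-- The weights are zero up to a switch and one afterwards, so the sum telescopes from the switch
on. -/
lemma exists_sum_switch (g : ℕ → ℝ) (δ : ℕ → ℕ) (hδ1 : ∀ y, δ y ≤ 1) (hδ : Monotone δ) (L : ℕ) :
    ∃ k, ∑ y ∈ Finset.range L, (δ y : ℝ) * (g (y + 1) - g y) = g L - g k := by
  induction L with
  | zero => exact ⟨0, by simp⟩
  | succ L ih =>
    rcases Nat.eq_zero_or_pos (δ L) with h | h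
    · refine ⟨L + 1, ?_⟩
      rw [sub_self]
      refine Finset.sum_eq_zero fun y hy => ?_
      have : δ y = 0 := Nat.le_zero.1 (h ▸ hδ (by have := Finset.mem_range.1 hy; omega))
      simp [this]
    · obtain ⟨k, hk⟩ := ih
      refine ⟨k, ?_⟩
      rw [Finset.sum_range_succ, hk, show δ L = 1 from le_antisymm (hδ1 L) h]
      push_cast
      ring

lemma abs_sum_sub_shift_le {h : ℕ → ℝ} {c : ℝ} {L : ℕ} (h0 : |h 0| ≤ c) (hL : |h L| ≤ c) :
    |∑ y ∈ Finset.range L, h y - ∑ y ∈ Finset.range L, h (y + 1)| ≤ 2 * c := by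
  rw [← Finset.sum_sub_distrib, Finset.sum_range_sub']
  exact (abs_sub _ _).trans (by linarith)

/-- While `y` runs over a window, `y * M ≤ N`, so `pos M (X - y)` drops by at most one, and does so
once. The sampled points are thus consecutive except for a single repetition, and the sums differ by
a few boundary terms. -/
lemma abs_sum_pos_sub_le {N : ℕ} [NeZero N] (hMN : M * M ≤ N) {L : ℕ} (hL : L ≤ M + 1)
    {f : ZMod M → ℝ} {b : ℝ} (hf : ∀ m, |f m| ≤ b) (X : ZMod N) {m : ℕ}
    (hm : m ≤ pos M X + 2) (hm' : pos M X ≤ m) :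
    |∑ y ∈ Finset.range L, f ((m : ZMod M) - 1 + (y : ℕ)) -
      ∑ y ∈ Finset.range L, f ((pos M (X - (y : ZMod N)) : ℕ) + (y : ℕ))| ≤ 4 * b := by
  have hb : 0 ≤ b := (abs_nonneg _).trans (hf 0)
  have hshift : ∀ a : ZMod M, |∑ y ∈ Finset.range L, f (a + (y : ℕ)) -
      ∑ y ∈ Finset.range L, f (a + 1 + (y : ℕ))| ≤ 2 * b := by
    intro a
    have := abs_sum_sub_shift_le (h := fun y : ℕ => f (a + (y : ℕ))) (L := L) (hf _) (hf _)
    refine le_trans (le_of_eq ?_) this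
    congr 2
    refine Finset.sum_congr rfl fun y _ => ?_
    push_cast
    ring_nf
  set x := pos M X with hx
  have h1 : |∑ y ∈ Finset.range L, f ((m : ZMod M) - 1 + (y : ℕ)) -
      ∑ y ∈ Finset.range L, f ((x : ZMod M) + (y : ℕ))| ≤ 2 * b := by
    obtain rfl | rfl | rfl : m = x ∨ m = x + 1 ∨ m = x + 2 := by omega
    · have := hshift ((x : ZMod M) - 1)
      rwa [sub_add_cancel] at this
    · simp [hb]
    · have := hshift (x : ZMod M)
      rw [abs_sub_comm] at this
      convert this using 6
      push_cast
      ring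
  have h2 : |∑ y ∈ Finset.range L, f ((x : ZMod M) + (y : ℕ)) -
      ∑ y ∈ Finset.range L, f ((pos M (X - (y : ZMod N)) : ℕ) + (y : ℕ))| ≤ 2 * b := by
    -- The extra turn keeps `n - y` free of truncation.
    set n := X.val + N with hn
    have hnX : (n : ZMod N) = X := by simp [hn]
    have hxn : (x : ZMod M) = (n * M / N : ℕ) := by
      rw [hx, ← pos_natCast, hnX]
    let δ : ℕ → ℕ := fun y => if y < L then n * M / N - (n - y) * M / N else 1
    have hyM : ∀ y < L, y * M ≤ N := fun y hy =>
      (Nat.mul_le_mul_right M (by omega : y ≤ M)).trans hMN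
    have hyN : ∀ y < L, y ≤ n := by
      intro y hy
      have := Nat.le_mul_of_pos_right y (NeZero.pos M)
      have := hyM y hy
      omega
    have hdiv : ∀ y < L, (n - y) * M / N ≤ n * M / N ∧ n * M / N ≤ (n - y) * M / N + 1 := by
      intro y hy
      have h3 := hyM y hy
      constructor
      · exact Nat.div_le_div_right (Nat.mul_le_mul_right _ (Nat.sub_le _ _))
      · rw [← Nat.add_div_right _ (NeZero.pos N)]
        refine Nat.div_le_div_right ?_
        rw [Nat.sub_mul]
        omega
    have hδ1 : ∀ y, δ y ≤ 1 := by
      intro y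
      by_cases hy : y < L
      · simp only [δ, if_pos hy]
        have := hdiv y hy
        omega
      · simp [δ, hy]
    have hδm : Monotone δ := by
      intro y y' hyy
      by_cases hy : y' < L
      · have hy0 : y < L := by omega
        simp only [δ, if_pos hy, if_pos hy0]
        refine Nat.sub_le_sub_left (Nat.div_le_div_right (Nat.mul_le_mul_right _ ?_)) _
        omega
      · simp only [δ, if_neg hy]
        exact hδ1 y
    obtain ⟨k, hk⟩ := exists_sum_switch (fun y : ℕ => f ((x : ZMod M) - 1 + (y : ℕ))) δ hδ1 hδm L
    rw [← Finset.sum_sub_distrib]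
    have e : ∀ y ∈ Finset.range L, f ((x : ZMod M) + (y : ℕ)) -
        f ((pos M (X - (y : ZMod N)) : ℕ) + (y : ℕ)) = (δ y : ℝ) *
        (f ((x : ZMod M) - 1 + ((y + 1 : ℕ) : ZMod M)) - f ((x : ZMod M) - 1 + (y : ℕ))) := by
      intro y hy
      have hy := Finset.mem_range.1 hy
      have e1 : X - (y : ZMod N) = ((n - y : ℕ) : ZMod N) := by
        rw [Nat.cast_sub (hyN y hy), hnX]
      have e2 : ((pos M (X - (y : ZMod N)) : ℕ) : ZMod M) = (x : ZMod M) - (δ y : ℕ) := by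
        rw [e1, pos_natCast, hxn]
        simp only [δ, if_pos hy]
        rw [Nat.cast_sub (hdiv y hy).1]
        ring
      have e3 : (x : ZMod M) - 1 + ((y + 1 : ℕ) : ZMod M) = x + (y : ℕ) := by push_cast; ring
      rw [e2, e3]
      rcases Nat.le_one_iff_eq_zero_or_eq_one.1 (hδ1 y) with h | h
      · simp [h]
      · simp [h]
    rw [Finset.sum_congr rfl e, hk]
    have hfL := hf ((x : ZMod M) - 1 + (L : ℕ))
    have hfk := hf ((x : ZMod M) - 1 + (k : ℕ))
    exact (abs_sub _ _).trans (by linarith)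
  calc _ ≤ _ := abs_sub_le _ (∑ y ∈ Finset.range L, f ((x : ZMod M) + (y : ℕ))) _
    _ ≤ 2 * b + 2 * b := add_le_add h1 h2
    _ = _ := by ring

/-- The sum over the windows of side `L` that contain a vertex of the torus. -/
def winSum {N : ℕ} (L : ℕ) (A : Pt N → ℕ → ℕ → ℝ) (X : Pt N) : ℝ :=
  ∑ y ∈ Finset.range L, ∑ z ∈ Finset.range L, A (X.1 - (y : ℕ), X.2 - (z : ℕ)) y z

lemma winSum_sub {N : ℕ} (L : ℕ) (A A' : Pt N → ℕ → ℕ → ℝ) (X : Pt N) :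
    winSum L (fun b y z => A b y z - A' b y z) X = winSum L A X - winSum L A' X := by
  unfold winSum
  simp only [Finset.sum_sub_distrib]

/-- With the windows held fixed, a step to the right raises the position in each by one. Only the
windows being entered or left contribute, two in each of the `L` rows. -/
lemma abs_winSum_right_sub_le {N : ℕ} {L : ℕ} {A : Pt N → ℕ → ℕ → ℝ} {c : ℝ}
    (hA : ∀ b, ∀ y ≤ L, ∀ z ≤ L, |A b y z| ≤ c) (x y : ZMod N) :
    |winSum L A (x + 1, y) - winSum L (fun b y z => A b (y + 1) z) (x, y)| ≤ L * (2 * c) := by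
  unfold winSum
  rw [Finset.sum_comm, Finset.sum_comm (f := fun u v => A _ (u + 1) v), ← Finset.sum_sub_distrib]
  refine (Finset.abs_sum_le_sum_abs _ _).trans ?_
  calc _ ≤ ∑ z ∈ Finset.range L, 2 * c := by
        refine Finset.sum_le_sum fun z hz => ?_
        have hz := (Finset.mem_range.1 hz).le
        have := abs_sum_sub_shift_le (L := L) (c := c)
          (h := fun u : ℕ => A (x + 1 - (u : ℕ), y - (z : ℕ)) u z)
          (hA _ _ (Nat.zero_le _) _ hz) (hA _ _ le_rfl _ hz)
        simpa only [Nat.cast_add, Nat.cast_one, add_sub_add_right_eq_sub] using this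
    _ = _ := by simp

lemma abs_winSum_up_sub_le {N : ℕ} {L : ℕ} {A : Pt N → ℕ → ℕ → ℝ} {c : ℝ}
    (hA : ∀ b, ∀ y ≤ L, ∀ z ≤ L, |A b y z| ≤ c) (x y : ZMod N) :
    |winSum L A (x, y + 1) - winSum L (fun b y z => A b y (z + 1)) (x, y)| ≤ L * (2 * c) := by
  unfold winSum
  rw [← Finset.sum_sub_distrib]
  refine (Finset.abs_sum_le_sum_abs _ _).trans ?_
  calc _ ≤ ∑ z ∈ Finset.range L, 2 * c := by
        refine Finset.sum_le_sum fun z hz => ?_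
        have hz := (Finset.mem_range.1 hz).le
        have := abs_sum_sub_shift_le (L := L) (c := c)
          (h := fun u : ℕ => A (x - (z : ℕ), y + 1 - (u : ℕ)) z u)
          (hA _ _ hz _ (Nat.zero_le _)) (hA _ _ hz _ le_rfl)
        simpa only [Nat.cast_add, Nat.cast_one, add_sub_add_right_eq_sub] using this
    _ = _ := by simp

lemma abs_winSum_right_up_sub_le {N : ℕ} {L : ℕ} {A : Pt N → ℕ → ℕ → ℝ} {c : ℝ}
    (hA : ∀ b, ∀ y ≤ L + 1, ∀ z ≤ L + 1, |A b y z| ≤ c) (x y : ZMod N) :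
    |winSum L A (x + 1, y + 1) - winSum L (fun b y z => A b (y + 1) (z + 1)) (x, y)| ≤
      L * (4 * c) := by
  have h1 := abs_winSum_right_sub_le (L := L)
    (fun b y hy z hz => hA b y (by omega) z (by omega)) x (y + 1)
  have h2 := abs_winSum_up_sub_le (L := L) (A := fun b y z => A b (y + 1) z)
    (fun b y hy z hz => hA b (y + 1) (by omega) z (by omega)) x y
  refine (abs_sub_le _ _ _).trans ((add_le_add h1 h2).trans (le_of_eq ?_))
  ring

/-- The divergence-free flow with stream function `P`. -/
def curl {N : ℕ} (P : Pt N → ℝ) (e : Ed N) : ℝ :=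
  if e.1 then P (e.2.1, e.2.2 + 1) - P (e.2.1 + 1, e.2.2 + 1)
  else P (e.2.1 + 1, e.2.2 + 1) - P (e.2.1 + 1, e.2.2)

lemma dv_curl {N : ℕ} (P : Pt N → ℝ) (p : Pt N) : dv (curl P) p = 0 := by
  unfold dv curl
  simp only [if_true, Bool.false_eq_true, if_false, sub_add_cancel]
  ring

/-- The edge of the `M`-torus seen at position `(y, z)` in the window with corner `b`. -/
def seen (M : ℕ) {N : ℕ} (d : Bool) (b : Pt N) (y z : ℕ) : Ed M :=
  (d, ((pos M b.1 + y : ℕ), (pos M b.2 + z : ℕ)))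

lemma pos_lt {M N : ℕ} [NeZero M] [NeZero N] (X : ZMod N) : pos M X < M := by
  unfold pos
  rw [Nat.div_lt_iff_lt_mul (NeZero.pos N), mul_comm]
  exact Nat.mul_lt_mul_of_pos_left (ZMod.val_lt X) (NeZero.pos M)

/-- Gluing divergence-free flows whose stream functions are small. -/
lemma exists_glued_circulation {L : ℕ} (hL0 : 0 < L) (hL : L ≤ M) {δ : ℝ} {E : Pt N → Ed M → ℝ}
    (hE : ∀ b p, dv (E b) p = 0)
    (hs : ∀ b x y, x ≤ 2 * M + 1 → y ≤ 2 * M + 1 → |stream (E b) x y| ≤ δ) :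
    ∃ G : Ed N → ℝ, (∀ p, dv G p = 0) ∧ ∀ e,
      |G e - ((L : ℝ) ^ 2)⁻¹ * winSum L (fun b y z => E b (seen M e.1 b y z)) e.2| ≤
        6 * δ / L := by
  -- An average of flows cut off at window borders is not divergence-free. The curl of the averaged
  -- stream functions is, and differs from it only by border terms of size `δ`: at most `6Lδ` before
  -- division by `L²`.
  set A : Pt N → ℕ → ℕ → ℝ := fun b y z => stream (E b) (pos M b.1 + y) (pos M b.2 + z) with hAdef
  have hA : ∀ b, ∀ y ≤ L + 1, ∀ z ≤ L + 1, |A b y z| ≤ δ := by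
    intro b y hy z hz
    have h1 := pos_lt (M := M) b.1
    have h2 := pos_lt (M := M) b.2
    exact hs b _ _ (by omega) (by omega)
  have hA' : ∀ b, ∀ y ≤ L, ∀ z ≤ L, |A b y z| ≤ δ :=
    fun b y hy z hz => hA b y (by omega) z (by omega)
  have hLr : (0 : ℝ) < L := by exact_mod_cast hL0
  refine ⟨fun e => ((L : ℝ) ^ 2)⁻¹ * curl (winSum L A) e, fun p => ?_, ?_⟩
  · rw [dv_mul, dv_curl, mul_zero]
  rintro ⟨d, x, y⟩
  rw [← mul_sub, abs_mul, abs_of_nonneg (by positivity : (0 : ℝ) ≤ ((L : ℝ) ^ 2)⁻¹)]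
  have key : |curl (winSum L A) (d, x, y) -
      winSum L (fun b y z => E b (seen M d b y z)) (x, y)| ≤ L * (4 * δ) + L * (2 * δ) := by
    have h11 := abs_winSum_right_up_sub_le hA x y
    cases d with
    | false =>
      have h10 := abs_winSum_right_sub_le hA' x y
      have e : (fun b y z => E b (seen M false b y z)) =
          fun b y z => A b (y + 1) (z + 1) - A b (y + 1) z := by
        funext b y z
        simp only [hAdef, ← add_assoc, stream_false, seen]
      rw [e, winSum_sub]
      simp only [curl, Bool.false_eq_true, if_false]
      rw [sub_sub_sub_comm]
      exact (abs_sub _ _).trans (add_le_add h11 h10)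
    | true =>
      have h01 := abs_winSum_up_sub_le hA' x y
      have e : (fun b y z => E b (seen M true b y z)) =
          fun b y z => A b y (z + 1) - A b (y + 1) (z + 1) := by
        funext b y z
        simp only [hAdef, ← add_assoc, stream_true (hE b), seen]
      rw [e, winSum_sub]
      simp only [curl, if_true]
      rw [sub_sub_sub_comm]
      exact (abs_sub _ _).trans ((add_le_add h01 h11).trans_eq (add_comm _ _))
  calc _ ≤ ((L : ℝ) ^ 2)⁻¹ * (L * (4 * δ) + L * (2 * δ)) := by gcongr
    _ = _ := by field_simp; ring

/-- Moving average over squares of side `L`. -/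
def smooth {M : ℕ} (L : ℕ) (φ : Ed M → ℝ) (e : Ed M) : ℝ :=
  ((L : ℝ) ^ 2)⁻¹ * ∑ y ∈ Finset.range L, ∑ z ∈ Finset.range L,
    φ (e.1, (e.2.1 + (y : ℕ), e.2.2 + (z : ℕ)))

/-- Moving average over squares of side `L`. -/
def ptSmooth {M : ℕ} (L : ℕ) (g : Pt M → ℝ) (p : Pt M) : ℝ :=
  ((L : ℝ) ^ 2)⁻¹ * ∑ y ∈ Finset.range L, ∑ z ∈ Finset.range L,
    g (p.1 + (y : ℕ), p.2 + (z : ℕ))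

lemma dv_smooth {M : ℕ} (L : ℕ) (φ : Ed M → ℝ) (p : Pt M) :
    dv (smooth L φ) p = ptSmooth L (dv φ) p := by
  unfold smooth ptSmooth
  rw [dv_mul, dv_sum]
  refine congrArg _ (Finset.sum_congr rfl fun y _ => ?_)
  rw [dv_sum]
  simp only [dv, sub_add_eq_add_sub]

lemma sum_ptSmooth {L : ℕ} (hL : 0 < L) (g : Pt M → ℝ) : ∑ p, ptSmooth L g p = ∑ p, g p := by
  unfold ptSmooth
  rw [← Finset.mul_sum, Finset.sum_comm]
  have h : ∀ y z : ℕ, ∑ p : Pt M, g (p.1 + (y : ℕ), p.2 + (z : ℕ)) = ∑ p, g p := fun y z =>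
    Fintype.sum_equiv (Equiv.addRight ((y : ZMod M), (z : ZMod M))) _ _ fun _ => rfl
  have h' : ∀ y : ℕ, ∑ p : Pt M, ∑ z ∈ Finset.range L, g (p.1 + (y : ℕ), p.2 + (z : ℕ)) =
      L * ∑ p, g p := by
    intro y
    rw [Finset.sum_comm]
    simp [h]
  have hLr : (L : ℝ) ≠ 0 := by positivity
  simp only [h', Finset.sum_const, Finset.card_range, nsmul_eq_mul]
  field_simp

/-- If all windows carry the same `φ`, their average at `X` is a moving average of `φ` near the
image of `X`. The two coordinates are exchanged one after the other, at `4b` per line. -/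
lemma abs_smooth_sub_le (hMN : M * M ≤ N) {L : ℕ} (hL0 : 0 < L) (hL : L ≤ M + 1) {φ : Ed M → ℝ}
    {b : ℝ} (hφ : ∀ e, |φ e| ≤ b) (d : Bool) (X : Pt N) {m n : ℕ}
    (hm : m ≤ pos M X.1 + 2) (hm' : pos M X.1 ≤ m)
    (hn : n ≤ pos M X.2 + 2) (hn' : pos M X.2 ≤ n) :
    |smooth L φ (d, ((m : ZMod M) - 1, (n : ZMod M) - 1)) -
      ((L : ℝ) ^ 2)⁻¹ * winSum L (fun b y z => φ (seen M d b y z)) X| ≤ 8 * b / L := by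
  have hLr : (0 : ℝ) < L := by exact_mod_cast hL0
  unfold smooth winSum
  rw [← mul_sub, abs_mul, abs_of_nonneg (by positivity : (0 : ℝ) ≤ ((L : ℝ) ^ 2)⁻¹)]
  have h1 : ∀ y ∈ Finset.range L, |∑ z ∈ Finset.range L,
        φ (d, ((m : ZMod M) - 1 + (y : ℕ), (n : ZMod M) - 1 + (z : ℕ))) -
      ∑ z ∈ Finset.range L, φ (d, ((m : ZMod M) - 1 + (y : ℕ),
        (pos M (X.2 - (z : ZMod N)) : ℕ) + (z : ℕ)))| ≤ 4 * b := fun y _ =>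
    abs_sum_pos_sub_le hMN hL (f := fun q => φ (d, ((m : ZMod M) - 1 + (y : ℕ), q)))
      (fun _ => hφ _) X.2 hn hn'
  have h2 : ∀ z ∈ Finset.range L, |∑ y ∈ Finset.range L,
        φ (d, ((m : ZMod M) - 1 + (y : ℕ), (pos M (X.2 - (z : ZMod N)) : ℕ) + (z : ℕ))) -
      ∑ y ∈ Finset.range L, φ (d, ((pos M (X.1 - (y : ZMod N)) : ℕ) + (y : ℕ),
        (pos M (X.2 - (z : ZMod N)) : ℕ) + (z : ℕ)))| ≤ 4 * b := fun z _ =>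
    abs_sum_pos_sub_le hMN hL (f := fun q => φ (d, (q, (pos M (X.2 - (z : ZMod N)) : ℕ) + (z : ℕ))))
      (fun _ => hφ _) X.1 hm hm'
  have h1' := (Finset.abs_sum_le_sum_abs _ _).trans (Finset.sum_le_sum h1)
  have h2' := (Finset.abs_sum_le_sum_abs _ _).trans (Finset.sum_le_sum h2)
  rw [Finset.sum_sub_distrib] at h1' h2'
  rw [Finset.sum_comm] at h2'
  rw [Finset.sum_comm (f := fun (z y : ℕ) => φ (d, ((pos M (X.1 - (y : ZMod N)) : ℕ) + (y : ℕ),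
        (pos M (X.2 - (z : ZMod N)) : ℕ) + (z : ℕ))))] at h2'
  simp only [Finset.sum_const, Finset.card_range, nsmul_eq_mul] at h1' h2'
  have h3 := (abs_sub_le _ _ _).trans (add_le_add h1' h2')
  simp only [seen, Nat.cast_add]
  calc _ ≤ ((L : ℝ) ^ 2)⁻¹ * (L * (4 * b) + L * (4 * b)) := by gcongr
    _ = _ := by field_simp; ring

lemma abs_rescale_smooth_sub_le (hMN : M * M ≤ N) {L : ℕ} (hL0 : 0 < L) (hL : L ≤ M + 1)
    {φ : Ed M → ℝ} {b : ℝ} (hφ : ∀ e, |φ e| ≤ b) (e : Ed N) :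
    |rescale (smooth L φ) e -
      ((L : ℝ) ^ 2)⁻¹ * winSum L (fun b y z => φ (seen M e.1 b y z)) e.2| ≤ 8 * b / L := by
  have hMN' : M ≤ N := (Nat.le_mul_self M).trans hMN
  obtain ⟨d, X⟩ := e
  cases d with
  | false =>
    simp only [rescale, Bool.false_eq_true, if_false]
    exact abs_edgAvg_sub_le hMN' fun m hm hm' => abs_vtxAvg_sub_le hMN' fun n hn hn' =>
      abs_smooth_sub_le hMN hL0 hL hφ false X hm hm' hn hn'
  | true =>
    simp only [rescale, if_true]
    exact abs_vtxAvg_sub_le hMN' fun m hm hm' => abs_edgAvg_sub_le hMN' fun n hn hn' =>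
      abs_smooth_sub_le hMN hL0 hL hφ true X hm hm' hn hn'

end Windows

/-! ### Gluing window flows into a multiflow -/

section Gluing

variable {M N : ℕ} [NeZero M] [NeZero N]

lemma ptAvg_sub {M N : ℕ} (g h : Pt M → ℝ) (X : Pt N) :
    ptAvg (fun p => g p - h p) X = ptAvg g X - ptAvg h X := by
  unfold ptAvg
  simp only [vtxAvg_sub]

lemma ptAvg_mul {M N : ℕ} (a : ℝ) (g : Pt M → ℝ) (X : Pt N) :
    ptAvg (fun p => a * g p) X = a * ptAvg g X := by
  unfold ptAvg
  simp only [vtxAvg_mul]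

lemma ptAvg_sum {M N : ℕ} {ι : Type*} (s : Finset ι) (g : ι → Pt M → ℝ) (X : Pt N) :
    ptAvg (fun p => ∑ i ∈ s, g i p) X = ∑ i ∈ s, ptAvg (g i) X := by
  unfold ptAvg
  simp only [vtxAvg_sum]

lemma ptAvg_one {M N : ℕ} [NeZero M] (X : Pt N) : ptAvg (fun _ : Pt M => 1) X = 1 := by
  unfold ptAvg
  simp only [vtxAvg_const]

lemma ptAvg_nonneg {M N : ℕ} {g : Pt M → ℝ} (hg : ∀ p, 0 ≤ g p) (X : Pt N) : 0 ≤ ptAvg g X :=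
  vtxAvg_nonneg (fun _ => vtxAvg_nonneg (fun _ => hg _) _) _

lemma exists_of_ptAvg_ne_zero {M N : ℕ} {g : Pt M → ℝ} {X : Pt N} (h : ptAvg g X ≠ 0) :
    ∃ s < M, ∃ t < M, g (((X.1.val * M + s) / N : ℕ), ((X.2.val * M + t) / N : ℕ)) ≠ 0 := by
  obtain ⟨s, hs, h⟩ := exists_of_vtxAvg_ne_zero h
  obtain ⟨t, ht, h⟩ := exists_of_vtxAvg_ne_zero h
  exact ⟨s, hs, t, ht, h⟩

lemma ptSmooth_sub {M : ℕ} (L : ℕ) (g h : Pt M → ℝ) (p : Pt M) :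
    ptSmooth L (fun p => g p - h p) p = ptSmooth L g p - ptSmooth L h p := by
  unfold ptSmooth
  simp only [Finset.sum_sub_distrib, mul_sub]

lemma ptSmooth_mul {M : ℕ} (L : ℕ) (a : ℝ) (g : Pt M → ℝ) (p : Pt M) :
    ptSmooth L (fun p => a * g p) p = a * ptSmooth L g p := by
  unfold ptSmooth
  simp only [← Finset.mul_sum]
  ring

lemma exists_of_ptSmooth_ne_zero {M L : ℕ} {g : Pt M → ℝ} {p : Pt M} (h : ptSmooth L g p ≠ 0) :
    ∃ y < L, ∃ z < L, g (p.1 + (y : ℕ), p.2 + (z : ℕ)) ≠ 0 := by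
  by_contra! hc
  refine h ?_
  rw [ptSmooth, Finset.sum_eq_zero fun y hy => Finset.sum_eq_zero fun z hz =>
    hc y (Finset.mem_range.1 hy) z (Finset.mem_range.1 hz), mul_zero]

variable {I : Type} [Fintype I] [DecidableEq I]

/-- The smoothed indicator function of a class of vertices, on the larger torus. -/
def blur {M N : ℕ} (L : ℕ) (l : Pt M → I) (i : I) (X : Pt N) : ℝ :=
  ptAvg (ptSmooth L fun p => if l p = i then 1 else 0) X

lemma blur_nonneg {M N : ℕ} {I : Type} [DecidableEq I] (L : ℕ) (l : Pt M → I) (i : I) (X : Pt N) :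
    0 ≤ blur L l i X :=
  ptAvg_nonneg (fun _ => by unfold ptSmooth; positivity) X

lemma sum_blur {N : ℕ} {L : ℕ} (hL : 0 < L) (l : Pt M → I) (X : Pt N) :
    ∑ i, blur L l i X = 1 := by
  have hLr : (L : ℝ) ≠ 0 := by positivity
  have h : ∀ p : Pt M, ∑ i, ptSmooth L (fun p => if l p = i then (1 : ℝ) else 0) p = 1 := by
    intro p
    unfold ptSmooth
    rw [← Finset.mul_sum, Finset.sum_comm]
    simp only [fun y => Finset.sum_comm (s := Finset.univ) (t := Finset.range L)
      (f := fun (i : I) (z : ℕ) => if l (p.1 + (y : ℕ), p.2 + (z : ℕ)) = i then (1 : ℝ) else 0)]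
    simp
    field_simp
  unfold blur
  rw [← ptAvg_sum]
  simp only [h, ptAvg_one]

lemma sum_blur_pt {I : Type} [DecidableEq I] {L : ℕ} (hL : 0 < L) (l : Pt M → I) (i : I) :
    ∑ X : Pt N, blur L l i X = (N / M) ^ 2 * classSize l i := by
  unfold blur
  rw [sum_ptAvg, sum_ptSmooth hL, classSize]

/-- The scales match: `(M/N) · M⁻³ = N⁻³ · (N/M)²`, and class sizes grow by `(N/M)²`. The result is
therefore exactly a flow between the blurred classes with weight `N⁻³` per pair. -/
lemma dv_rescale_smooth_coarseFlow {I : Type} [DecidableEq I] {L : ℕ} {l : Pt M → I}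
    {F : I → I → Ed M → ℝ} (hF : IsCoarseFlow l F) (i j : I) (X : Pt N) :
    dv (rescale (smooth L (F i j))) X = M / N * (((M : ℝ) ^ 3)⁻¹ *
      (classSize l j * blur L l i X - classSize l i * blur L l j X)) := by
  have h : dv (smooth L (F i j)) = fun p => ((M : ℝ) ^ 3)⁻¹ *
      (classSize l j * ptSmooth L (fun p => if l p = i then 1 else 0) p -
        classSize l i * ptSmooth L (fun p => if l p = j then 1 else 0) p) := by
    funext p
    rw [dv_smooth, ← ptSmooth_mul, ← ptSmooth_mul, ← ptSmooth_sub, ← ptSmooth_mul]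
    congr 1
    funext p
    exact hF i j p
  rw [dv_rescale, h, ptAvg_mul, ptAvg_sub, ptAvg_mul, ptAvg_mul]
  rfl

theorem exists_glued_multiflow (hMN : M * M ≤ N) {L D : ℕ} (hL0 : 0 < L) (hL : L ≤ M)
    {l : Pt M → I}
    (hD : ∀ i (v w : Pt N), blur L l i v ≠ 0 → blur L l i w ≠ 0 →
      (w.1 - v.1).valMinAbs.natAbs ≤ D ∧ (w.2 - v.2).valMinAbs.natAbs ≤ D)
    {F : Pt N → I → I → Ed M → ℝ} (hF : ∀ b, IsCoarseFlow l (F b)) {B δ : ℝ}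
    (hB : ∀ b e, volume₂ (F b) e ≤ B)
    (hs : ∀ b b' i j x y, x ≤ 2 * M + 1 → y ≤ 2 * M + 1 →
      |stream (fun e => F b i j e - F b' i j e) x y| ≤ δ) :
    ∃ G : Pt N → Pt N → Ed N → ℝ, IsMultiflow G ∧ ∀ e, volume₂ G e ≤
      ((L : ℝ) ^ 2)⁻¹ * winSum L (fun b y z => volume₂ (F b) (seen M e.1 b y z)) e.2 +
        Fintype.card I ^ 2 * (6 * δ / L + 8 * B / L) + 4 * D / N := by
  have hM : (M : ℝ) ≠ 0 := NeZero.ne _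
  have hN : (N : ℝ) ≠ 0 := NeZero.ne _
  -- The reference flow `F 0` supplies the divergence; only the circulations `F b - F 0` are glued.
  have hcirc := fun i j => exists_glued_circulation (N := N) hL0 hL
    (E := fun b e => F b i j e - F 0 i j e)
    (fun b p => by rw [dv_sub, hF b i j p, hF 0 i j p, sub_self]) (fun b => hs b 0 i j)
  choose C hC0 hC using hcirc
  have hH : ∀ i j (p : Pt N), dv (fun e => rescale (smooth L (F 0 i j)) e + C i j e) p =
      ((N : ℝ) ^ 3)⁻¹ * ((∑ v : Pt N, blur L l j v) * blur L l i p -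
        (∑ v : Pt N, blur L l i v) * blur L l j p) := by
    intro i j p
    rw [dv_add, hC0, add_zero, dv_rescale_smooth_coarseFlow (hF 0), sum_blur_pt hL0,
      sum_blur_pt hL0]
    field_simp
  obtain ⟨G, hG, hGv⟩ := exists_multiflow_of_partition (fun i => blur L l i)
    (fun i v => blur_nonneg L l i v) (fun v => sum_blur hL0 l v) D hD _ hH
  refine ⟨G, hG, fun e => (hGv e).trans ?_⟩
  gcongr
  -- The window averages of `F 0` cancel between the two estimates, leaving those of `F b`.
  have hb : ∀ i j, |rescale (smooth L (F 0 i j)) e + C i j e| ≤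
      ((L : ℝ) ^ 2)⁻¹ * winSum L (fun b y z => |F b i j (seen M e.1 b y z)|) e.2 +
        (6 * δ / L + 8 * B / L) := by
    intro i j
    have h1 := hC i j e
    have h2 := abs_rescale_smooth_sub_le hMN hL0 (by omega : L ≤ M + 1)
      (fun e' => (abs_le_volume₂ (F 0) i j e').trans (hB 0 e')) e
    rw [winSum_sub L (fun b y z => F b i j (seen M e.1 b y z))
      (fun b y z => F 0 i j (seen M e.1 b y z)), mul_sub] at h1
    have h3 : |((L : ℝ) ^ 2)⁻¹ * winSum L (fun b y z => F b i j (seen M e.1 b y z)) e.2| ≤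
        ((L : ℝ) ^ 2)⁻¹ * winSum L (fun b y z => |F b i j (seen M e.1 b y z)|) e.2 := by
      rw [abs_mul, abs_of_nonneg (by positivity : (0 : ℝ) ≤ ((L : ℝ) ^ 2)⁻¹)]
      gcongr
      exact (Finset.abs_sum_le_sum_abs _ _).trans
        (Finset.sum_le_sum fun _ _ => Finset.abs_sum_le_sum_abs _ _)
    rw [abs_le] at h1 h2 h3 ⊢
    constructor <;> linarith [h1.1, h1.2, h2.1, h2.2, h3.1, h3.2]
  refine (Finset.sum_le_sum fun i _ => Finset.sum_le_sum fun j _ => hb i j).trans (le_of_eq ?_)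
  simp only [Finset.sum_add_distrib, ← Finset.mul_sum]
  congr 1
  · congr 1
    unfold winSum volume₂
    have hsw : ∀ g : I → ℕ → ℝ, ∑ i, ∑ y ∈ Finset.range L, g i y =
        ∑ y ∈ Finset.range L, ∑ i, g i y := fun g => Finset.sum_comm
    simp only [hsw]
  · simp
    ring

/-- The cell, in a partition of the torus into `K × K` squares, of a vertex. -/
def cell (K : ℕ) {M : ℕ} [NeZero K] [NeZero M] (p : Pt M) : Fin K × Fin K :=
  have h : ∀ a : ZMod M, a.val / (M / K + 1) < K := fun a => by
    rw [Nat.div_lt_iff_lt_mul (Nat.succ_pos _), mul_comm]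
    exact (ZMod.val_lt a).trans (by
      rw [mul_comm]; exact Nat.lt_mul_div_succ M (NeZero.pos K))
  (⟨p.1.val / (M / K + 1), h p.1⟩, ⟨p.2.val / (M / K + 1), h p.2⟩)

/-- Both points lie over one interval of length `R`, up to smoothing offsets below `L` and
interpolation offsets below one vertex. The quotients `k`, `k'` count full turns, which disappear in
`ZMod N`. -/
lemma natAbs_valMinAbs_le_of_near {R L : ℕ} (hR : 0 < R) {q s t y z : ℕ} {v w : ZMod N}
    (hs : s < M) (ht : t < M) (hy : y < L) (hz : z < L)
    (hv : ((((v.val * M + s) / N : ℕ) : ZMod M) + (y : ℕ)).val / R = q)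
    (hw : ((((w.val * M + t) / N : ℕ) : ZMod M) + (z : ℕ)).val / R = q) :
    (w - v).valMinAbs.natAbs ≤ (N * (R + L) + N + M) / M := by
  have hrep : ∀ (x : ZMod N) (s y : ℕ), s < M → y < L →
      ((((x.val * M + s) / N : ℕ) : ZMod M) + (y : ℕ)).val / R = q →
      ∃ k r m : ℕ, r < R ∧ m < N ∧ x.val * M + s + N * y = N * (q * R + r + M * k) + m := by
    intro x s y _ _ h
    set n := (x.val * M + s) / N + y with hn
    have h1 : ((((x.val * M + s) / N : ℕ) : ZMod M) + (y : ℕ)).val = n % M := by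
      rw [← Nat.cast_add, ZMod.val_natCast]
    rw [h1] at h
    refine ⟨n / M, n % M % R, (x.val * M + s) % N, Nat.mod_lt _ hR, Nat.mod_lt _ (NeZero.pos N), ?_⟩
    have h2 : q * R + n % M % R = n % M := by rw [← h]; exact Nat.div_add_mod' _ _
    rw [h2, Nat.mod_add_div, hn]
    have := Nat.div_add_mod (x.val * M + s) N
    linarith
  obtain ⟨k, r, m, hr, hm, e1⟩ := hrep v s y hs hy hv
  obtain ⟨k', r', m', hr', hm', e2⟩ := hrep w t z ht hz hw
  have hM := NeZero.pos M
  have hcast : ((w.val - v.val - N * (k' - k) : ℤ) : ZMod N) = w - v := by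
    push_cast
    simp
  have hle : (w - v).valMinAbs.natAbs ≤ (w.val - v.val - N * (k' - k) : ℤ).natAbs := by
    refine ZMod.natAbs_min_of_le_div_two N _ _ ?_ (ZMod.natAbs_valMinAbs_le _)
    rw [ZMod.coe_valMinAbs, hcast]
  refine hle.trans ?_
  rw [Nat.le_div_iff_mul_le hM]
  zify
  rw [← abs_of_nonneg (by positivity : (0 : ℤ) ≤ (M : ℤ)), ← abs_mul, abs_le]
  zify at e1 e2 hs ht hy hz hr hr' hm hm'
  have hN : (0 : ℤ) < N := by exact_mod_cast NeZero.pos N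
  have e3 : (w.val - v.val - N * (k' - k) : ℤ) * M =
      N * ((r' - r) + (y - z)) + (m' - m) + (s - t) := by linear_combination e2 - e1
  rw [e3, abs_of_nonneg (by positivity : (0 : ℤ) ≤ (M : ℤ))]
  have hb : (N : ℤ) * ((r' - r) + (y - z)) ≤ N * (R + L) :=
    mul_le_mul_of_nonneg_left (by linarith [(Int.natCast_nonneg r), (Int.natCast_nonneg z)]) hN.le
  have hb' : -(N * (R + L) : ℤ) ≤ (N : ℤ) * ((r' - r) + (y - z)) := by
    rw [← mul_neg]
    exact mul_le_mul_of_nonneg_left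
      (by linarith [(Int.natCast_nonneg r'), (Int.natCast_nonneg y)]) hN.le
  constructor <;> linarith [(Int.natCast_nonneg m), (Int.natCast_nonneg m'),
    (Int.natCast_nonneg s), (Int.natCast_nonneg t)]

lemma dist_le_of_blur_cell_ne_zero {K L : ℕ} [NeZero K] {i : Fin K × Fin K} {v w : Pt N}
    (hv : blur L (cell K (M := M)) i v ≠ 0) (hw : blur L (cell K (M := M)) i w ≠ 0) :
    (w.1 - v.1).valMinAbs.natAbs ≤ (N * (M / K + 1 + L) + N + M) / M ∧
      (w.2 - v.2).valMinAbs.natAbs ≤ (N * (M / K + 1 + L) + N + M) / M := by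
  have key : ∀ x : Pt N, blur L (cell K (M := M)) i x ≠ 0 → ∃ s < M, ∃ t < M, ∃ y < L, ∃ z < L,
      ((((x.1.val * M + s) / N : ℕ) : ZMod M) + (y : ℕ)).val / (M / K + 1) = i.1 ∧
      ((((x.2.val * M + t) / N : ℕ) : ZMod M) + (z : ℕ)).val / (M / K + 1) = i.2 := by
    intro x hx
    obtain ⟨s, hs, t, ht, h⟩ := exists_of_ptAvg_ne_zero hx
    obtain ⟨y, hy, z, hz, h⟩ := exists_of_ptSmooth_ne_zero h
    rw [ite_ne_right_iff] at h
    refine ⟨s, hs, t, ht, y, hy, z, hz, ?_, ?_⟩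
    · rw [← h.1]; rfl
    · rw [← h.1]; rfl
  obtain ⟨s, hs, t, ht, y, hy, z, hz, h1, h2⟩ := key v hv
  obtain ⟨s', hs', t', ht', y', hy', z', hz', h1', h2'⟩ := key w hw
  exact ⟨natAbs_valMinAbs_le_of_near (Nat.succ_pos _) hs hs' hy hy' h1 h1',
    natAbs_valMinAbs_le_of_near (Nat.succ_pos _) ht ht' hz hz' h2 h2'⟩

end Gluing

/-! ### Restoring the capacity bound -/

section Capacity

lemma winSum_le {N L : ℕ} {A : Pt N → ℕ → ℕ → ℝ} {B : ℝ} (hA : ∀ b y z, A b y z ≤ B) (X : Pt N) :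
    winSum L A X ≤ (L : ℝ) ^ 2 * B := by
  unfold winSum
  calc _ ≤ ∑ _y ∈ Finset.range L, ∑ _z ∈ Finset.range L, B := by gcongr; exact hA _ _ _
    _ = _ := by simp; ring

lemma volume₂_add_le {N : ℕ} {ι κ : Type*} [Fintype ι] [Fintype κ] (F G : ι → κ → Ed N → ℝ) {a b : ℝ}
    (ha : 0 ≤ a) (hb : 0 ≤ b) (e : Ed N) :
    volume₂ (fun i j e => a * F i j e + b * G i j e) e ≤ a * volume₂ F e + b * volume₂ G e := by
  unfold volume₂
  simp only [Finset.mul_sum, ← Finset.sum_add_distrib]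
  refine Finset.sum_le_sum fun i _ => Finset.sum_le_sum fun j _ => (abs_add_le _ _).trans ?_
  rw [abs_mul, abs_mul, abs_of_nonneg ha, abs_of_nonneg hb]

lemma isMultiflow_mix {N : ℕ} {F G : Pt N → Pt N → Ed N → ℝ} (hF : IsMultiflow F)
    (hG : IsMultiflow G) {a b : ℝ} (hab : a + b = 1) :
    IsMultiflow fun i j e => a * F i j e + b * G i j e := by
  intro v w p
  rw [dv_add, dv_mul, dv_mul, hF, hG, ← add_mul, hab, one_mul]

lemma width_div_le {K M N : ℕ} (hM : 0 < M) (hN : 0 < N) (hMN : M ≤ N) :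
    4 * (((N * (M / K + 1 + (M / K + 1)) + N + M) / M : ℕ) : ℝ) / N ≤ 8 / K + 16 / M := by
  have hMr : (0 : ℝ) < M := by exact_mod_cast hM
  have hNr : (0 : ℝ) < N := by exact_mod_cast hN
  have hMNr : (M : ℝ) ≤ N := by exact_mod_cast hMN
  have h1 : (((N * (M / K + 1 + (M / K + 1)) + N + M) / M : ℕ) : ℝ) ≤
      ((N * (M / K + 1 + (M / K + 1)) + N + M : ℕ) : ℝ) / M := Nat.cast_div_le
  have h2 : ((M / K : ℕ) : ℝ) ≤ M / K := Nat.cast_div_le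
  have h3 : ((N * (M / K + 1 + (M / K + 1)) + N + M : ℕ) : ℝ) ≤
      N * (2 * ((M : ℝ) / K) + 4) := by
    push_cast
    nlinarith
  calc _ ≤ 4 * ((N * (2 * ((M : ℝ) / K) + 4)) / M) / N := by
        gcongr
        exact h1.trans (by gcongr)
    _ = _ := by
        field_simp
        ring

/-- Flows on the small torus, one for each window of the large torus, with nearly the same stream
functions, can be glued to a flow on the large torus which respects the capacity. -/
theorem exists_glued_multiflow_of_capacity {B ε : ℝ} (hB : 1 / 4 < B) (hε : 0 < ε) :
    ∃ (K : ℕ) (_ : NeZero K) (η : ℝ) (M₁ : ℕ), 0 < η ∧ ∀ (M N : ℕ) [NeZero M] [NeZero N],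
      M₁ ≤ M → M * M ≤ N → M / K + 1 ≤ M ∧
      ∀ F : Pt N → (Fin K × Fin K) → (Fin K × Fin K) → Ed M → ℝ,
        (∀ b, IsCoarseFlow (cell K) (F b)) → (∀ b e, volume₂ (F b) e ≤ B) →
        (∀ b b' i j x y, x ≤ 2 * M + 1 → y ≤ 2 * M + 1 →
          |stream (fun e => F b i j e - F b' i j e) x y| ≤ η * M) →
        ∃ G : Pt N → Pt N → Ed N → ℝ, IsMultiflow G ∧ ∀ e, volume₂ G e ≤ B ∧ volume₂ G e ≤
          (((M / K + 1 : ℕ) : ℝ) ^ 2)⁻¹ *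
            winSum (M / K + 1) (fun b y z => volume₂ (F b) (seen M e.1 b y z)) e.2 + ε := by
  have hB0 : 0 < B := by linarith
  set θ := min 1 (ε / B) with hθ
  have hθ0 : 0 < θ := by positivity
  have hθ1 : θ ≤ 1 := min_le_left _ _
  have hθB : θ * B ≤ ε := by
    have := min_le_right 1 (ε / B)
    rw [← hθ, le_div_iff₀ hB0] at this
    exact this
  -- With weight `θ` on the shortest-path flow, `(1 - θ)(B + ε') + θ/4 ≤ B` restores the capacity,
  -- and `ε' + θ/4 = θ B ≤ ε` bounds the loss.
  set ε' := θ * (B - 1 / 4) with hε'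
  have hε'0 : 0 < ε' := mul_pos hθ0 (by linarith)
  obtain ⟨K₀, hK₀⟩ := exists_nat_gt (32 / ε')
  -- At least two cells per side are needed for `M / K + 1 ≤ M`.
  set K := K₀ + 2 with hK
  have hKr : (0 : ℝ) < K := by positivity
  have hK1 : 8 / (K : ℝ) ≤ ε' / 4 := by
    rw [div_lt_iff₀ hε'0] at hK₀
    rw [div_le_div_iff₀ hKr (by norm_num)]
    have : (K : ℝ) = K₀ + 2 := by rw [hK]; push_cast; ring
    rw [this]
    nlinarith
  -- `K` is fixed first, by the width of the cells. Then `η` has to beat the `K⁴` pairs of cells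
  -- times the ratio `M / L ≤ K`. Finally a large `M` absorbs the remaining errors.
  set η := ε' / (24 * (K : ℝ) ^ 5) with hη
  have hη0 : 0 < η := by positivity
  obtain ⟨M₀, hM₀⟩ := exists_nat_gt ((32 * B * (K : ℝ) ^ 5 + 64) / ε')
  refine ⟨K, ⟨by omega⟩, η, M₀ + 2, hη0, fun M N _ _ hM hMN => ?_⟩
  have hM0 : 0 < M := NeZero.pos M
  have hMr : (0 : ℝ) < M := by exact_mod_cast hM0
  have hL : M / K + 1 ≤ M := by
    have : M / K ≤ M / 2 := Nat.div_le_div_left (by omega) (by omega)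
    omega
  refine ⟨hL, fun F hF hFB hs => ?_⟩
  have hKne : NeZero K := ⟨by omega⟩
  obtain ⟨G, hG, hGv⟩ := exists_glued_multiflow hMN (Nat.succ_pos _) hL
    (fun i v w hv hw => dist_le_of_blur_cell_ne_zero (K := K) hv hw) hF hFB hs
  have hLr : (0 : ℝ) < (M / K + 1 : ℕ) := by positivity
  have hLK : (M : ℝ) ≤ K * (M / K + 1 : ℕ) := by
    exact_mod_cast (Nat.lt_mul_div_succ M (by omega : 0 < K)).le
  have herr : (Fintype.card (Fin K × Fin K) : ℝ) ^ 2 *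
      (6 * (η * M) / (M / K + 1 : ℕ) + 8 * B / (M / K + 1 : ℕ)) +
      4 * (((N * (M / K + 1 + (M / K + 1)) + N + M) / M : ℕ) : ℝ) / N ≤ ε' := by
    have h1 := width_div_le (K := K) hM0 (NeZero.pos N) ((Nat.le_mul_self M).trans hMN)
    have h2 : 6 * (η * M) / (M / K + 1 : ℕ) ≤ 6 * η * K := by
      rw [div_le_iff₀ hLr]
      nlinarith
    have h3 : 8 * B / (M / K + 1 : ℕ) ≤ 8 * B * K / M := by
      rw [div_le_div_iff₀ hLr hMr]
      nlinarith
    have h4 : (32 * B * (K : ℝ) ^ 5 + 64) / M ≤ ε' := by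
      rw [div_lt_iff₀ hε'0] at hM₀
      rw [div_le_iff₀ hMr]
      have : (M₀ : ℝ) + 2 ≤ M := by exact_mod_cast hM
      nlinarith
    have h5 : (K : ℝ) ^ 4 * (6 * η * K) = ε' / 4 := by
      rw [hη]; field_simp; ring
    have h6 : (K : ℝ) ^ 4 * (8 * B * K / M) + 16 / M = (32 * B * (K : ℝ) ^ 5 + 64) / M / 4 := by
      field_simp; ring
    have h7 : (Fintype.card (Fin K × Fin K) : ℝ) ^ 2 = (K : ℝ) ^ 4 := by
      simp; ring
    rw [h7]
    calc _ ≤ (K : ℝ) ^ 4 * (6 * η * K + 8 * B * K / M) + (8 / K + 16 / M) := by gcongr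
      _ ≤ _ := by linarith
  refine ⟨_, isMultiflow_mix hG isMultiflow_stdFlow (sub_add_cancel 1 θ), fun e => ?_⟩
  have hmix := volume₂_add_le G (stdFlow N) (by linarith : 0 ≤ 1 - θ) hθ0.le e
  have hstd := volume₂_stdFlow_le e
  have havg := winSum_le (L := M / K + 1) (A := fun b y z => volume₂ (F b) (seen M e.1 b y z))
    (fun b y z => hFB b _) e.2
  set avg := (((M / K + 1 : ℕ) : ℝ) ^ 2)⁻¹ *
    winSum (M / K + 1) (fun b y z => volume₂ (F b) (seen M e.1 b y z)) e.2 with havg'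
  have havgB : avg ≤ B := by
    rw [havg', inv_mul_le_iff₀ (by positivity)]
    exact havg
  have hG0 := volume₂_nonneg G e
  have hGe : volume₂ G e ≤ avg + ε' := by linarith [hGv e]
  constructor
  · nlinarith
  · nlinarith

end Capacity

/-! ### Window environments and averaged costs -/

section Averaging

variable {M N : ℕ} [NeZero M] [NeZero N]

/-- The fibre of `pos M` over `m` lies in a run of `N / M + 1` consecutive integers starting at `m N
/ M` rounded up. -/
lemma sum_pos_le {g : ZMod M → ℝ} (hg : ∀ m, 0 ≤ g m) :
    ∑ b : ZMod N, g (pos M b : ℕ) ≤ (N / M + 1) * ∑ m, g m := by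
  classical
  have hfib : ∀ m : ZMod M,
      ((Finset.univ.filter fun b : ZMod N => pos M b = m.val).card : ℝ) ≤ N / M + 1 := by
    intro m
    have hM := NeZero.pos M
    set a := (m.val * N + (M - 1)) / M with ha
    have hcard : (Finset.univ.filter fun b : ZMod N => pos M b = m.val).card ≤ N / M + 1 := by
      calc _ ≤ (Finset.Ico a (a + (N / M + 1))).card := by
            refine Finset.card_le_card_of_injOn ZMod.val ?_ (ZMod.val_injective N).injOn
            intro b hb
            simp only [Finset.coe_filter, Finset.mem_univ, true_and, mem_ofPred_eq] at hb
            unfold pos at hb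
            have h1 := Nat.div_mul_le_self (b.val * M) N
            have h2 := Nat.lt_mul_div_succ (b.val * M) (NeZero.pos N)
            rw [hb] at h1 h2
            have h3 := Nat.lt_mul_div_succ (m.val * N + (M - 1)) hM
            rw [← ha] at h3
            have h4 := Nat.lt_mul_div_succ N hM
            simp only [Finset.coe_Ico, mem_Ico]
            constructor
            · rw [ha, Nat.div_le_iff_le_mul_add_pred hM]
              nlinarith
            · have h5 : m.val * N ≤ a * M := by
                have : M * (a + 1) = a * M + M := by ring
                omega
              by_contra! hc
              have h6 : (a + (N / M + 1)) * M ≤ b.val * M := Nat.mul_le_mul_right _ hc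
              nlinarith
        _ = _ := by simp
    calc _ ≤ ((N / M + 1 : ℕ) : ℝ) := by exact_mod_cast hcard
      _ ≤ _ := by
        push_cast
        gcongr
        exact Nat.cast_div_le
  have hpos : ∀ b : ZMod N, pos M b = ((pos M b : ℕ) : ZMod M).val := fun b => by
    rw [ZMod.val_natCast, Nat.mod_eq_of_lt (pos_lt b)]
  rw [← Finset.sum_fiberwise (s := Finset.univ) (g := fun b : ZMod N => ((pos M b : ℕ) : ZMod M)),
    Finset.mul_sum]
  refine Finset.sum_le_sum fun m _ => ?_
  calc _ = ∑ b ∈ Finset.univ.filter fun b : ZMod N => ((pos M b : ℕ) : ZMod M) = m, g m :=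
        Finset.sum_congr rfl fun b hb => by rw [(Finset.mem_filter.1 hb).2]
    _ ≤ _ := by
        rw [Finset.sum_const, nsmul_eq_mul]
        refine mul_le_mul_of_nonneg_right (le_trans ?_ (hfib m)) (hg m)
        gcongr
        rintro rfl
        exact hpos _

lemma sum_seen_le {h : Ed M → ℝ} (hh : ∀ e, 0 ≤ h e) (d : Bool) (y z : ℕ) :
    ∑ b : Pt N, h (seen M d b y z) ≤ (N / M + 1) ^ 2 * ∑ p : Pt M, h (d, p) := by
  have hshift : ∀ (g : ZMod M → ℝ) (y : ℕ), ∑ m, g (m + (y : ℕ)) = ∑ m, g m := fun g y =>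
    Fintype.sum_equiv (Equiv.addRight (y : ZMod M)) _ _ fun _ => rfl
  unfold seen
  simp only [Nat.cast_add]
  rw [Fintype.sum_prod_type, Fintype.sum_prod_type]
  calc _ ≤ ∑ x : ZMod N, (N / M + 1) * ∑ n, h (d, (pos M x : ℕ) + (y : ℕ), n) := by
        refine Finset.sum_le_sum fun x _ => ?_
        rw [← hshift (fun n => h (d, (pos M x : ℕ) + (y : ℕ), n)) z]
        exact sum_pos_le (g := fun n : ZMod M => h (d, (pos M x : ℕ) + (y : ℕ), n + (z : ℕ))) fun _ => hh _
    _ ≤ (N / M + 1) * ((N / M + 1) * ∑ m, ∑ n, h (d, m, n)) := by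
        rw [← Finset.mul_sum, ← hshift (fun m => ∑ n, h (d, m, n)) y]
        gcongr
        exact sum_pos_le (g := fun m : ZMod M => ∑ n, h (d, m + (y : ℕ), n))
          fun _ => Finset.sum_nonneg fun _ _ => hh _
    _ = _ := by ring

/-- The window with corner `b`, as a map from the edges of the small torus to those of the large
torus. -/
def window (M : ℕ) {N : ℕ} (b : Pt N) (e : Ed M) : Ed N :=
  (e.1, (b.1 + (e.2.1 - (pos M b.1 : ℕ)).val, b.2 + (e.2.2 - (pos M b.2 : ℕ)).val))

/-- Injectivity makes the environment read through a window i.i.d., with the law of the small torus.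
-/
lemma window_injective {N : ℕ} (hMN : M ≤ N) (b : Pt N) : Function.Injective (window M b) := by
  have h : ∀ a a' p : ZMod M, (((a - p).val : ℕ) : ZMod N) = (((a' - p).val : ℕ) : ZMod N) →
      a = a' := by
    intro a a' p h
    rw [ZMod.natCast_eq_natCast_iff', Nat.mod_eq_of_lt ((ZMod.val_lt _).trans_le hMN),
      Nat.mod_eq_of_lt ((ZMod.val_lt _).trans_le hMN)] at h
    exact sub_left_injective (ZMod.val_injective M h)
  rintro ⟨d, x, y⟩ ⟨d', x', y'⟩ he
  simp only [window, Prod.mk.injEq, add_right_inj] at he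
  rw [he.1, h _ _ _ he.2.1, h _ _ _ he.2.2]

/-- As long as positions do not wrap around, each window attaches to an edge its true cost-factor in
the large torus. -/
lemma window_seen {M N : ℕ} (d : Bool) (b : Pt N) {y z : ℕ} (hy : y < M) (hz : z < M) :
    window M b (seen M d b y z) = (d, (b.1 + (y : ℕ), b.2 + (z : ℕ))) := by
  simp only [window, seen, Nat.cast_add, add_sub_cancel_left, ZMod.val_natCast,
    Nat.mod_eq_of_lt hy, Nat.mod_eq_of_lt hz]

lemma sum_mul_winSum (c : Ed N → ℝ) (d : Bool) (L : ℕ) (A : Pt N → ℕ → ℕ → ℝ) :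
    ∑ X : Pt N, c (d, X) * winSum L A X = ∑ y ∈ Finset.range L, ∑ z ∈ Finset.range L,
      ∑ b : Pt N, c (d, (b.1 + (y : ℕ), b.2 + (z : ℕ))) * A b y z := by
  unfold winSum
  simp only [Finset.mul_sum]
  rw [Finset.sum_comm]
  refine Finset.sum_congr rfl fun y _ => ?_
  rw [Finset.sum_comm]
  refine Finset.sum_congr rfl fun z _ => ?_
  refine (Fintype.sum_equiv (Equiv.addRight ((y : ZMod N), (z : ZMod N))) _ _ fun b => ?_).symm
  simp only [Equiv.coe_addRight, Prod.fst_add, Prod.snd_add, add_sub_cancel_right]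
  rfl

lemma sq_avg_winSum_le {N L : ℕ} (hL : 0 < L) (A : Pt N → ℕ → ℕ → ℝ) (X : Pt N) :
    (((L : ℝ) ^ 2)⁻¹ * winSum L A X) ^ 2 ≤
      ((L : ℝ) ^ 2)⁻¹ * winSum L (fun b y z => A b y z ^ 2) X := by
  have hLr : (0 : ℝ) < L := by exact_mod_cast hL
  have h : winSum L A X ^ 2 ≤ (L : ℝ) ^ 2 * winSum L (fun b y z => A b y z ^ 2) X := by
    have := sq_sum_le_card_mul_sum_sq (s := Finset.range L ×ˢ Finset.range L)
      (f := fun q : ℕ × ℕ => A (X.1 - (q.1 : ZMod N), X.2 - (q.2 : ZMod N)) q.1 q.2)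
    rw [Finset.sum_product, Finset.sum_product] at this
    simp only [Finset.card_product, Finset.card_range, Nat.cast_mul] at this
    rw [sq (L : ℝ)]
    exact this
  rw [mul_pow, inv_pow, inv_mul_le_iff₀ (by positivity), ← mul_assoc, sq ((L : ℝ) ^ 2),
    mul_assoc ((L : ℝ) ^ 2), mul_inv_cancel₀ (by positivity), mul_one]
  exact h

/-- The preimage of a box is a box, because each coordinate is constrained at most once. -/
lemma measurePreserving_comp_injective {E F : Type*} [Fintype E] [Fintype F] (κ : Measure ℝ)
    [IsProbabilityMeasure κ] {φ : E → F} (hφ : Function.Injective φ) :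
    MeasurePreserving (fun (c : F → ℝ) e => c (φ e)) (Measure.pi fun _ => κ)
      (Measure.pi fun _ => κ) := by
  have hm : Measurable fun (c : F → ℝ) e => c (φ e) := by fun_prop
  refine ⟨hm, (Measure.pi_eq fun s hs => ?_).symm⟩
  rw [Measure.map_apply hm (MeasurableSet.univ_pi hs)]
  have h : (fun (c : F → ℝ) e => c (φ e)) ⁻¹' univ.pi s =
      univ.pi fun i => {x | ∀ e, φ e = i → x ∈ s e} := by
    ext c
    simp only [mem_preimage, Set.mem_pi, mem_univ, true_imp_iff, mem_ofPred_eq]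
    exact ⟨fun h i e he => he ▸ h e, fun h e => h _ e rfl⟩
  rw [h, Measure.pi_pi]
  refine (Fintype.prod_of_injective φ hφ _ _ (fun i hi => ?_) fun e => ?_).symm
  · have : {x | ∀ e, φ e = i → x ∈ s e} = univ := by
      ext x
      simp only [mem_ofPred_eq, mem_univ, iff_true]
      exact fun e he => (hi ⟨e, he⟩).elim
    rw [this, measure_univ]
  · congr 1
    ext x
    simp only [mem_ofPred_eq]
    exact ⟨fun hx e' he => hφ he ▸ hx, fun hx => hx e rfl⟩

end Averaging

/-! ### Costs of feasible flows and of coarse flows -/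

section Costs

variable {N : ℕ} [NeZero N] {κ : Measure ℝ} [IsProbabilityMeasure κ] {cm B : ℝ}

lemma quadCost_mono {E : Type} [Fintype E] {v w c : E → ℝ} (hc : ∀ e, 0 ≤ c e) (hv : ∀ e, 0 ≤ v e)
    (hvw : ∀ e, v e ≤ w e) : quadCost v c ≤ quadCost w c :=
  Finset.sum_le_sum fun e _ =>
    mul_le_mul_of_nonneg_left (pow_le_pow_left₀ (hv e) (hvw e) 2) (hc e)

/-- The volumes of the feasible flows. -/
def feasVol (hN : 3 ≤ N) (B : ℝ) (t : feasibleFlows N B) (e : Ed N) : ℝ := t.1 (edgeEquiv hN e)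

lemma feasVol_nonneg (hN : 3 ≤ N) (t : feasibleFlows N B) (e : Ed N) : 0 ≤ feasVol hN B t e :=
  NNReal.coe_nonneg _

lemma feasVol_le (hN : 3 ≤ N) (t : feasibleFlows N B) (e : Ed N) : feasVol hN B t e ≤ B :=
  t.2.2 _

lemma costN_eq (hN : 3 ≤ N) (c : TorusEdge N → ℝ) :
    costN N c B = infCost (feasVol hN B) fun e => c (edgeEquiv hN e) := by
  unfold costN infCost
  rw [sInf_image']
  refine iInf_congr fun t => ?_
  exact (Fintype.sum_equiv (edgeEquiv hN) _ _ fun _ => rfl).symm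

lemma exists_feasibleFlow_of_multiflow (hN : 3 ≤ N) {G : Pt N → Pt N → Ed N → ℝ}
    (hG : IsMultiflow G) (hB : ∀ e, volume₂ G e ≤ B) :
    ∃ t : feasibleFlows N B, ∀ e, feasVol hN B t e ≤ volume₂ G e := by
  obtain ⟨f, hf, hfG⟩ := exists_standardizedGlobalFlow hN hG
  refine ⟨⟨f, hf, fun e => ?_⟩, hfG⟩
  obtain ⟨e, rfl⟩ := (edgeEquiv hN).surjective e
  exact (hfG e).trans (hB e)

lemma nonempty_feasibleFlows (hN : 3 ≤ N) (hB : 1 / 4 < B) : (feasibleFlows N B).Nonempty := by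
  obtain ⟨t, -⟩ := exists_feasibleFlow_of_multiflow hN isMultiflow_stdFlow
    fun e => (volume₂_stdFlow_le e).trans hB.le
  exact ⟨t, t.2⟩

lemma integrable_costN (hN : 3 ≤ N) (hB : 1 / 4 < B) (hκ : κ (Icc 0 cm) = 1) :
    Integrable (fun c => costN N c B) (environment N κ) := by
  have : Nonempty (feasibleFlows N B) := (nonempty_feasibleFlows hN hB).to_subtype
  simp only [costN_eq hN]
  exact (measurePreserving_comp_injective κ (edgeEquiv hN).injective).integrable_comp_of_integrable
    (integrable_infCost hκ (feasVol_nonneg hN) (feasVol_le hN))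

lemma integral_costN (hN : 3 ≤ N) (hB : 1 / 4 < B) :
    ∫ c, costN N c B ∂(environment N κ) =
      ∫ c, infCost (feasVol hN B) c ∂(Measure.pi fun _ => κ) := by
  have : Nonempty (feasibleFlows N B) := (nonempty_feasibleFlows hN hB).to_subtype
  have hmp := measurePreserving_comp_injective κ (edgeEquiv hN).injective
  rw [← hmp.map_eq, integral_map hmp.measurable.aemeasurable
    (continuous_infCost (feasVol_nonneg hN) (feasVol_le hN)).aestronglyMeasurable]
  simp only [costN_eq hN]
  rfl

lemma infCost_le_of_multiflow (hN : 3 ≤ N) {G : Pt N → Pt N → Ed N → ℝ}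
    (hG : IsMultiflow G) (hB : ∀ e, volume₂ G e ≤ B) {c : Ed N → ℝ} (hc : ∀ e, 0 ≤ c e) :
    infCost (feasVol hN B) c ≤ quadCost (volume₂ G) c := by
  obtain ⟨t, ht⟩ := exists_feasibleFlow_of_multiflow hN hG hB
  exact (infCost_le (feasVol_nonneg hN) (feasVol_le hN) c t).trans
    (quadCost_mono hc (feasVol_nonneg hN t) ht)

/-- The coarse flows between the cells of the torus with volumes at most `B`. -/
abbrev CoarseFlows (K N : ℕ) [NeZero K] [NeZero N] (B : ℝ) : Type :=
  {F : Fin K × Fin K → Fin K × Fin K → Ed N → ℝ // IsCoarseFlow (cell K) F ∧ ∀ e, volume₂ F e ≤ B}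

lemma nonempty_coarseFlows (K : ℕ) [NeZero K] (hB : 1 / 4 < B) : Nonempty (CoarseFlows K N B) := by
  obtain ⟨F, hF, hFv⟩ := exists_coarseFlow (cell K) (isMultiflow_stdFlow (N := N))
  exact ⟨⟨F, hF, fun e => (hFv e).trans ((volume₂_stdFlow_le e).trans hB.le)⟩⟩

lemma infCost_coarseFlows_le (K : ℕ) [NeZero K] (hN : 3 ≤ N) (hB : 1 / 4 < B) {c : Ed N → ℝ}
    (hc : ∀ e, 0 ≤ c e) :
    infCost (fun F : CoarseFlows K N B => volume₂ F.1) c ≤ infCost (feasVol hN B) c := by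
  have : Nonempty (feasibleFlows N B) := (nonempty_feasibleFlows hN hB).to_subtype
  refine le_ciInf fun t => ?_
  obtain ⟨G, hG, hGv⟩ := exists_multiflow hN t.2.1
  obtain ⟨F, hF, hFv⟩ := exists_coarseFlow (cell K) hG
  have hle : ∀ e, volume₂ F e ≤ feasVol hN B t e := fun e => (hFv e).trans (hGv e)
  have h := infCost_le (vol := fun F : CoarseFlows K N B => volume₂ F.1)
    (fun F => volume₂_nonneg F.1) (fun F => F.2.2) c
    ⟨F, hF, fun e => (hle e).trans (feasVol_le hN t e)⟩
  exact h.trans (quadCost_mono hc (volume₂_nonneg F) hle)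

end Costs

/-! ### Comparison of two torus sizes -/

section Comparison

variable {M N : ℕ} [NeZero M] [NeZero N] {κ : Measure ℝ} [IsProbabilityMeasure κ] {cm B : ℝ}

lemma infCost_le_sum_windows {M : ℕ} (hN : 3 ≤ N) {L : ℕ} (hL0 : 0 < L) (hL : L ≤ M) {ε : ℝ} (hε : 0 ≤ ε)
    {v : (Ed M → ℝ) → Ed M → ℝ} (hv0 : ∀ c e, 0 ≤ v c e) (hvB : ∀ c e, v c e ≤ B)
    {c : Ed N → ℝ} (hc : ∀ e, c e ∈ Icc 0 cm) {G : Pt N → Pt N → Ed N → ℝ} (hG : IsMultiflow G)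
    (hGv : ∀ e, volume₂ G e ≤ B ∧ volume₂ G e ≤ ((L : ℝ) ^ 2)⁻¹ *
      winSum L (fun b y z => v (fun e' => c (window M b e')) (seen M e.1 b y z)) e.2 + ε) :
    infCost (feasVol hN B) c ≤ ((L : ℝ) ^ 2)⁻¹ * (∑ d, ∑ y ∈ Finset.range L, ∑ z ∈ Finset.range L,
      ∑ b : Pt N, c (window M b (seen M d b y z)) *
        v (fun e' => c (window M b e')) (seen M d b y z) ^ 2) +
      Fintype.card (Ed N) * (cm * (2 * B * ε + ε ^ 2)) := by
  have hLr : (0 : ℝ) < L := by exact_mod_cast hL0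
  refine (infCost_le_of_multiflow hN hG (fun e => (hGv e).1) fun e => (hc e).1).trans ?_
  have hpt : ∀ e : Ed N, c e * volume₂ G e ^ 2 ≤ ((L : ℝ) ^ 2)⁻¹ * (c e * winSum L (fun b y z =>
      v (fun e' => c (window M b e')) (seen M e.1 b y z) ^ 2) e.2) +
      cm * (2 * B * ε + ε ^ 2) := by
    intro e
    have h1 := (hGv e).2
    have h2 := sq_avg_winSum_le hL0
      (fun b y z => v (fun e' => c (window M b e')) (seen M e.1 b y z)) e.2
    have h3 := winSum_le (L := L)
      (A := fun b y z => v (fun e' => c (window M b e')) (seen M e.1 b y z))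
      (fun b y z => hvB _ _) e.2
    set a := ((L : ℝ) ^ 2)⁻¹ *
      winSum L (fun b y z => v (fun e' => c (window M b e')) (seen M e.1 b y z)) e.2
    have haB : a ≤ B := by
      simp only [a]
      rw [inv_mul_le_iff₀ (by positivity)]
      exact h3
    have hB0 : 0 ≤ B := (hv0 (fun _ => 0) 0).trans (hvB _ _)
    have hsq : volume₂ G e ^ 2 ≤ (a + ε) ^ 2 := pow_le_pow_left₀ (volume₂_nonneg G e) h1 2
    -- Expand `(a + ε)²`, using `a ≤ B` in the cross term and convexity for `a²`.
    have hsq' : volume₂ G e ^ 2 ≤ ((L : ℝ) ^ 2)⁻¹ * winSum L (fun b y z =>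
        v (fun e' => c (window M b e')) (seen M e.1 b y z) ^ 2) e.2 + (2 * B * ε + ε ^ 2) := by
      nlinarith
    calc _ ≤ c e * (((L : ℝ) ^ 2)⁻¹ * winSum L (fun b y z =>
          v (fun e' => c (window M b e')) (seen M e.1 b y z) ^ 2) e.2 + (2 * B * ε + ε ^ 2)) :=
          mul_le_mul_of_nonneg_left hsq' (hc e).1
      _ ≤ _ := by
          rw [mul_add, mul_left_comm]
          gcongr
          exact (hc e).2
  unfold quadCost
  refine (Finset.sum_le_sum fun e _ => hpt e).trans (le_of_eq ?_)
  rw [Finset.sum_add_distrib, ← Finset.mul_sum, Fintype.sum_prod_type]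
  simp only [sum_mul_winSum]
  congr 1
  · congr 1
    refine Finset.sum_congr rfl fun d _ => Finset.sum_congr rfl fun y hy =>
      Finset.sum_congr rfl fun z hz => Finset.sum_congr rfl fun b _ => ?_
    rw [window_seen d b ((Finset.mem_range.1 hy).trans_le hL)
      ((Finset.mem_range.1 hz).trans_le hL)]
  · rw [Finset.sum_const, nsmul_eq_mul, Finset.card_univ]

/-- The expected contribution of an edge seen in a window does not depend on the window. At each of
the `L²` positions a small edge is seen from at most `(N/M + 1)²` corners, and the factor `L²`
cancels the averaging. -/
theorem integral_infCost_le_of_gluing (hN : 3 ≤ N) (hMN : M ≤ N) (hB : 1 / 4 < B)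
    (hκ : κ (Icc 0 cm) = 1) {L : ℕ} (hL0 : 0 < L) (hL : L ≤ M) {ε : ℝ} (hε : 0 ≤ ε)
    {v : (Ed M → ℝ) → Ed M → ℝ} (hv0 : ∀ c e, 0 ≤ v c e) (hvB : ∀ c e, v c e ≤ B)
    (hvm : ∀ e, Measurable fun c => v c e)
    (hglue : ∀ c : Ed N → ℝ, ∃ G : Pt N → Pt N → Ed N → ℝ, IsMultiflow G ∧ ∀ e,
      volume₂ G e ≤ B ∧ volume₂ G e ≤ ((L : ℝ) ^ 2)⁻¹ *
        winSum L (fun b y z => v (fun e' => c (window M b e')) (seen M e.1 b y z)) e.2 + ε) :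
    ∫ c, infCost (feasVol hN B) c ∂(Measure.pi fun _ => κ) ≤
      (N / M + 1) ^ 2 * ∫ c, quadCost (v c) c ∂(Measure.pi fun _ => κ) +
        Fintype.card (Ed N) * (cm * (2 * B * ε + ε ^ 2)) := by
  have hne : Nonempty (feasibleFlows N B) := (nonempty_feasibleFlows hN hB).to_subtype
  have hLr : (0 : ℝ) < L := by exact_mod_cast hL0
  have hmp := fun b : Pt N => measurePreserving_comp_injective κ (window_injective hMN b)
  have hterm : ∀ e : Ed M, Integrable (fun c : Ed M → ℝ => c e * v c e ^ 2)
      (Measure.pi fun _ => κ) := by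
    intro e
    refine Integrable.of_bound ((measurable_pi_apply e).mul
      ((hvm e).pow_const 2)).aestronglyMeasurable (cm * B ^ 2) ?_
    filter_upwards [ae_pi_mem_Icc hκ] with c hc
    rw [Real.norm_of_nonneg (mul_nonneg (hc e).1 (sq_nonneg _))]
    exact mul_le_mul (hc e).2 (pow_le_pow_left₀ (hv0 c e) (hvB c e) 2) (sq_nonneg _)
      ((hc e).1.trans (hc e).2)
  have hint : ∀ (b : Pt N) (e : Ed M), Integrable (fun c : Ed N → ℝ => c (window M b e) *
      v (fun e' => c (window M b e')) e ^ 2) (Measure.pi fun _ => κ) := fun b e =>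
    (hmp b).integrable_comp_of_integrable (hterm e)
  have hval : ∀ (b : Pt N) (e : Ed M), ∫ c : Ed N → ℝ, c (window M b e) *
      v (fun e' => c (window M b e')) e ^ 2 ∂(Measure.pi fun _ => κ) =
      ∫ c : Ed M → ℝ, c e * v c e ^ 2 ∂(Measure.pi fun _ => κ) := by
    intro b e
    conv_rhs => rw [← (hmp b).map_eq]
    exact (integral_map (hmp b).measurable.aemeasurable
      (by rw [(hmp b).map_eq]; exact (hterm e).aestronglyMeasurable)).symm
  set H : Ed M → ℝ := fun e => ∫ c : Ed M → ℝ, c e * v c e ^ 2 ∂(Measure.pi fun _ => κ) with hH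
  have hH0 : ∀ e, 0 ≤ H e := by
    intro e
    refine integral_nonneg_of_ae ?_
    filter_upwards [ae_pi_mem_Icc hκ] with c hc
    exact mul_nonneg (hc e).1 (sq_nonneg _)
  have hquad : ∫ c, quadCost (v c) c ∂(Measure.pi fun _ => κ) = ∑ e, H e := by
    unfold quadCost
    exact integral_finsetSum _ fun e _ => hterm e
  have hintS : Integrable (fun c : Ed N → ℝ => ∑ d, ∑ y ∈ Finset.range L, ∑ z ∈ Finset.range L,
      ∑ b : Pt N, c (window M b (seen M d b y z)) *
        v (fun e' => c (window M b e')) (seen M d b y z) ^ 2) (Measure.pi fun _ => κ) :=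
    integrable_finsetSum _ fun d _ => integrable_finsetSum _ fun y _ =>
      integrable_finsetSum _ fun z _ => integrable_finsetSum _ fun b _ => hint b _
  have hS : ∫ c : Ed N → ℝ, ∑ d, ∑ y ∈ Finset.range L, ∑ z ∈ Finset.range L,
      ∑ b : Pt N, c (window M b (seen M d b y z)) *
        v (fun e' => c (window M b e')) (seen M d b y z) ^ 2 ∂(Measure.pi fun _ => κ) =
      ∑ d, ∑ y ∈ Finset.range L, ∑ z ∈ Finset.range L, ∑ b : Pt N, H (seen M d b y z) := by
    rw [integral_finsetSum _ fun d _ => integrable_finsetSum _ fun y _ =>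
      integrable_finsetSum _ fun z _ => integrable_finsetSum _ fun b _ => hint b _]
    refine Finset.sum_congr rfl fun d _ => ?_
    rw [integral_finsetSum _ fun y _ => integrable_finsetSum _ fun z _ =>
      integrable_finsetSum _ fun b _ => hint b _]
    refine Finset.sum_congr rfl fun y _ => ?_
    rw [integral_finsetSum _ fun z _ => integrable_finsetSum _ fun b _ => hint b _]
    refine Finset.sum_congr rfl fun z _ => ?_
    rw [integral_finsetSum _ fun b _ => hint b _]
    exact Finset.sum_congr rfl fun b _ => hval b _
  calc _ ≤ ∫ c : Ed N → ℝ, (((L : ℝ) ^ 2)⁻¹ * (∑ d, ∑ y ∈ Finset.range L, ∑ z ∈ Finset.range L,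
        ∑ b : Pt N, c (window M b (seen M d b y z)) *
          v (fun e' => c (window M b e')) (seen M d b y z) ^ 2) +
        Fintype.card (Ed N) * (cm * (2 * B * ε + ε ^ 2))) ∂(Measure.pi fun _ => κ) := by
        refine integral_mono_ae (integrable_infCost hκ (feasVol_nonneg hN) (feasVol_le hN))
          ((hintS.const_mul _).add (integrable_const _)) ?_
        filter_upwards [ae_pi_mem_Icc hκ] with c hc
        obtain ⟨G, hG, hGv⟩ := hglue c
        exact infCost_le_sum_windows hN hL0 hL hε hv0 hvB hc hG hGv
    _ = ((L : ℝ) ^ 2)⁻¹ * (∑ d, ∑ y ∈ Finset.range L, ∑ z ∈ Finset.range L,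
        ∑ b : Pt N, H (seen M d b y z)) + Fintype.card (Ed N) * (cm * (2 * B * ε + ε ^ 2)) := by
        rw [integral_add (hintS.const_mul _) (integrable_const _), integral_const_mul, hS]
        simp
    _ ≤ ((L : ℝ) ^ 2)⁻¹ * (∑ d, ∑ _y ∈ Finset.range L, ∑ _z ∈ Finset.range L,
        (N / M + 1) ^ 2 * ∑ p : Pt M, H (d, p)) +
        Fintype.card (Ed N) * (cm * (2 * B * ε + ε ^ 2)) := by
        gcongr with d _ y _ z _
        exact sum_seen_le hH0 d y z
    _ = _ := by
        rw [hquad, Fintype.sum_prod_type (f := H)]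
        simp only [Finset.sum_const, Finset.card_range, nsmul_eq_mul, ← Finset.mul_sum]
        field_simp

/-- The expected cost on a large torus, compared with the expected cost on a small torus. -/
theorem exists_integral_infCost_le (hcm : 0 ≤ cm) (hκ : κ (Icc 0 cm) = 1) (hB : 1 / 4 < B) {ε : ℝ}
    (hε : 0 < ε) :
    ∃ (C : ℝ) (M₁ : ℕ), ∀ (M N : ℕ) [NeZero M] [NeZero N] (hM : 3 ≤ M) (hN : 3 ≤ N), M₁ ≤ M →
      M * M ≤ N → ∫ c, infCost (feasVol hN B) c ∂(Measure.pi fun _ => κ) ≤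
        (N / M + 1) ^ 2 * (∫ c, infCost (feasVol hM B) c ∂(Measure.pi fun _ => κ) + C * M + 1) +
          2 * N ^ 2 * (cm * (2 * B * ε + ε ^ 2)) := by
  have hB0 : 0 ≤ B := by linarith
  obtain ⟨K, _, η, M₁, hη, hglue⟩ := exists_glued_multiflow_of_capacity hB hε
  obtain ⟨ι, _, M₀, hclass⟩ := exists_classes (Fin K × Fin K) hB0 hη
  refine ⟨Fintype.card ι * (cm * B ^ 2 * 2), max M₀ M₁, fun M N _ _ hM hN hMM hMN => ?_⟩
  obtain ⟨hL, hglue⟩ := hglue M N ((le_max_right _ _).trans hMM) hMN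
  have hne := nonempty_coarseFlows (N := M) K hB
  have hneM : Nonempty (feasibleFlows M B) := (nonempty_feasibleFlows hM hB).to_subtype
  obtain ⟨pr, hpr⟩ := hclass M ((le_max_left _ _).trans hMM) (CoarseFlows K M B)
    (fun F => F.1) (fun F => F.2.2) (fun F F' i j p => by rw [F.2.1 i j p, F'.2.1 i j p])
  have hcv0 : ∀ (F : CoarseFlows K M B) e, 0 ≤ volume₂ F.1 e := fun F => volume₂_nonneg F.1
  have hcvB : ∀ (F : CoarseFlows K M B) e, volume₂ F.1 e ≤ B := fun F => F.2.2
  obtain ⟨s, hs, hsm, hsc⟩ := exists_selection_in_class (κ := κ) hcm hκ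
    (vol := fun F : CoarseFlows K M B => volume₂ F.1) hcv0 hcvB pr
  -- The selection `s` never leaves its class, so `hpr` gives the closeness of stream functions for
  -- any two windows.
  have hmain := integral_infCost_le_of_gluing (N := N) (κ := κ) hN
    ((Nat.le_mul_self M).trans hMN) hB hκ (Nat.succ_pos _) hL hε.le
    (v := fun c => volume₂ (s c).1) (fun c => hcv0 (s c)) (fun c => hcvB (s c)) hsm (fun c =>
      hglue (fun b => (s fun e' => c (window M b e')).1) (fun b => (s _).2.1)
        (fun b => (s _).2.2) fun b b' => hpr _ _ (hs _ _))
  have hcoarse : ∫ c, infCost (fun F : CoarseFlows K M B => volume₂ F.1) c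
        ∂(Measure.pi fun _ => κ) ≤
      ∫ c, infCost (feasVol hM B) c ∂(Measure.pi fun _ => κ) := by
    refine integral_mono_ae (integrable_infCost hκ hcv0 hcvB)
      (integrable_infCost hκ (feasVol_nonneg hM) (feasVol_le hM)) ?_
    filter_upwards [ae_pi_mem_Icc hκ] with c hc
    exact infCost_coarseFlows_le K hM hB fun e => (hc e).1
  have hcard : ∀ n : ℕ, [NeZero n] → (Fintype.card (Ed n) : ℝ) = 2 * n ^ 2 := by
    intro n _
    simp
    ring
  have hsqrt : √(Fintype.card (Ed M)) ≤ 2 * M := by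
    rw [hcard, Real.sqrt_le_left (by positivity)]
    nlinarith [sq_nonneg (M : ℝ)]
  rw [hcard] at hmain
  refine hmain.trans ?_
  gcongr
  refine hsc.trans ?_
  have : (Fintype.card ι : ℝ) * ((cm * B ^ 2) * √(Fintype.card (Ed M))) ≤
      Fintype.card ι * (cm * B ^ 2 * 2) * M := by
    calc _ ≤ (Fintype.card ι : ℝ) * ((cm * B ^ 2) * (2 * M)) := by gcongr
      _ = _ := by ring
  linarith

end Comparison

/-! ### Convergence of almost decreasing sequences -/

section Limit

/-- An almost decreasing bounded sequence converges. -/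
lemma exists_tendsto_of_eventually_le {a : ℕ → ℝ} {A : ℝ} (h0 : ∀ n, 0 ≤ a n) (hA : ∀ n, a n ≤ A)
    (h : ∀ ε > 0, ∀ᶠ m in atTop, ∀ᶠ n in atTop, a n ≤ a m + ε) :
    ∃ γ, Tendsto a atTop (𝓝 γ) := by
  have hbb : IsBoundedUnder (· ≥ ·) atTop a := isBoundedUnder_of ⟨0, h0⟩
  have hba : IsBoundedUnder (· ≤ ·) atTop a := isBoundedUnder_of ⟨A, hA⟩
  refine ⟨liminf a atTop, tendsto_order.2 ⟨fun b hb => eventually_lt_of_lt_liminf hb hbb,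
    fun b hb => ?_⟩⟩
  set ε := (b - liminf a atTop) / 3 with hε
  have hε0 : 0 < ε := by rw [hε]; linarith
  have hfr : ∃ᶠ m in atTop, a m < liminf a atTop + ε :=
    frequently_lt_of_liminf_lt hba.isCoboundedUnder_ge (by linarith)
  -- A late index whose value is near the lower limit; almost decrease then keeps all large terms
  -- near it.
  obtain ⟨m, hm, hm'⟩ := (hfr.and_eventually (h ε hε0)).exists
  filter_upwards [hm'] with n hn
  linarith

end Limit

/-! ### Convergence of the expected cost per vertex -/

section Convergence

variable {κ : Measure ℝ} [IsProbabilityMeasure κ] {cm B : ℝ}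

/-- The expected cost per vertex converges. -/
theorem exists_tendsto_integral_costN (hcm : 0 < cm) (hκ : κ (Icc 0 cm) = 1) (hB : 1 / 4 < B) :
    ∃ γ : ℝ, Tendsto (fun N : ℕ => ((N : ℝ) ^ 2)⁻¹ * ∫ c, costN N c B ∂(environment N κ))
      atTop (𝓝 γ) := by
  have hB0 : 0 < B := by linarith
  set a : ℕ → ℝ := fun N => ((N : ℝ) ^ 2)⁻¹ * ∫ c, costN N c B ∂(environment N κ) with ha
  suffices h : ∃ γ, Tendsto (fun n => a (n + 3)) atTop (𝓝 γ) by
    obtain ⟨γ, hγ⟩ := h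
    exact ⟨γ, (tendsto_add_atTop_iff_nat 3).1 hγ⟩
  have h3 : ∀ n : ℕ, 3 ≤ n + 3 := fun n => by omega
  have hne : ∀ n : ℕ, Nonempty (feasibleFlows (n + 3) B) := fun n =>
    (nonempty_feasibleFlows (h3 n) hB).to_subtype
  have haS : ∀ n : ℕ, a (n + 3) = (((n + 3 : ℕ) : ℝ) ^ 2)⁻¹ *
      ∫ c, infCost (feasVol (h3 n) B) c ∂(Measure.pi fun _ => κ) := fun n => by
    simp only [ha]
    rw [integral_costN (h3 n) hB]
  refine exists_tendsto_of_eventually_le (A := 2 * (cm * B ^ 2)) (fun n => ?_) (fun n => ?_)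
    fun ε hε => ?_
  · rw [haS]
    have := hne n
    refine mul_nonneg (by positivity) (integral_nonneg_of_ae ?_)
    filter_upwards [ae_pi_mem_Icc hκ] with c hc
    exact infCost_nonneg fun e => (hc e).1
  · rw [haS, inv_mul_le_iff₀ (by positivity)]
    have := hne n
    calc _ ≤ ∫ _c : Ed (n + 3) → ℝ, Fintype.card (Ed (n + 3)) * (cm * B ^ 2)
          ∂(Measure.pi fun _ => κ) := by
          refine integral_mono_ae (integrable_infCost hκ (feasVol_nonneg _) (feasVol_le _))
            (integrable_const _) ?_
          filter_upwards [ae_pi_mem_Icc hκ] with c hc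
          exact infCost_le_card (feasVol_nonneg _) (feasVol_le _) hc
      _ = _ := by
          simp only [integral_const, probReal_univ, one_smul, Fintype.card_prod, Fintype.card_bool,
            ZMod.card]
          push_cast
          ring
  -- Three errors of size `ε / 3`: the gluing error, controlled by `δ`; the fluctuation term `C / M
  -- + 1 / M²`, small for large `M`; and the factor `(1 + M / N)²`, close to one for large `N`.
  · set δ := min 1 (ε / (6 * cm * (2 * B + 1))) with hδ
    have hδ0 : 0 < δ := by positivity
    have hδ1 : δ ≤ 1 := min_le_left _ _
    have hδε : 2 * (cm * (2 * B * δ + δ ^ 2)) ≤ ε / 3 := by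
      have h := min_le_right 1 (ε / (6 * cm * (2 * B + 1)))
      rw [← hδ, le_div_iff₀ (by positivity)] at h
      have h' : δ ^ 2 ≤ δ := by nlinarith
      have : cm * δ ^ 2 ≤ cm * δ := by gcongr
      linarith
    obtain ⟨C, M₁, hC⟩ := exists_integral_infCost_le (κ := κ) hcm.le hκ hB hδ0
    have hsmall : ∀ᶠ m : ℕ in atTop,
        C / ((m + 3 : ℕ) : ℝ) + (((m + 3 : ℕ) : ℝ) ^ 2)⁻¹ ≤ ε / 3 := by
      have h1 : Tendsto (fun m : ℕ => C / (m : ℝ) + ((m : ℝ) ^ 2)⁻¹) atTop (𝓝 (0 + 0)) :=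
        (tendsto_const_div_atTop_nhds_zero_nat C).add
          ((tendsto_pow_atTop two_ne_zero).comp tendsto_natCast_atTop_atTop).inv_tendsto_atTop
      rw [add_zero] at h1
      exact (((tendsto_add_atTop_iff_nat 3).2 h1).eventually (ge_mem_nhds (by positivity)))
    filter_upwards [hsmall, eventually_ge_atTop M₁] with m hm hmM
    have hlim : ∀ x : ℝ, ∀ᶠ n : ℕ in atTop,
        (1 + ((m + 3 : ℕ) : ℝ) / ((n + 3 : ℕ) : ℝ)) ^ 2 * x ≤ x + ε / 3 := by
      intro x
      have h1 : Tendsto (fun n : ℕ => (1 + ((m + 3 : ℕ) : ℝ) / (n : ℝ)) ^ 2 * x) atTop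
          (𝓝 ((1 + 0) ^ 2 * x)) :=
        (((tendsto_const_div_atTop_nhds_zero_nat _).const_add 1).pow 2).mul_const x
      have h2 : (1 + 0) ^ 2 * x < x + ε / 3 := by linarith
      exact ((tendsto_add_atTop_iff_nat 3).2 h1).eventually (ge_mem_nhds h2)
    filter_upwards [hlim (a (m + 3) + (C / ((m + 3 : ℕ) : ℝ) + (((m + 3 : ℕ) : ℝ) ^ 2)⁻¹)),
      eventually_ge_atTop ((m + 3) * (m + 3))] with n hn hnM
    have hmain := hC (m + 3) (n + 3) (h3 m) (h3 n) (by omega) (by omega)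
    have hMr : (0 : ℝ) < (m + 3 : ℕ) := by positivity
    have hNr : (0 : ℝ) < (n + 3 : ℕ) := by positivity
    rw [haS m] at hn ⊢
    rw [haS n, inv_mul_le_iff₀ (by positivity)]
    set S := ∫ c, infCost (feasVol (h3 m) B) c ∂(Measure.pi fun _ => κ)
    set P : ℝ := ((m + 3 : ℕ) : ℝ)
    set Q : ℝ := ((n + 3 : ℕ) : ℝ)
    have e : (Q / P + 1) ^ 2 * (S + C * P + 1) =
        Q ^ 2 * ((1 + P / Q) ^ 2 * ((P ^ 2)⁻¹ * S + (C / P + (P ^ 2)⁻¹))) := by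
      field_simp
      ring
    rw [e] at hmain
    refine hmain.trans ?_
    rw [mul_comm 2 (Q ^ 2), mul_assoc, ← mul_add]
    refine mul_le_mul_of_nonneg_left ?_ (sq_nonneg Q)
    linarith

end Convergence

end LatticeFlow

end

theorem theorem1 (κ : Measure ℝ) [IsProbabilityMeasure κ]
    (hκ : ∃ cmax : ℝ, 0 < cmax ∧ κ (Set.Icc 0 cmax) = 1)
    (B : ℝ) (hB : 1 / 4 < B) :
    (∀ N : ℕ, 3 ≤ N →
      (LatticeFlow.feasibleFlows N B).Nonempty ∧
      Integrable (fun c => LatticeFlow.costN N c B) (LatticeFlow.environment N κ)) ∧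
    ∃ γ : ℝ,
      Tendsto
        (fun N : ℕ => ((N : ℝ) ^ 2)⁻¹ *
          ∫ c, LatticeFlow.costN N c B ∂(LatticeFlow.environment N κ))
        atTop (𝓝 γ) := by
  obtain ⟨cm, hcm, hκ⟩ := hκ
  exact ⟨fun N hN => by
    have : NeZero N := ⟨by omega⟩
    exact ⟨LatticeFlow.nonempty_feasibleFlows hN hB, LatticeFlow.integrable_costN hN hB hκ⟩,
    LatticeFlow.exists_tendsto_integral_costN hcm hκ hB⟩
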